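/- Let $N\ge 1$ be an integer, let $p,q>1$ and $a,b>0$, and let $G_1,G_2\in C^1(\mathbb{R})$ be real-valued with $G_1(0)=G_2(0)=0$, $G_1(s)\ge a|s|^p$ and $G_2(s)\ge b|s|^q$ for all $s\in\mathbb{R}$. Let $f_1,g_1,f_2,g_2\in C_c^\infty(\mathbb{R}^N)$ be real-valued with $\int_{\mathbb{R}^N}g_1\,dx>0$ and $\int_{\mathbb{R}^N}g_2\,dx>0$, and put $r_0=\sup\{|x| : x\in \operatorname{supp} f_1\cup\operatorname{supp} f_2\cup\operatorname{supp} g_1\cup\operatorname{supp} g_2\}$. For $\varepsilon>0$ and $0<T<\infty$ consider $$\partial_t^2u-\Delta u=G_1(v),\qquad \partial_t^2v-\Delta v=G_2(u)\qquad\text{in }\mathbb{R}^N\times(0,T),$$ $$(u,\partial_tu)(0)=(\varepsilon f_1,\varepsilon g_1),\qquad (v,\partial_tv)(0)=(\varepsilon f_2,\varepsilon g_2).$$ A weak solution in $(0,T)$ is a pair of real-valued functions $u,v\in C([0,T);H^1(\mathbb{R}^N))\cap C^1([0,T);L^2(\mathbb{R}^N))$ with $G_1(v),G_2(u)\in L^1(0,T;L^1(\mathbb{R}^N))$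 that attains the initial data and satisfies, for every $\Psi\in C_c^\infty(\mathbb{R}^N\times[0,T))$, $$\varepsilon\int_{\mathbb{R}^N} g_1\Psi(\cdot,0)\,dx+\int_0^T\!\!\int_{\mathbb{R}^N} G_1(v)\Psi\,dx\,dt=\int_0^T\!\!\int_{\mathbb{R}^N}\big(-\partial_tu\,\partial_t\Psi+\nabla u\cdot\nabla\Psi\big)\,dx\,dt,$$ $$\varepsilon\int_{\mathbb{R}^N} g_2\Psi(\cdot,0)\,dx+\int_0^T\!\!\int_{\mathbb{R}^N} G_2(u)\Psi\,dx\,dt=\int_0^T\!\!\int_{\mathbb{R}^N}\big(-\partial_tv\,\partial_t\Psi+\nabla v\cdot\nabla\Psi\big)\,dx\,dt.$$ Set $$F_{SS}(N,p,q)=\Big(p+2+\frac1q\Big)(pq-1)^{-1}-\frac{N-1}{2},\qquad \Gamma_{SS}(N,p,q)=\max\{F_{SS}(N,p,q),F_{SS}(N,q,p)\},$$ and assume $\Gamma_{SS}(N,p,q)\ge0$. Then there are constants $\varepsilon_0>0$ and $C>0$, independent of $\varepsilon$, $T$, $u$ and $v$, such that whenever $0<\varepsilon\le\varepsilon_0$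 and $(u,v)$ is a weak solution in $(0,T)$ with $\operatorname{supp}u\cup\operatorname{supp}v\subset\{(x,t)\in\mathbb{R}^N\times[0,T) : |x|\le r_0+t\}$, one has $$T\le\begin{cases}C\varepsilon^{-\Gamma_{SS}(N,p,q)^{-1}} & \text{if }\Gamma_{SS}(N,p,q)>0,\\[2pt] \exp\big(C\varepsilon^{-\min\{p(pq-1),\,q(pq-1)\}}\big) & \text{if }\Gamma_{SS}(N,p,q)=0,\ p\ne q,\\[2pt] \exp\big(C\varepsilon^{-p(p-1)}\big) & \text{if }\Gamma_{SS}(N,p,q)=0,\ p=q.\end{cases}$$ -/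

import Mathlib

open MeasureTheory Set
open scoped ContDiff

namespace WaveSystem

/-- The Euclidean space `ℝᴺ`. -/
abbrev Space (N : ℕ) : Type := EuclideanSpace ℝ (Fin N)

/-- `L²(ℝᴺ)`, real valued. -/
abbrev L2 (N : ℕ) : Type := Lp ℝ 2 (volume : Measure (Space N))

/-- `L²(ℝᴺ; ℝᴺ)`, the space in which gradients live. -/
abbrev L2Vec (N : ℕ) : Type := Lp (Space N) 2 (volume : Measure (Space N))

/-- `f ∈ C_c^∞(ℝᴺ)`. -/
def IsCcSmooth {N : ℕ} (f : Space N → ℝ) : Prop :=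
  ContDiff ℝ ∞ f ∧ HasCompactSupport f

/-- `z ∈ L²(ℝᴺ; ℝᴺ)` is the weak gradient of `w ∈ L²(ℝᴺ)`, so that `w ∈ H¹(ℝᴺ)`:
`∫ w ∂ᵢφ = - ∫ zᵢ φ` for all `φ ∈ C_c^∞(ℝᴺ)` and all `i`. -/
def IsWeakGradient {N : ℕ} (w : L2 N) (z : L2Vec N) : Prop :=
  ∀ φ : Space N → ℝ, IsCcSmooth φ → ∀ i : Fin N,
    ∫ x, w x * fderiv ℝ φ x (EuclideanSpace.single i 1) = -∫ x, (z x) i * φ x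

/-- `Ψ ∈ C_c^∞(ℝᴺ × [0, T))`: the restriction to `t ≥ 0` of a smooth function on `ℝᴺ × ℝ`
whose support is compact and contained in `{t < T}`; no condition is imposed at `t = 0`. -/
def IsTestFunction {N : ℕ} (T : ℝ) (Ψ : Space N × ℝ → ℝ) : Prop :=
  ContDiff ℝ ∞ Ψ ∧ HasCompactSupport Ψ ∧ ∀ z ∈ tsupport Ψ, z.2 < T

/-- `F ∈ L¹(0, T; L¹(ℝᴺ))`, as a Bochner space: for almost every `t ∈ (0, T)` the function `F t`
represents the value at `t` of a Bochner integrable function with values in `L¹(ℝᴺ)`. -/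
def MemL1L1 {N : ℕ} (T : ℝ) (F : ℝ → Space N → ℝ) : Prop :=
  ∃ K : ℝ → Lp ℝ 1 (volume : Measure (Space N)),
    IntegrableOn K (Ioo 0 T) ∧
      ∀ᵐ t ∂(volume.restrict (Ioo 0 T)), (K t : Space N → ℝ) =ᵐ[volume] F t

/-- `u` is a weak solution in `(0, T)` of `∂ₜ² u - Δ u = H`, `u(0) = ε f`, `∂ₜ u(0) = ε g`, with
`u ∈ C([0, T); H¹) ∩ C¹([0, T); L²)` and `H ∈ L¹(0, T; L¹)`.
Here `∂ₜ u` is the derivative of the curve `u : [0, T) → L²`, and continuity in `H¹` is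
continuity in `L²` of both `u` and its weak gradient `Du`. -/
structure IsWeakWave {N : ℕ} (T ε : ℝ) (f g : Space N → ℝ) (H : ℝ → Space N → ℝ)
    (u : ℝ → L2 N) : Prop where
  contDiffOn : ContDiffOn ℝ 1 u (Ico 0 T)
  initial : (u 0 : Space N → ℝ) =ᵐ[volume] fun x => ε * f x
  initial_deriv : ((derivWithin u (Ico 0 T) 0 : L2 N) : Space N → ℝ) =ᵐ[volume] fun x => ε * g x
  source : MemL1L1 T H
  weak : ∃ Du : ℝ → L2Vec N,
    ContinuousOn Du (Ico 0 T) ∧ (∀ t ∈ Ico 0 T, IsWeakGradient (u t) (Du t)) ∧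
    ∀ Ψ : Space N × ℝ → ℝ, IsTestFunction T Ψ →
      ε * (∫ x, g x * Ψ (x, 0)) + ∫ t in Ioo 0 T, ∫ x, H t x * Ψ (x, t) =
        ∫ t in Ioo 0 T, ∫ x,
          (-(derivWithin u (Ico 0 T) t x * deriv (fun s => Ψ (x, s)) t)
            + inner ℝ (Du t x) (gradient (fun y => Ψ (y, t)) x))

/-- `(u, v)` is a weak solution in `(0, T)` of `∂ₜ² u - Δ u = G₁(v)`, `∂ₜ² v - Δ v = G₂(u)` with
`(u, ∂ₜ u)(0) = ε (f₁, g₁)` and `(v, ∂ₜ v)(0) = ε (f₂, g₂)`. -/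
def IsWeakSolution {N : ℕ} (G₁ G₂ : ℝ → ℝ) (f₁ g₁ f₂ g₂ : Space N → ℝ) (ε T : ℝ)
    (u v : ℝ → L2 N) : Prop :=
  IsWeakWave T ε f₁ g₁ (fun t x => G₁ (v t x)) u ∧
    IsWeakWave T ε f₂ g₂ (fun t x => G₂ (u t x)) v

/-- `supp u ⊆ {(x, t) ∈ ℝᴺ × [0, T) : |x| ≤ r + t}`. -/
def SupportedInCone {N : ℕ} (r T : ℝ) (u : ℝ → L2 N) : Prop :=
  ∀ t ∈ Ico 0 T, ∀ᵐ x ∂(volume : Measure (Space N)), r + t < ‖x‖ → u t x = 0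

/-- `r₀ = sup {|x| : x ∈ supp (f₁, f₂, g₁, g₂)}`. -/
noncomputable def dataRadius {N : ℕ} (f₁ g₁ f₂ g₂ : Space N → ℝ) : ℝ :=
  sSup (norm '' (tsupport f₁ ∪ tsupport f₂ ∪ tsupport g₁ ∪ tsupport g₂))

/-- `F_SS(N, p, q) = (p + 2 + 1/q) / (pq - 1) - (N - 1)/2`. -/
noncomputable def FSS (N : ℕ) (p q : ℝ) : ℝ :=
  (p + 2 + 1 / q) * (p * q - 1)⁻¹ - ((N : ℝ) - 1) / 2

/-- `Γ_SS(N, p, q) = max {F_SS(N, p, q), F_SS(N, q, p)}`. -/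
noncomputable def ΓSS (N : ℕ) (p q : ℝ) : ℝ :=
  max (FSS N p q) (FSS N q p)

end WaveSystem

/-! ### Measurable representatives and test functions as curves in `L²` -/

namespace WaveSystem

open Filter Topology

/-! The proof is a test function argument. Moving all derivatives onto the test function, each
component satisfies `ε · (data) + ∫ H Ψ = ∫ U □Ψ`, where `H` is its source and `□ = ∂ₜ² - Δ`. Take
`Ψ = χ(t/R) Φ`, with `χ` a cutoff and `Φ` an exact solution of the free wave equation: either `1` or
`((M + t)² - |x|²)^(-α)` with `α = (N - 1)/2`. For `M ≥ r₀ + 1` the singular set of `Φ` avoids the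
cone carrying the solution. Only terms with a derivative of `χ` survive in `□Ψ`, so the right side
lives in the layer `R/2 ≤ t ≤ R`, and Hölder bounds it by a power of the layer energy, `E₂ = ∫
|u|^q` or `E₁ = ∫ |v|^p`, times a power of `R` (`TestedWave.core`, `IsCutoff.hoelder`).

Three estimates result for each equation. `Φ = 1` bounds the source below time `R` by the layer
energy of the unknown (`exists_estimate_const`). The power solution, whose data term is positive for
large `M`, bounds that energy from below by `ε` (`exists_estimate_data`). A superposition of time
translates `M = c + 2^k` with weights `2^(kκ)` bounds the source with weight `(c + t)^(-β)`, at the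
price of a power of `log R` (`exists_estimate_log`); the sums are controlled by
`exists_dyadic_sum_le`.

If `Γ_SS > 0`, the first estimate for both equations and the second for one of them are linear
inequalities in `log E₁`, `log E₂`, `log ε`, `log R`. Eliminating the energies gives `log ε ≤ const
- Γ_SS log R` (`subcritical_elimination`).

If `Γ_SS = 0`, the powers of `R` cancel. With `s = log R`, a logarithmic average `Z(s)` of the
weighted source satisfies `Z' ≥ (δ/K)^P` and `Z ≤ K (Z')^(1/P) s^ν`, where `δ` is a multiple of `ε`.
The first makes `Z` grow linearly, the second then forces blow-up, whence `log T ≲ δ^(-(P-1)/(1-ν))`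
(`IsCutoff.exists_log_bound`). For `p ≠ q` one goes once around the system, so `P = pq`
(`exists_critical_bound`); for `p = q` the two equations are added and `P = p`
(`exists_critical_bound_diag`). -/

instance : Fact ((2 : ENNReal) ≠ ⊤) := ⟨by simp⟩

/-- A measurable curve in `L²` has a jointly measurable representative. -/
theorem exists_measurable_representative {N : ℕ} (u : ℝ → L2 N)
    (hu : ∀ e : L2 N, Measurable fun t => dist e (u t)) :
    ∃ U : Space N × ℝ → ℝ, Measurable U ∧ ∀ t, (fun x => U (x, t)) =ᵐ[volume] u t := by
  classical
  have : SecondCountableTopology (L2 N) := Lp.SecondCountableTopology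
  let e : ℕ → L2 N := TopologicalSpace.denseSeq (L2 N)
  have hex : ∀ (n : ℕ) (t : ℝ), ∃ k, dist (e k) (u t) < (1 / 2) ^ n := by
    intro n t
    obtain ⟨k, hk⟩ := (TopologicalSpace.denseRange_denseSeq (L2 N)).exists_dist_lt (u t)
      (ε := (1 / 2 : ℝ) ^ n) (by positivity)
    exact ⟨k, by rw [dist_comm]; exact hk⟩
  -- Taking the first admissible index makes the choice measurable in `t`.
  let k : ℕ → ℝ → ℕ := fun n t => Nat.find (hex n t)
  have hk : ∀ n, Measurable (k n) := fun n =>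
    measurable_find (hex n) fun m => measurableSet_lt (hu (e m)) measurable_const
  let Un : ℕ → Space N × ℝ → ℝ := fun n z => e (k n z.2) z.1
  have hUn : ∀ n, Measurable (Un n) := by
    intro n
    have h1 : Measurable (fun w : ℕ × Space N => e w.1 w.2) :=
      measurable_from_prod_countable_right fun m => (Lp.stronglyMeasurable (e m)).measurable
    exact h1.comp (((hk n).comp measurable_snd).prodMk measurable_fst)
  refine ⟨fun z => limsup (fun n => Un n z) atTop, Measurable.limsup hUn, fun t => ?_⟩
  have hmeas : ∀ n, Measurable fun x => ‖Un n (x, t) - u t x‖ₑ ^ 2 := fun n =>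
    ((Lp.stronglyMeasurable (e (k n t))).sub
      (Lp.stronglyMeasurable (u t))).measurable.enorm.pow_const 2
  -- The squared `L²` errors are at most `4^(-n)`. Their summability upgrades `L²` convergence to
  -- convergence at almost every `x`, for every fixed `t`, without passing to a subsequence that
  -- depends on `t`.
  have hsum : ∫⁻ x, ∑' n, ‖Un n (x, t) - u t x‖ₑ ^ 2 < ⊤ := by
    rw [lintegral_tsum fun n => (hmeas n).aemeasurable]
    have hle : ∀ n, ∫⁻ x, ‖Un n (x, t) - u t x‖ₑ ^ 2 ≤ ENNReal.ofReal ((1 / 4) ^ n) := by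
      intro n
      have h1 : ∫⁻ x, ‖Un n (x, t) - u t x‖ₑ ^ 2 = eLpNorm (e (k n t) - u t : L2 N) 2 volume ^ 2 := by
        have := eLpNorm_nnreal_pow_eq_lintegral (μ := volume) (p := 2)
          (f := ((e (k n t) - u t : L2 N) : Space N → ℝ)) (by simp)
        simp only [NNReal.coe_ofNat, ENNReal.rpow_ofNat, ENNReal.coe_ofNat] at this
        rw [this]
        refine lintegral_congr_ae ?_
        filter_upwards [Lp.coeFn_sub (e (k n t)) (u t)] with x hx
        rw [hx]; rfl
      rw [h1, ← Lp.enorm_def, ← ofReal_norm, ← ENNReal.ofReal_pow (norm_nonneg _)]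
      apply ENNReal.ofReal_le_ofReal
      have h2 : dist (e (k n t)) (u t) < (1 / 2) ^ n := Nat.find_spec (hex n t)
      rw [dist_eq_norm] at h2
      calc ‖e (k n t) - u t‖ ^ 2 ≤ ((1 / 2) ^ n) ^ 2 := by gcongr
        _ = (1 / 4) ^ n := by rw [← pow_mul, mul_comm, pow_mul]; norm_num
    refine (ENNReal.tsum_le_tsum hle).trans_lt ?_
    rw [← ENNReal.ofReal_tsum_of_nonneg (fun n => by positivity)
      (summable_geometric_of_lt_one (by norm_num) (by norm_num))]
    exact ENNReal.ofReal_lt_top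
  have hae := ae_lt_top (Measurable.tsum hmeas) hsum.ne
  filter_upwards [hae] with x hx
  have h1 : Tendsto (fun n => ‖Un n (x, t) - u t x‖ₑ ^ 2) atTop (𝓝 0) :=
    ENNReal.tendsto_atTop_zero_of_tsum_ne_top hx.ne
  have h2 : Tendsto (fun n => Un n (x, t)) atTop (𝓝 (u t x)) := by
    rw [tendsto_iff_norm_sub_tendsto_zero]
    have h3 : Tendsto (fun n => (‖Un n (x, t) - u t x‖ₑ ^ 2).toReal) atTop (𝓝 0) := by
      exact (ENNReal.tendsto_toReal ENNReal.zero_ne_top).comp h1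
    have h4 := h3.sqrt
    simp only [Real.sqrt_zero] at h4
    refine h4.congr fun n => ?_
    rw [ENNReal.toReal_pow, toReal_enorm, Real.sqrt_sq (norm_nonneg _)]
  exact h2.limsup_eq

theorem exists_measurable_representative_of_continuousOn {N : ℕ} {T : ℝ} {u : ℝ → L2 N}
    (hu : ContinuousOn u (Ico 0 T)) :
    ∃ U : Space N × ℝ → ℝ, Measurable U ∧
      ∀ t ∈ Ioo 0 T, (fun x => U (x, t)) =ᵐ[volume] u t := by
  classical
  obtain ⟨U, hU, h⟩ := exists_measurable_representative ((Ico 0 T).piecewise u fun _ => 0) (by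
    intro e
    have : (fun t => dist e ((Ico 0 T).piecewise u (fun _ => 0) t)) =
        (Ico 0 T).piecewise (fun t => dist e (u t)) (fun _ => dist e 0) := by
      funext t
      by_cases ht : t ∈ Ico 0 T <;> simp [Set.piecewise, ht]
    rw [this]
    exact ContinuousOn.measurable_piecewise ((continuous_const.dist continuous_id).comp_continuousOn hu)
      continuousOn_const
      measurableSet_Ico)
  refine ⟨U, hU, fun t ht => ?_⟩
  have := h t
  rwa [Set.piecewise_eq_of_mem _ _ _ (Ioo_subset_Ico_self ht)] at this

/-- The derivative of `Ψ` in the direction `v`. -/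
noncomputable def dirDeriv {N : ℕ} (v : Space N × ℝ) (Ψ : Space N × ℝ → ℝ) (z : Space N × ℝ) : ℝ :=
  fderiv ℝ Ψ z v

/-- The `i`-th spatial direction in space-time. -/
noncomputable def spaceDir {N : ℕ} (i : Fin N) : Space N × ℝ := (EuclideanSpace.single i 1, 0)

/-- The time direction in space-time. -/
noncomputable def timeDir (N : ℕ) : Space N × ℝ := (0, 1)

/-- The wave operator `∂ₜ² - Δ`. -/
noncomputable def waveOp {N : ℕ} (Ψ : Space N × ℝ → ℝ) (z : Space N × ℝ) : ℝ :=
  dirDeriv (timeDir N) (dirDeriv (timeDir N) Ψ) z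
    - ∑ i, dirDeriv (spaceDir i) (dirDeriv (spaceDir i) Ψ) z

variable {N : ℕ} {T : ℝ} {Ψ : Space N × ℝ → ℝ}

theorem IsTestFunction.dirDeriv (h : IsTestFunction T Ψ) (v : Space N × ℝ) :
    IsTestFunction T (dirDeriv v Ψ) := by
  refine ⟨?_, h.2.1.fderiv_apply ℝ v, fun z hz => h.2.2 z (tsupport_fderiv_apply_subset ℝ v hz)⟩
  exact (h.1.fderiv_right (m := ∞) (by simp)).clm_apply contDiff_const

theorem IsTestFunction.slice (h : IsTestFunction T Ψ) (t : ℝ) :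
    IsCcSmooth (fun x => Ψ (x, t)) := by
  refine ⟨h.1.comp (contDiff_id.prodMk contDiff_const), ?_⟩
  refine HasCompactSupport.comp_isClosedEmbedding h.2.1 (g := fun x : Space N => (x, t)) ?_
  exact ⟨isEmbedding_prodMkLeft t, by
      have : range (fun x : Space N => (x, t)) = univ ×ˢ {t} := by ext ⟨a, b⟩; simp [eq_comm]
      rw [this]; exact isClosed_univ.prod isClosed_singleton⟩

theorem IsTestFunction.hasDerivAt_time (h : IsTestFunction T Ψ) (x : Space N) (t : ℝ) :
    HasDerivAt (fun s => Ψ (x, s)) (WaveSystem.dirDeriv (timeDir N) Ψ (x, t)) t := by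
  have h1 : HasFDerivAt Ψ (fderiv ℝ Ψ (x, t)) (x, t) :=
    (h.1.differentiable (by simp)).differentiableAt.hasFDerivAt
  have h2 : HasDerivAt (fun s : ℝ => (x, s)) ((0 : Space N), (1 : ℝ)) t :=
    (hasDerivAt_const t x).prodMk (hasDerivAt_id t)
  exact h1.comp_hasDerivAt t h2

theorem IsTestFunction.fderiv_slice (h : IsTestFunction T Ψ) (x : Space N) (t : ℝ) (i : Fin N) :
    fderiv ℝ (fun y => Ψ (y, t)) x (EuclideanSpace.single i 1) =
      WaveSystem.dirDeriv (spaceDir i) Ψ (x, t) := by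
  have h1 : HasFDerivAt Ψ (fderiv ℝ Ψ (x, t)) (x, t) :=
    (h.1.differentiable (by simp)).differentiableAt.hasFDerivAt
  have h2 : HasFDerivAt (fun y : Space N => (y, t))
      ((ContinuousLinearMap.id ℝ (Space N)).prod (0 : Space N →L[ℝ] ℝ)) x :=
    (hasFDerivAt_id x).prodMk (hasFDerivAt_const t x)
  have h3 : HasFDerivAt (fun y => Ψ (y, t)) _ x := h1.comp x h2
  rw [h3.fderiv]
  rfl

theorem IsTestFunction.memLp_slice (h : IsTestFunction T Ψ) (t : ℝ) (p : ENNReal) :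
    MemLp (fun x => Ψ (x, t)) p (volume : Measure (Space N)) :=
  (h.slice t).1.continuous.memLp_of_hasCompactSupport (h.slice t).2

theorem IsTestFunction.exists_bound (h : IsTestFunction T Ψ) : ∃ C, ∀ z, ‖Ψ z‖ ≤ C :=
  h.1.continuous.bounded_above_of_compact_support h.2.1

/-- The curve `t ↦ Ψ(·, t)` in `L²`. -/
noncomputable def sliceL2 (h : IsTestFunction T Ψ) (t : ℝ) : L2 N := (h.memLp_slice t 2).toLp _

theorem coeFn_sliceL2 (h : IsTestFunction T Ψ) (t : ℝ) :
    (sliceL2 h t : Space N → ℝ) =ᵐ[volume] fun x => Ψ (x, t) := MemLp.coeFn_toLp _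

theorem inner_sliceL2 (h : IsTestFunction T Ψ) (t : ℝ) (w : L2 N) :
    inner ℝ w (sliceL2 h t) = ∫ x, w x * Ψ (x, t) := by
  rw [L2.inner_def]
  refine integral_congr_ae ?_
  filter_upwards [coeFn_sliceL2 h t] with x hx
  rw [hx]; simp [mul_comm]

/-- The second time derivative is bounded, so the Taylor remainder is `O((s - t)²)` uniformly in
`x`; it vanishes off a fixed compact set of `x`, so the bound passes to the `L²` norm. -/
theorem hasDerivAt_sliceL2 (h : IsTestFunction T Ψ) (t : ℝ) :
    HasDerivAt (sliceL2 h) (sliceL2 (h.dirDeriv (timeDir N)) t) t := by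
  have hd := h.dirDeriv (timeDir N)
  obtain ⟨C, hC⟩ := (hd.dirDeriv (timeDir N)).exists_bound
  have hC0 : 0 ≤ C := (norm_nonneg _).trans (hC 0)
  set K : Set (Space N) := Prod.fst '' tsupport Ψ
  have hK : IsCompact K := h.2.1.isCompact.image continuous_fst
  set g : L2 N := indicatorConstLp 2 hK.measurableSet hK.measure_lt_top.ne (1 : ℝ)
  have hpt : ∀ x s, ‖Ψ (x, s) - Ψ (x, t) - (s - t) * WaveSystem.dirDeriv (timeDir N) Ψ (x, t)‖
      ≤ C * (s - t) ^ 2 := by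
    intro x s
    have h1 : ∀ r, ‖WaveSystem.dirDeriv (timeDir N) Ψ (x, r)
        - WaveSystem.dirDeriv (timeDir N) Ψ (x, t)‖ ≤ C * ‖r - t‖ := fun r =>
      convex_univ.norm_image_sub_le_of_norm_hasDerivWithin_le
        (f := fun r => WaveSystem.dirDeriv (timeDir N) Ψ (x, r))
        (fun y _ => (hd.hasDerivAt_time x y).hasDerivWithinAt) (fun y _ => hC _)
        (mem_univ t) (mem_univ r)
    have h2 : ∀ y ∈ uIcc t s, HasDerivWithinAt
        (fun r => Ψ (x, r) - r * WaveSystem.dirDeriv (timeDir N) Ψ (x, t))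
        (WaveSystem.dirDeriv (timeDir N) Ψ (x, y) - 1 * WaveSystem.dirDeriv (timeDir N) Ψ (x, t))
        (uIcc t s) y := fun y _ =>
      ((h.hasDerivAt_time x y).sub ((hasDerivAt_id y).mul_const _)).hasDerivWithinAt
    have h3 := (convex_uIcc t s).norm_image_sub_le_of_norm_hasDerivWithin_le
      (C := C * ‖s - t‖) h2 (fun y hy => by
        rw [one_mul]
        refine (h1 y).trans ?_
        gcongr
        exact abs_sub_left_of_mem_uIcc hy) left_mem_uIcc right_mem_uIcc
    calc _ = ‖(Ψ (x, s) - s * WaveSystem.dirDeriv (timeDir N) Ψ (x, t)) -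
          (Ψ (x, t) - t * WaveSystem.dirDeriv (timeDir N) Ψ (x, t))‖ := by congr 1; ring
      _ ≤ C * ‖s - t‖ * ‖s - t‖ := h3
      _ = C * (s - t) ^ 2 := by rw [mul_assoc, Real.norm_eq_abs, abs_mul_abs_self, sq]
  have hnorm : ∀ s, ‖sliceL2 h s - sliceL2 h t - (s - t) • sliceL2 hd t‖ ≤
      C * (s - t) ^ 2 * ‖g‖ := by
    intro s
    refine Lp.norm_le_mul_norm_of_ae_le_mul ?_
    filter_upwards [Lp.coeFn_sub (sliceL2 h s - sliceL2 h t) ((s - t) • sliceL2 hd t),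
      Lp.coeFn_sub (sliceL2 h s) (sliceL2 h t), Lp.coeFn_smul (s - t) (sliceL2 hd t),
      coeFn_sliceL2 h s, coeFn_sliceL2 h t, coeFn_sliceL2 hd t,
      (indicatorConstLp_coeFn : (g : Space N → ℝ) =ᵐ[volume] _)] with x h1 h2 h3 h4 h5 h6 h7
    rw [h1, Pi.sub_apply, h2, h3, Pi.sub_apply, Pi.smul_apply, h4, h5, h6, h7, smul_eq_mul]
    by_cases hx : x ∈ K
    · simpa [hx] using hpt x s
    · have h8 : ∀ r, (x, r) ∉ tsupport Ψ := fun r hr => hx ⟨_, hr, rfl⟩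
      have h9 : WaveSystem.dirDeriv (timeDir N) Ψ (x, t) = 0 := by
        by_contra hne
        exact h8 t (tsupport_fderiv_apply_subset ℝ (timeDir N) (subset_tsupport _ hne))
      simp [image_eq_zero_of_notMem_tsupport (h8 _), h9, hx]
  rw [hasDerivAt_iff_isLittleO]
  have hbig : (fun s => sliceL2 h s - sliceL2 h t - (s - t) • sliceL2 hd t) =O[𝓝 t]
      fun s => (s - t) ^ 2 := by
    refine Asymptotics.IsBigO.of_bound (C * ‖g‖) (Eventually.of_forall fun s => ?_)
    refine (hnorm s).trans (le_of_eq ?_)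
    rw [Real.norm_eq_abs, abs_of_nonneg (sq_nonneg (s - t))]; ring
  refine hbig.trans_isLittleO ?_
  have := Asymptotics.isLittleO_pow_sub_sub t (m := 2) (by norm_num)
  simpa only [Real.norm_eq_abs, sq_abs] using this

end WaveSystem

/-! ### From weak solutions to a space-time identity -/

namespace WaveSystem

open Filter Topology

variable {N : ℕ} {T : ℝ} {Ψ : Space N × ℝ → ℝ}

/-- Lebesgue measure on `ℝᴺ × (0, T)`. -/
noncomputable def slab (N : ℕ) (T : ℝ) : Measure (Space N × ℝ) :=
  (volume : Measure (Space N)).prod (volume.restrict (Ioo 0 T))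

/-- The consequences of `IsWeakWave` used below: `u` has a jointly measurable representative `U`,
which vanishes outside the cone and satisfies the equation tested twice in time. -/
structure TestedWave {N : ℕ} (T ε : ℝ) (f g : Space N → ℝ) (r : ℝ) (H U : Space N × ℝ → ℝ) :
    Prop where
  measurable : Measurable U
  integrable : Integrable H (slab N T)
  nonneg : ∀ z, 0 ≤ H z
  cone : ∀ᵐ z ∂(slab N T), r + z.2 < ‖z.1‖ → U z = 0
  cone' : ∀ᵐ z ∂(slab N T), r + z.2 < ‖z.1‖ → H z = 0
  tested : ∀ Ψ : Space N × ℝ → ℝ, IsTestFunction T Ψ →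
    ε * ((∫ x, g x * Ψ (x, 0)) - ∫ x, f x * dirDeriv (timeDir N) Ψ (x, 0))
      + ∫ z, H z * Ψ z ∂(slab N T) = ∫ z, U z * waveOp Ψ z ∂(slab N T)

/-- The curve `u` is not controlled near `T`. This confines every time integral to a compact
interval on which `u` is continuous. -/
theorem IsTestFunction.exists_time_bound (h : IsTestFunction T Ψ) (hT : 0 < T) :
    ∃ T', 0 < T' ∧ T' < T ∧ ∀ x t, T' ≤ t → (x, t) ∉ tsupport Ψ := by
  by_cases hne : (tsupport Ψ).Nonempty
  · obtain ⟨z, hz, hmax⟩ := h.2.1.isCompact.exists_isMaxOn hne continuous_snd.continuousOn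
    have hzT := h.2.2 z hz
    refine ⟨(max z.2 0 + T) / 2, ?_, ?_, fun x t ht hmem => ?_⟩
    · have := le_max_right z.2 0; linarith
    · have := max_lt hzT hT; linarith
    · have h1 : t ≤ z.2 := hmax hmem
      have h2 := le_max_left z.2 0
      have := max_lt hzT hT
      linarith
  · exact ⟨T / 2, by linarith, by linarith, fun x t _ hm => hne ⟨_, hm⟩⟩

theorem sliceL2_eq_zero (h : IsTestFunction T Ψ) {t : ℝ} (ht : ∀ x, (x, t) ∉ tsupport Ψ) :
    sliceL2 h t = 0 := by
  apply Lp.ext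
  filter_upwards [coeFn_sliceL2 h t, Lp.coeFn_zero ℝ 2 (volume : Measure (Space N))] with x h1 h2
  rw [h1, h2, Pi.zero_apply, image_eq_zero_of_notMem_tsupport (ht x)]

theorem continuous_sliceL2 (h : IsTestFunction T Ψ) : Continuous (sliceL2 h) :=
  continuous_iff_continuousAt.2 fun t => (hasDerivAt_sliceL2 h t).continuousAt

theorem integrableOn_of_continuousOn_of_zero {φ : ℝ → ℝ} {T' : ℝ} (hT : T' < T)
    (hφ : ContinuousOn φ (Ico 0 T)) (h0 : ∀ t, T' ≤ t → φ t = 0) : IntegrableOn φ (Ioo 0 T) := by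
  have h1 : IntegrableOn φ (Icc 0 T') :=
    (hφ.mono fun t ht => ⟨ht.1, ht.2.trans_lt hT⟩).integrableOn_Icc
  have h2 : IntegrableOn φ (Ici T') :=
    (integrableOn_zero (μ := volume) (s := Ici T')).congr_fun (fun t ht => (h0 t ht).symm)
      measurableSet_Ici
  refine (h1.union h2).mono_set fun t ht => ?_
  rcases le_total t T' with h | h
  · exact Or.inl ⟨ht.1.le, h⟩
  · exact Or.inr h

theorem integrable_mul_testFunction (h : IsTestFunction T Ψ) (w : L2 N) (t : ℝ) :
    Integrable (fun x => w x * Ψ (x, t)) :=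
  (Lp.memLp w).integrable_mul (h.memLp_slice t 2)

/-- Integration by parts in time. -/
theorem integral_inner_sliceL2 {u : ℝ → L2 N} (hu : ContDiffOn ℝ 1 u (Ico 0 T)) (hT : 0 < T)
    (h : IsTestFunction T Ψ) :
    ∫ t in Ioo 0 T, (inner ℝ (derivWithin u (Ico 0 T) t) (sliceL2 h t)
      + inner ℝ (u t) (sliceL2 (h.dirDeriv (timeDir N)) t)) = - inner ℝ (u 0) (sliceL2 h 0) := by
  obtain ⟨T', hT', hTT, hz⟩ := h.exists_time_bound hT
  have hd := h.dirDeriv (timeDir N)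
  have hz' : ∀ x t, T' ≤ t → (x, t) ∉ tsupport (dirDeriv (timeDir N) Ψ) := fun x t ht hm =>
    hz x t ht (tsupport_fderiv_apply_subset ℝ _ hm)
  set φ : ℝ → ℝ := fun t => inner ℝ (derivWithin u (Ico 0 T) t) (sliceL2 h t)
      + inner ℝ (u t) (sliceL2 hd t) with hφdef
  have hφc : ContinuousOn φ (Ico 0 T) :=
    ((hu.continuousOn_derivWithin (uniqueDiffOn_Ico 0 T) le_rfl).inner
      (continuous_sliceL2 h).continuousOn).add
      (hu.continuousOn.inner (continuous_sliceL2 hd).continuousOn)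
  have hφ0 : ∀ t, T' ≤ t → φ t = 0 := fun t ht => by
    simp [hφdef, sliceL2_eq_zero h fun x => hz x t ht, sliceL2_eq_zero hd fun x => hz' x t ht]
  have h1 : ∫ t in Ioo 0 T, φ t = ∫ t in (0 : ℝ)..T', φ t := by
    rw [intervalIntegral.integral_of_le hT'.le]
    refine setIntegral_eq_of_subset_of_forall_sdiff_eq_zero measurableSet_Ioo
      (fun t ht => ⟨ht.1, lt_of_le_of_lt ht.2 hTT⟩) fun t ht => hφ0 t ?_
    by_contra hlt
    exact ht.2 ⟨ht.1.1, (not_le.1 hlt).le⟩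
  have hsub : Icc 0 T' ⊆ Ico 0 T := fun t ht => ⟨ht.1, ht.2.trans_lt hTT⟩
  rw [h1, intervalIntegral.integral_eq_sub_of_hasDerivAt_of_le
    (f := fun t => (inner ℝ (u t) (sliceL2 h t) : ℝ)) (f' := φ) hT'.le
    ((hu.continuousOn.mono hsub).inner (continuous_sliceL2 h).continuousOn) (fun t ht => ?_)
    ((hφc.mono hsub).intervalIntegrable_of_Icc hT'.le)]
  · simp [sliceL2_eq_zero h fun x => hz x T' le_rfl]
  · have hmem : Ico 0 T ∈ 𝓝 t := Ico_mem_nhds ht.1 (ht.2.trans hTT)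
    have hut : HasDerivAt u (derivWithin u (Ico 0 T) t) t :=
      ((hu.differentiableOn (by simp)) t ⟨ht.1.le, ht.2.trans hTT⟩).hasDerivWithinAt.hasDerivAt hmem
    have := hut.inner ℝ (hasDerivAt_sliceL2 h t)
    rw [add_comm] at this
    exact this

theorem inner_gradient_slice (h : IsTestFunction T Ψ) (w : Space N) (x : Space N) (t : ℝ) :
    inner ℝ w (gradient (fun y => Ψ (y, t)) x) =
      ∑ i, w i * dirDeriv (spaceDir i) Ψ (x, t) := by
  rw [real_inner_comm, gradient, InnerProductSpace.toDual_symm_apply]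
  conv_lhs => rw [← (EuclideanSpace.basisFun (Fin N) ℝ).sum_repr w]
  rw [map_sum]
  refine Finset.sum_congr rfl fun i _ => ?_
  rw [map_smul, EuclideanSpace.basisFun_apply, h.fderiv_slice, EuclideanSpace.basisFun_repr,
    smul_eq_mul]

/-- Integration by parts in space. -/
theorem integral_inner_gradient (h : IsTestFunction T Ψ) {w : L2 N} {z : L2Vec N}
    (hw : IsWeakGradient w z) (t : ℝ) :
    ∫ x, (inner ℝ (z x) (gradient (fun y => Ψ (y, t)) x) : ℝ) =
      -∑ i, inner ℝ w (sliceL2 ((h.dirDeriv (spaceDir i)).dirDeriv (spaceDir i)) t) := by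
  simp_rw [inner_gradient_slice h]
  rw [integral_finsetSum, ← Finset.sum_neg_distrib]
  · refine Finset.sum_congr rfl fun i _ => ?_
    have hi := h.dirDeriv (spaceDir i)
    rw [inner_sliceL2, ← neg_neg (∫ x, z x i * _), ← hw _ (hi.slice t) i]
    simp_rw [hi.fderiv_slice]
  · intro i _
    have hi := h.dirDeriv (spaceDir i)
    have hm : MemLp (fun x => (z x) i) 2 volume :=
      (EuclideanSpace.proj (𝕜 := ℝ) i).comp_memLp' (Lp.memLp z)
    exact hm.integrable_mul (hi.memLp_slice t 2)

theorem IsTestFunction.continuous (h : IsTestFunction T Ψ) : Continuous Ψ := h.1.continuous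

theorem continuous_waveOp (h : IsTestFunction T Ψ) : Continuous (waveOp Ψ) :=
  ((h.dirDeriv _).dirDeriv _).continuous.sub
    (continuous_finsetSum _ fun _ _ => ((h.dirDeriv _).dirDeriv _).continuous)

theorem hasCompactSupport_waveOp (h : IsTestFunction T Ψ) : HasCompactSupport (waveOp Ψ) := by
  refine HasCompactSupport.intro h.2.1.isCompact fun z hz => ?_
  have h1 : ∀ v, dirDeriv v (dirDeriv v Ψ) z = 0 := fun v => by
    by_contra hne
    exact hz (tsupport_fderiv_apply_subset ℝ v
      (tsupport_fderiv_apply_subset ℝ v (subset_tsupport _ hne)))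
  simp [waveOp, h1]

theorem integral_mul_waveOp_slice (h : IsTestFunction T Ψ) (w : L2 N) (t : ℝ) :
    ∫ x, w x * waveOp Ψ (x, t) =
      inner ℝ w (sliceL2 ((h.dirDeriv (timeDir N)).dirDeriv (timeDir N)) t)
      - ∑ i, inner ℝ w (sliceL2 ((h.dirDeriv (spaceDir i)).dirDeriv (spaceDir i)) t) := by
  simp_rw [inner_sliceL2, waveOp, mul_sub, Finset.mul_sum]
  rw [integral_sub (integrable_mul_testFunction ((h.dirDeriv _).dirDeriv _) w t)
    (integrable_finsetSum _ fun i _ =>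
      integrable_mul_testFunction ((h.dirDeriv _).dirDeriv _) w t), integral_finsetSum]
  exact fun i _ => integrable_mul_testFunction ((h.dirDeriv _).dirDeriv _) w t

/-- The weak formulation carries one derivative on `u`. Integrating by parts in time against `∂ₜΨ`
and in space through the weak gradient puts both derivatives on `Ψ`; the boundary term at `t = 0` is
the contribution of `f`. -/
theorem IsWeakWave.tested {ε : ℝ} {f g : Space N → ℝ} {H : ℝ → Space N → ℝ} {u : ℝ → L2 N}
    (hu : IsWeakWave T ε f g H u) (hT : 0 < T) (h : IsTestFunction T Ψ) :
    ε * ((∫ x, g x * Ψ (x, 0)) - ∫ x, f x * dirDeriv (timeDir N) Ψ (x, 0))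
      + ∫ t in Ioo 0 T, ∫ x, H t x * Ψ (x, t) =
        ∫ t in Ioo 0 T, ∫ x, u t x * waveOp Ψ (x, t) := by
  obtain ⟨Du, -, hDu, hweak⟩ := hu.weak
  have hd := h.dirDeriv (timeDir N)
  have hdd := hd.dirDeriv (timeDir N)
  have key := hweak Ψ h
  have hin : ∀ t ∈ Ioo 0 T, ∫ x, (-(derivWithin u (Ico 0 T) t x * deriv (fun s => Ψ (x, s)) t)
      + inner ℝ (Du t x) (gradient (fun y => Ψ (y, t)) x)) =
      (∫ x, u t x * waveOp Ψ (x, t)) - (inner ℝ (derivWithin u (Ico 0 T) t) (sliceL2 hd t)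
      + inner ℝ (u t) (sliceL2 hdd t)) := by
    intro t ht
    simp_rw [(h.hasDerivAt_time _ _).deriv]
    have hneg := (integrable_mul_testFunction hd (derivWithin u (Ico 0 T) t) t).neg
    rw [integral_add (f := fun x => -(derivWithin u (Ico 0 T) t x *
      dirDeriv (timeDir N) Ψ (x, t))) hneg, integral_neg,
      integral_inner_gradient h (hDu t ⟨ht.1.le, ht.2⟩), integral_mul_waveOp_slice h,
      ← inner_sliceL2 hd]
    · ring
    · simp_rw [inner_gradient_slice h]
      refine integrable_finsetSum _ fun i _ => ?_
      have hm : MemLp (fun x => (Du t x) i) 2 volume :=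
        (EuclideanSpace.proj (𝕜 := ℝ) i).comp_memLp' (Lp.memLp (Du t))
      exact hm.integrable_mul ((h.dirDeriv (spaceDir i)).memLp_slice t 2)
  rw [setIntegral_congr_fun measurableSet_Ioo hin, integral_sub,
    integral_inner_sliceL2 hu.contDiffOn hT hd, inner_sliceL2] at key
  · have h0 : ∫ x, u 0 x * dirDeriv (timeDir N) Ψ (x, 0) =
        ε * ∫ x, f x * dirDeriv (timeDir N) Ψ (x, 0) := by
      rw [← integral_const_mul]
      refine integral_congr_ae ?_
      filter_upwards [hu.initial] with x hx
      rw [hx]; ring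
    rw [h0] at key
    linarith
  · obtain ⟨T', hT', hTT, hz⟩ := h.exists_time_bound hT
    have hz2 : ∀ v x t, T' ≤ t → (x, t) ∉ tsupport (dirDeriv v (dirDeriv v Ψ)) :=
      fun v x t ht hm => hz x t ht (tsupport_fderiv_apply_subset ℝ v
        (tsupport_fderiv_apply_subset ℝ v hm))
    simp_rw [integral_mul_waveOp_slice h]
    refine integrableOn_of_continuousOn_of_zero hTT ?_ fun t ht => ?_
    · refine (hu.contDiffOn.continuousOn.inner (continuous_sliceL2 _).continuousOn).sub ?_
      exact continuousOn_finsetSum _ fun i _ =>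
        hu.contDiffOn.continuousOn.inner (continuous_sliceL2 _).continuousOn
    · rw [sliceL2_eq_zero _ fun x => hz2 _ x t ht]
      simp [fun i => sliceL2_eq_zero ((h.dirDeriv (spaceDir i)).dirDeriv (spaceDir i))
        fun x => hz2 _ x t ht]
  · obtain ⟨T', hT', hTT, hz⟩ := hd.exists_time_bound hT
    refine integrableOn_of_continuousOn_of_zero hTT ?_ fun t ht => ?_
    · exact ((hu.contDiffOn.continuousOn_derivWithin (uniqueDiffOn_Ico 0 T) le_rfl).inner
        (continuous_sliceL2 hd).continuousOn).add
        (hu.contDiffOn.continuousOn.inner (continuous_sliceL2 hdd).continuousOn)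
    · rw [sliceL2_eq_zero hd fun x => hz x t ht, sliceL2_eq_zero hdd fun x hm => hz x t ht
        (tsupport_fderiv_apply_subset ℝ _ hm)]
      simp

/-- By Tonelli the space-time integral of `|G(V)|` is `∫ ‖K t‖ dt`, which is finite for a Bochner
integrable `K`. -/
theorem integrable_comp_representative {G : ℝ → ℝ} (hG : Continuous G) {v : ℝ → L2 N}
    {V : Space N × ℝ → ℝ} (hV : Measurable V) (hVv : ∀ t ∈ Ioo 0 T, (fun x => V (x, t)) =ᵐ[volume] v t)
    (hK : MemL1L1 T fun t x => G (v t x)) : Integrable (fun z => G (V z)) (slab N T) := by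
  have hm : Measurable fun z => G (V z) := hG.measurable.comp hV
  refine ⟨hm.aestronglyMeasurable, ?_⟩
  obtain ⟨K, hKi, hKe⟩ := hK
  rw [HasFiniteIntegral, slab, lintegral_prod_symm' _ hm.enorm]
  refine lt_of_le_of_lt (le_of_eq (lintegral_congr_ae ?_)) hKi.2
  filter_upwards [hKe, ae_restrict_mem measurableSet_Ioo] with t ht htm
  rw [Lp.enorm_def, eLpNorm_one_eq_lintegral_enorm]
  refine lintegral_congr_ae ?_
  filter_upwards [ht, hVv t htm] with x h1 h2
  rw [h1, ← h2]

theorem ae_cone_representative {r : ℝ} {u : ℝ → L2 N} {U : Space N × ℝ → ℝ} (hU : Measurable U)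
    (hUu : ∀ t ∈ Ioo 0 T, (fun x => U (x, t)) =ᵐ[volume] u t) (hc : SupportedInCone r T u) :
    ∀ᵐ z ∂(slab N T), r + z.2 < ‖z.1‖ → U z = 0 := by
  have hm : MeasurableSet {z : Space N × ℝ | r + z.2 < ‖z.1‖ → U z = 0} := by
    have h1 : MeasurableSet {z : Space N × ℝ | r + z.2 < ‖z.1‖} :=
      measurableSet_lt (by fun_prop) (by fun_prop)
    have h2 : MeasurableSet {z | U z = 0} := hU (measurableSet_singleton 0)
    exact h1.imp h2
  rw [slab, Measure.ae_prod_iff_ae_ae hm, Measure.ae_ae_comm hm]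
  filter_upwards [ae_restrict_mem measurableSet_Ioo] with t ht
  filter_upwards [hUu t ht, hc t ⟨ht.1.le, ht.2⟩] with x h1 h2 h3
  exact h1.trans (h2 h3)

/-- Fubini needs `U □Ψ` to be jointly integrable. This follows from `|U| ≤ 1 + |U|^q`, as the second
factor is bounded with compact support. -/
theorem integrable_mul_of_rpow {q : ℝ} (hq : 1 < q) {U W : Space N × ℝ → ℝ} (hU : Measurable U)
    (hUq : Integrable (fun z => |U z| ^ q) (slab N T)) (hW : Continuous W)
    (hWc : HasCompactSupport W) : Integrable (fun z => U z * W z) (slab N T) := by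
  obtain ⟨C, hC⟩ := hW.bounded_above_of_compact_support hWc
  have hfin : IsFiniteMeasureOnCompacts (slab N T) := by unfold slab; infer_instance
  have hWi : Integrable W (slab N T) := hW.integrable_of_hasCompactSupport hWc
  refine (hWi.norm.add (hUq.mul_const C)).mono' (hU.mul hW.measurable).aestronglyMeasurable
    (Eventually.of_forall fun z => ?_)
  have hC0 : 0 ≤ C := (norm_nonneg _).trans (hC z)
  have h1 : |U z| ≤ 1 + |U z| ^ q := by
    rcases le_total |U z| 1 with h | h
    · have := Real.rpow_nonneg (abs_nonneg (U z)) q; linarith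
    · have := Real.self_le_rpow_of_one_le h hq.le; linarith
  have h2 := Real.rpow_nonneg (abs_nonneg (U z)) q
  calc ‖U z * W z‖ = |U z| * ‖W z‖ := by rw [norm_mul, Real.norm_eq_abs]
    _ ≤ (1 + |U z| ^ q) * ‖W z‖ := by gcongr
    _ = ‖W z‖ + |U z| ^ q * ‖W z‖ := by ring
    _ ≤ ‖W z‖ + |U z| ^ q * C := by gcongr; exact hC z

theorem IsWeakWave.testedWave {ε r q : ℝ} {f g : Space N → ℝ} {G : ℝ → ℝ} {u v : ℝ → L2 N}
    {U V : Space N × ℝ → ℝ} (hu : IsWeakWave T ε f g (fun t x => G (v t x)) u) (hT : 0 < T)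
    (hG : Continuous G) (hG0 : G 0 = 0) (hGn : ∀ s, 0 ≤ G s)
    (hU : Measurable U) (hUu : ∀ t ∈ Ioo 0 T, (fun x => U (x, t)) =ᵐ[volume] u t)
    (hV : Measurable V) (hVv : ∀ t ∈ Ioo 0 T, (fun x => V (x, t)) =ᵐ[volume] v t)
    (hcu : SupportedInCone r T u) (hcv : SupportedInCone r T v)
    (hq : 1 < q) (hUq : Integrable (fun z => |U z| ^ q) (slab N T)) :
    TestedWave T ε f g r (fun z => G (V z)) U := by
  have hint := integrable_comp_representative hG hV hVv hu.source
  refine ⟨hU, hint, fun z => hGn _, ae_cone_representative hU hUu hcu, ?_, fun Ψ hΨ => ?_⟩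
  · filter_upwards [ae_cone_representative hV hVv hcv] with z hz h
    rw [hz h, hG0]
  obtain ⟨C, hC⟩ := hΨ.exists_bound
  have h1 : Integrable (fun z => G (V z) * Ψ z) (slab N T) :=
    hint.mul_bdd hΨ.continuous.aestronglyMeasurable (Eventually.of_forall hC)
  have h2 := integrable_mul_of_rpow hq hU hUq (continuous_waveOp hΨ) (hasCompactSupport_waveOp hΨ)
  rw [slab] at h1 h2 ⊢
  rw [integral_prod_symm _ h1, integral_prod_symm _ h2]
  have e1 : ∫ t in Ioo 0 T, ∫ x, G (V (x, t)) * Ψ (x, t) =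
      ∫ t in Ioo 0 T, ∫ x, G (v t x) * Ψ (x, t) := by
    refine setIntegral_congr_fun measurableSet_Ioo fun t ht => integral_congr_ae ?_
    filter_upwards [hVv t ht] with x hx
    rw [← hx]
  have e2 : ∫ t in Ioo 0 T, ∫ x, U (x, t) * waveOp Ψ (x, t) =
      ∫ t in Ioo 0 T, ∫ x, u t x * waveOp Ψ (x, t) := by
    refine setIntegral_congr_fun measurableSet_Ioo fun t ht => integral_congr_ae ?_
    filter_upwards [hUu t ht] with x hx
    rw [← hx]
  rw [e1, e2]
  exact hu.tested hT hΨ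

theorem integrable_rpow_of_le {G : ℝ → ℝ} {b q : ℝ} (hb : 0 < b) (hq : ∀ s, b * |s| ^ q ≤ G s)
    {U : Space N × ℝ → ℝ} (hU : Measurable U)
    (h : Integrable (fun z => G (U z)) (slab N T)) : Integrable (fun z => |U z| ^ q) (slab N T) := by
  refine (h.mul_const b⁻¹).mono'
    ((continuous_abs.measurable.comp hU).pow_const q).aestronglyMeasurable
    (Eventually.of_forall fun z => ?_)
  rw [Real.norm_eq_abs, abs_of_nonneg (Real.rpow_nonneg (abs_nonneg _) _), ← div_eq_mul_inv,
    le_div_iff₀ hb, mul_comm]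
  exact hq _

theorem IsWeakSolution.exists_testedWave {ε r p q a b : ℝ} {f₁ g₁ f₂ g₂ : Space N → ℝ}
    {G₁ G₂ : ℝ → ℝ} {u v : ℝ → L2 N} (h : IsWeakSolution G₁ G₂ f₁ g₁ f₂ g₂ ε T u v) (hT : 0 < T)
    (hp : 1 < p) (hq : 1 < q) (ha : 0 < a) (hb : 0 < b)
    (hG₁ : Continuous G₁) (hG₂ : Continuous G₂) (hG₁0 : G₁ 0 = 0) (hG₂0 : G₂ 0 = 0)
    (hG₁p : ∀ s : ℝ, a * |s| ^ p ≤ G₁ s) (hG₂q : ∀ s : ℝ, b * |s| ^ q ≤ G₂ s)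
    (hcu : SupportedInCone r T u) (hcv : SupportedInCone r T v) :
    ∃ U V : Space N × ℝ → ℝ, TestedWave T ε f₁ g₁ r (fun z => G₁ (V z)) U ∧
      TestedWave T ε f₂ g₂ r (fun z => G₂ (U z)) V := by
  obtain ⟨U, hU, hUu⟩ := exists_measurable_representative_of_continuousOn h.1.contDiffOn.continuousOn
  obtain ⟨V, hV, hVv⟩ := exists_measurable_representative_of_continuousOn h.2.contDiffOn.continuousOn
  have hn₁ : ∀ s, 0 ≤ G₁ s := fun s => (by positivity : 0 ≤ a * |s| ^ p).trans (hG₁p s)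
  have hn₂ : ∀ s, 0 ≤ G₂ s := fun s => (by positivity : 0 ≤ b * |s| ^ q).trans (hG₂q s)
  refine ⟨U, V, h.1.testedWave hT hG₁ hG₁0 hn₁ hU hUu hV hVv hcu hcv hq ?_,
    h.2.testedWave hT hG₂ hG₂0 hn₂ hV hVv hU hUu hcv hcu hp ?_⟩
  · exact integrable_rpow_of_le hb hG₂q hU (integrable_comp_representative hG₂ hU hUu h.2.source)
  · exact integrable_rpow_of_le ha hG₁p hV (integrable_comp_representative hG₁ hV hVv h.1.source)

end WaveSystem

/-! ### Cutoff functions and smooth powers -/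

namespace WaveSystem

open Filter Topology

/-- A time cutoff `χ` together with a weight `ϖ` living on the transition layer `(1/2, 1)` that
controls the derivatives of `χ`. -/
structure IsCutoff (p q C : ℝ) (χ ϖ : ℝ → ℝ) : Prop where
  smooth : ContDiff ℝ ∞ χ
  eq_one : ∀ s, s ≤ 1 / 2 → χ s = 1
  eq_zero : ∀ s, 1 ≤ s → χ s = 0
  anti : Antitone χ
  cont : Continuous ϖ
  nonneg : ∀ s, 0 ≤ ϖ s
  le : ∀ s, ϖ s ≤ χ s
  left : ∀ s, s ≤ 1 / 2 → ϖ s = 0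
  pos : 0 < C
  deriv_p : ∀ s, |deriv χ s| ≤ C * ϖ s ^ (1 / p)
  deriv_q : ∀ s, |deriv χ s| ≤ C * ϖ s ^ (1 / q)
  deriv2_p : ∀ s, |deriv (deriv χ) s| ≤ C * ϖ s ^ (1 / p)
  deriv2_q : ∀ s, |deriv (deriv χ) s| ≤ C * ϖ s ^ (1 / q)

theorem IsCutoff.le_one {p q C : ℝ} {χ ϖ : ℝ → ℝ} (h : IsCutoff p q C χ ϖ) (s : ℝ) : χ s ≤ 1 := by
  rcases le_total s (1 / 2) with hs | hs
  · exact (h.eq_one s hs).le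
  · exact (h.anti hs).trans (h.eq_one _ le_rfl).le

theorem IsCutoff.right {p q C : ℝ} {χ ϖ : ℝ → ℝ} (h : IsCutoff p q C χ ϖ) (s : ℝ) (hs : 1 ≤ s) :
    ϖ s = 0 := le_antisymm ((h.le s).trans (h.eq_zero s hs).le) (h.nonneg s)

theorem IsCutoff.nonneg' {p q C : ℝ} {χ ϖ : ℝ → ℝ} (h : IsCutoff p q C χ ϖ) (s : ℝ) : 0 ≤ χ s :=
  (h.nonneg s).trans (h.le s)

theorem IsCutoff.symm {p q C : ℝ} {χ ϖ : ℝ → ℝ} (h : IsCutoff p q C χ ϖ) : IsCutoff q p C χ ϖ :=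
  ⟨h.smooth, h.eq_one, h.eq_zero, h.anti, h.cont, h.nonneg, h.le, h.left, h.pos, h.deriv_q,
    h.deriv_p, h.deriv2_q, h.deriv2_p⟩

/-- A high power `χ = η^(2n+2)` of a smooth step has first and second derivatives bounded by
`η^(2n)`, hence by a fractional power of `χ` itself. The factor `ζ` in `ϖ = χ ζ` equals `1` where
these derivatives live and switches `ϖ` off continuously before `1/2`. -/
theorem exists_isCutoff {p q : ℝ} (hp : 1 < p) (hq : 1 < q) :
    ∃ C χ ϖ, IsCutoff p q C χ ϖ := by
  set η : ℝ → ℝ := fun s => Real.smoothTransition (8 - 8 * s) with hη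
  set ζ : ℝ → ℝ := fun s => Real.smoothTransition (8 * s - 4) with hζ
  have hηs : ContDiff ℝ ∞ η := Real.smoothTransition.contDiff.comp (by fun_prop)
  have hζs : ContDiff ℝ ∞ ζ := Real.smoothTransition.contDiff.comp (by fun_prop)
  have hη0 : ∀ s, 0 ≤ η s := fun s => Real.smoothTransition.nonneg _
  have hη1 : ∀ s, η s ≤ 1 := fun s => Real.smoothTransition.le_one _
  have hζ0 : ∀ s, 0 ≤ ζ s := fun s => Real.smoothTransition.nonneg _
  have hζ1 : ∀ s, ζ s ≤ 1 := fun s => Real.smoothTransition.le_one _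
  have hηone : ∀ s, s ≤ 7 / 8 → η s = 1 := fun s hs =>
    Real.smoothTransition.one_of_one_le (by linarith)
  have hηzero : ∀ s, 1 ≤ s → η s = 0 := fun s hs =>
    Real.smoothTransition.zero_of_nonpos (by linarith)
  have hζone : ∀ s, 5 / 8 ≤ s → ζ s = 1 := fun s hs =>
    Real.smoothTransition.one_of_one_le (by linarith)
  have hζzero : ∀ s, s ≤ 1 / 2 → ζ s = 0 := fun s hs =>
    Real.smoothTransition.zero_of_nonpos (by linarith)
  have hanti : Antitone η := fun x y hxy => Real.smoothTransition.monotone (by linarith)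
  -- This size ensures `2n ≥ (2n + 2)/r` for both exponents `r = p, q`, and so `η^(2n) ≤
  -- (η^(2n+2))^(1/r)`.
  obtain ⟨n, hn⟩ := exists_nat_ge (max (p / (p - 1)) (q / (q - 1)))
  -- the first two derivatives of `η` are bounded and vanish off `[7/8, 1]`
  have hη' : ContDiff ℝ ∞ (deriv η) := (contDiff_infty_iff_deriv.1 hηs).2
  have hη'' : ContDiff ℝ ∞ (deriv (deriv η)) := (contDiff_infty_iff_deriv.1 hη').2
  have hd : ∀ s, HasDerivAt η (deriv η s) s := fun s =>
    (hηs.differentiable (by simp)).differentiableAt.hasDerivAt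
  have hd' : ∀ s, HasDerivAt (deriv η) (deriv (deriv η) s) s := fun s =>
    (hη'.differentiable (by simp)).differentiableAt.hasDerivAt
  have hz1 : ∀ s, s < 7 / 8 → deriv η s = 0 := fun s hs => by
    have : η =ᶠ[𝓝 s] fun _ => 1 := by
      filter_upwards [Iio_mem_nhds hs] with x hx using hηone x (le_of_lt hx)
    rw [this.deriv_eq, deriv_const]
  have hz2 : ∀ s, 1 < s → deriv η s = 0 := fun s hs => by
    have : η =ᶠ[𝓝 s] fun _ => 0 := by
      filter_upwards [Ioi_mem_nhds hs] with x hx using hηzero x (le_of_lt hx)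
    rw [this.deriv_eq, deriv_const]
  have hc1 : HasCompactSupport (deriv η) := by
    refine HasCompactSupport.intro (isCompact_Icc (a := (7 / 8 : ℝ)) (b := 1)) fun s hs => ?_
    by_contra hne
    exact hs ⟨not_lt.1 fun h => hne (hz1 s h), not_lt.1 fun h => hne (hz2 s h)⟩
  obtain ⟨B, hB⟩ := hη'.continuous.bounded_above_of_compact_support hc1
  obtain ⟨B', hB'⟩ := hη''.continuous.bounded_above_of_compact_support hc1.deriv
  have hz3 : ∀ s, s < 7 / 8 → deriv (deriv η) s = 0 := fun s hs => by
    have : deriv η =ᶠ[𝓝 s] fun _ => 0 := by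
      filter_upwards [Iio_mem_nhds hs] with x hx using hz1 x hx
    rw [this.deriv_eq, deriv_const]
  have hB0 : 0 ≤ B := (norm_nonneg _).trans (hB 0)
  have hB0' : 0 ≤ B' := (norm_nonneg _).trans (hB' 0)
  have hd1 : ∀ s, deriv (fun s => η s ^ (2 * n + 2)) s =
      (2 * n + 2 : ℝ) * (η s ^ (2 * n + 1) * deriv η s) := fun s => by
    have := ((hd s).pow (2 * n + 2)).deriv
    push_cast at this
    rw [mul_assoc] at this
    exact this
  have hd2 : ∀ s, deriv (deriv fun s => η s ^ (2 * n + 2)) s = (2 * n + 2 : ℝ) *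
      ((2 * n + 1 : ℝ) * η s ^ (2 * n) * deriv η s * deriv η s
        + η s ^ (2 * n + 1) * deriv (deriv η) s) := fun s => by
    rw [funext hd1]
    have h := ((((hd s).pow (2 * n + 1)).mul (hd' s)).const_mul (2 * n + 2 : ℝ)).deriv
    push_cast at h
    exact h
  have hpow : ∀ r : ℝ, 1 < r → r / (r - 1) ≤ n → ∀ s, 7 / 8 ≤ s →
      η s ^ (2 * n) ≤ (η s ^ (2 * n + 2) * ζ s) ^ (1 / r) := by
    intro r hr hrn s hs
    rw [hζone s (by linarith), mul_one]
    rcases (hη0 s).eq_or_lt with h0 | h0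
    · rw [← h0]
      have : n ≠ 0 := by
        rintro rfl
        have : 0 < r / (r - 1) := by apply div_pos <;> linarith
        simp at hrn; linarith
      rw [zero_pow (by omega), zero_pow (by omega), Real.zero_rpow (by positivity)]
    · rw [← Real.rpow_natCast, ← Real.rpow_natCast, ← Real.rpow_mul h0.le]
      refine Real.rpow_le_rpow_of_exponent_ge h0 (hη1 s) ?_
      rw [div_le_iff₀ (by linarith)] at hrn
      push_cast
      rw [mul_one_div, div_le_iff₀ (by linarith)]
      nlinarith
  set C : ℝ := (2 * n + 2) * ((2 * n + 1) * B * B + B') + (2 * n + 2) * B + 1 with hC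
  have hCpos : 0 < C := by positivity
  have hϖ0 : ∀ s, 0 ≤ η s ^ (2 * n + 2) * ζ s := fun s => mul_nonneg (pow_nonneg (hη0 s) _) (hζ0 s)
  have hD1 : ∀ r : ℝ, 1 < r → r / (r - 1) ≤ n → ∀ s,
      |deriv (fun s => η s ^ (2 * n + 2)) s| ≤ C * (η s ^ (2 * n + 2) * ζ s) ^ (1 / r) := by
    intro r hr hrn s
    rcases lt_or_ge s (7 / 8) with hs | hs
    · rw [hd1, hz1 s hs]
      simpa using mul_nonneg hCpos.le (Real.rpow_nonneg (hϖ0 s) _)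
    · refine le_trans ?_ (mul_le_mul_of_nonneg_left (hpow r hr hrn s hs) hCpos.le)
      rw [hd1, abs_mul, abs_mul, abs_of_nonneg (by positivity : (0 : ℝ) ≤ 2 * n + 2),
        abs_of_nonneg (pow_nonneg (hη0 s) _)]
      calc (2 * n + 2 : ℝ) * (η s ^ (2 * n + 1) * |deriv η s|)
          ≤ (2 * n + 2 : ℝ) * (η s ^ (2 * n) * B) := by
            refine mul_le_mul_of_nonneg_left (mul_le_mul ?_ (hB s) (abs_nonneg _)
              (pow_nonneg (hη0 s) _)) (by positivity)
            exact pow_le_pow_of_le_one (hη0 s) (hη1 s) (by omega)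
        _ = (2 * n + 2) * B * η s ^ (2 * n) := by ring
        _ ≤ C * η s ^ (2 * n) := by
            gcongr
            · exact pow_nonneg (hη0 s) _
            · rw [hC]; nlinarith [show (0:ℝ) ≤ (2 * n + 2) * ((2 * n + 1) * B * B + B') by positivity]
  have hD2 : ∀ r : ℝ, 1 < r → r / (r - 1) ≤ n → ∀ s,
      |deriv (deriv fun s => η s ^ (2 * n + 2)) s| ≤
        C * (η s ^ (2 * n + 2) * ζ s) ^ (1 / r) := by
    intro r hr hrn s
    rcases lt_or_ge s (7 / 8) with hs | hs
    · rw [hd2, hz1 s hs, hz3 s hs]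
      simpa using mul_nonneg hCpos.le (Real.rpow_nonneg (hϖ0 s) _)
    · refine le_trans ?_ (mul_le_mul_of_nonneg_left (hpow r hr hrn s hs) hCpos.le)
      rw [hd2, abs_mul, abs_of_nonneg (by positivity : (0 : ℝ) ≤ 2 * n + 2)]
      have h1 : |(2 * n + 1 : ℝ) * η s ^ (2 * n) * deriv η s * deriv η s| ≤
          (2 * n + 1) * η s ^ (2 * n) * B * B := by
        rw [abs_mul, abs_mul, abs_mul, abs_of_nonneg (by positivity : (0 : ℝ) ≤ 2 * n + 1),
          abs_of_nonneg (pow_nonneg (hη0 s) _)]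
        have := hB s
        rw [Real.norm_eq_abs] at this
        have h0 := pow_nonneg (hη0 s) (2 * n)
        gcongr
      have h2 : |η s ^ (2 * n + 1) * deriv (deriv η) s| ≤ η s ^ (2 * n) * B' := by
        rw [abs_mul, abs_of_nonneg (pow_nonneg (hη0 s) _)]
        refine mul_le_mul (pow_le_pow_of_le_one (hη0 s) (hη1 s) (by omega)) (hB' s) (abs_nonneg _)
          (pow_nonneg (hη0 s) _)
      calc (2 * n + 2 : ℝ) * |(2 * n + 1 : ℝ) * η s ^ (2 * n) * deriv η s * deriv η s +
            η s ^ (2 * n + 1) * deriv (deriv η) s|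
          ≤ (2 * n + 2 : ℝ) * ((2 * n + 1) * η s ^ (2 * n) * B * B + η s ^ (2 * n) * B') := by
            gcongr
            exact (abs_add_le _ _).trans (add_le_add h1 h2)
        _ = (2 * n + 2) * ((2 * n + 1) * B * B + B') * η s ^ (2 * n) := by ring
        _ ≤ C * η s ^ (2 * n) := by
            gcongr
            · exact pow_nonneg (hη0 s) _
            · rw [hC]; nlinarith [show (0:ℝ) ≤ (2 * n + 2) * B by positivity]
  have hnp := (le_max_left _ _).trans hn
  have hnq := (le_max_right _ _).trans hn
  exact ⟨C, fun s => η s ^ (2 * n + 2), fun s => η s ^ (2 * n + 2) * ζ s,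
    { smooth := hηs.pow _
      eq_one := fun s hs => by simp only [hηone s (by linarith), one_pow]
      eq_zero := fun s hs => by simp only [hηzero s hs]; exact zero_pow (by omega)
      anti := fun x y hxy => pow_le_pow_left₀ (hη0 y) (hanti hxy) _
      cont := (hηs.continuous.pow _).mul hζs.continuous
      nonneg := hϖ0
      le := fun s => mul_le_of_le_one_right (pow_nonneg (hη0 s) _) (hζ1 s)
      left := fun s hs => by simp only [hζzero s hs, mul_zero]
      pos := hCpos
      deriv_p := hD1 p hp hnp
      deriv_q := hD1 q hq hnq
      deriv2_p := hD2 p hp hnp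
      deriv2_q := hD2 q hq hnq }⟩

/-- A smooth function on the line that agrees with a negative power away from the origin. -/
theorem exists_smooth_rpow (α : ℝ) : ∃ P : ℝ → ℝ, ContDiff ℝ ∞ P ∧ (∀ s, s ≤ 1 / 4 → P s = 0) ∧
    ∀ s, 1 / 2 ≤ s → P s = s ^ (-α) := by
  refine ⟨fun s => Real.smoothTransition (4 * s - 1) * s ^ (-α), ?_, fun s hs => ?_, fun s hs => ?_⟩
  · refine contDiff_iff_contDiffAt.2 fun s => ?_
    rcases lt_or_ge s (1 / 4) with hs | hs
    · refine (contDiffAt_const (c := (0 : ℝ))).congr_of_eventuallyEq ?_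
      filter_upwards [Iio_mem_nhds hs] with x hx
      rw [Real.smoothTransition.zero_of_nonpos (by have : x < 1 / 4 := hx; linarith), zero_mul]
    · refine ContDiffAt.mul ?_ (Real.contDiffAt_rpow_const_of_ne (by linarith))
      exact (Real.smoothTransition.contDiff.comp (by fun_prop)).contDiffAt
  · beta_reduce
    rw [Real.smoothTransition.zero_of_nonpos (by linarith), zero_mul]
  · beta_reduce
    rw [Real.smoothTransition.one_of_one_le (by linarith), one_mul]

end WaveSystem

/-! ### Exact solutions of the wave equation and the tested identity -/

namespace WaveSystem

open Filter Topology

variable {N : ℕ} {T : ℝ}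

theorem hasDerivAt_dirDeriv {Ψ : Space N × ℝ → ℝ} (h : Differentiable ℝ Ψ) (v z : Space N × ℝ) :
    HasDerivAt (fun s : ℝ => Ψ (z + s • v)) (dirDeriv v Ψ z) 0 := by
  have h1 : HasFDerivAt Ψ (fderiv ℝ Ψ z) (z + (0 : ℝ) • v) := by
    simpa using h.differentiableAt.hasFDerivAt
  have h2 : HasDerivAt (fun s : ℝ => z + s • v) v 0 := by
    simpa using ((hasDerivAt_id (0 : ℝ)).smul_const v).const_add z
  exact h1.comp_hasDerivAt 0 h2

/-- The test function `P((M + t)² - |x|²) θ(t)`. -/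
noncomputable def coneTest (P : ℝ → ℝ) (M : ℝ) (θ : ℝ → ℝ) (z : Space N × ℝ) : ℝ :=
  P ((M + z.2) ^ 2 - ‖z.1‖ ^ 2) * θ z.2

theorem contDiff_coneTest {P θ : ℝ → ℝ} (M : ℝ) (hP : ContDiff ℝ ∞ P) (hθ : ContDiff ℝ ∞ θ) :
    ContDiff ℝ ∞ (coneTest (N := N) P M θ) := by
  refine (hP.comp ?_).mul (hθ.comp contDiff_snd)
  exact ((contDiff_const.add contDiff_snd).pow 2).sub ((contDiff_norm_sq ℝ).comp contDiff_fst)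

theorem dirDeriv_time_coneTest {P θ : ℝ → ℝ} (M : ℝ) (hP : ContDiff ℝ ∞ P) (hθ : ContDiff ℝ ∞ θ)
    (z : Space N × ℝ) : dirDeriv (timeDir N) (coneTest P M θ) z =
      coneTest (deriv P) M (fun t => 2 * (M + t) * θ t) z + coneTest P M (deriv θ) z := by
  refine (hasDerivAt_dirDeriv ((contDiff_coneTest M hP hθ).differentiable (by simp)) _ z).unique ?_
  have h0 : (fun s : ℝ => coneTest P M θ (z + s • timeDir N)) =
      fun s => P ((M + (z.2 + s)) ^ 2 - ‖z.1‖ ^ 2) * θ (z.2 + s) := by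
    funext s; simp [coneTest, timeDir]
  rw [h0]
  have h1 : HasDerivAt (fun s : ℝ => (M + (z.2 + s)) ^ 2 - ‖z.1‖ ^ 2) (2 * (M + z.2)) 0 := by
    have := ((((hasDerivAt_id (0 : ℝ)).const_add z.2).const_add M).pow 2).sub_const (‖z.1‖ ^ 2)
    simpa using this
  have h2 : HasDerivAt P (deriv P ((M + z.2) ^ 2 - ‖z.1‖ ^ 2))
      ((M + (z.2 + 0)) ^ 2 - ‖z.1‖ ^ 2) := by
    rw [add_zero]; exact (hP.differentiable (by simp)).differentiableAt.hasDerivAt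
  have h3 : HasDerivAt (fun s : ℝ => θ (z.2 + s)) (deriv θ z.2) 0 := by
    refine HasDerivAt.comp_const_add z.2 0 ?_
    rw [add_zero]; exact (hθ.differentiable (by simp)).differentiableAt.hasDerivAt
  refine ((h2.comp 0 h1).mul h3).congr_deriv ?_
  simp [coneTest]; ring

theorem norm_sq_add_smul_single (x : Space N) (i : Fin N) (s : ℝ) :
    ‖x + s • EuclideanSpace.single i (1 : ℝ)‖ ^ 2 = ‖x‖ ^ 2 + 2 * s * x i + s ^ 2 := by
  rw [norm_add_sq_real, inner_smul_right, EuclideanSpace.inner_single_right, norm_smul]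
  simp
  ring

theorem dirDeriv_space_coneTest {P θ : ℝ → ℝ} (M : ℝ) (hP : ContDiff ℝ ∞ P)
    (hθ : ContDiff ℝ ∞ θ) (i : Fin N) (z : Space N × ℝ) :
    dirDeriv (spaceDir i) (coneTest P M θ) z = -2 * (z.1 i * coneTest (deriv P) M θ z) := by
  refine (hasDerivAt_dirDeriv ((contDiff_coneTest M hP hθ).differentiable (by simp)) _ z).unique ?_
  have h0 : (fun s : ℝ => coneTest P M θ (z + s • spaceDir i)) =
      fun s => P ((M + z.2) ^ 2 - (‖z.1‖ ^ 2 + 2 * s * z.1 i + s ^ 2)) * θ z.2 := by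
    funext s; simp [coneTest, spaceDir, norm_sq_add_smul_single]
  rw [h0]
  have h1 : HasDerivAt (fun s : ℝ => (M + z.2) ^ 2 - (‖z.1‖ ^ 2 + 2 * s * z.1 i + s ^ 2))
      (-(2 * z.1 i)) 0 := by
    have := (((((hasDerivAt_id (0 : ℝ)).const_mul 2).mul_const (z.1 i)).const_add
      (‖z.1‖ ^ 2)).add ((hasDerivAt_id (0 : ℝ)).pow 2)).const_sub ((M + z.2) ^ 2)
    simpa using this
  have h2 : HasDerivAt P (deriv P ((M + z.2) ^ 2 - ‖z.1‖ ^ 2))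
      ((M + z.2) ^ 2 - (‖z.1‖ ^ 2 + 2 * 0 * z.1 i + 0 ^ 2)) := by
    have : (M + z.2) ^ 2 - (‖z.1‖ ^ 2 + 2 * 0 * z.1 i + 0 ^ 2) = (M + z.2) ^ 2 - ‖z.1‖ ^ 2 := by
      ring
    rw [this]; exact (hP.differentiable (by simp)).differentiableAt.hasDerivAt
  refine ((h2.comp 0 h1).mul_const (θ z.2)).congr_deriv ?_
  simp [coneTest]; ring

theorem dirDeriv_space_sq_coneTest {P θ : ℝ → ℝ} (M : ℝ) (hP : ContDiff ℝ ∞ P)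
    (hθ : ContDiff ℝ ∞ θ) (i : Fin N) (z : Space N × ℝ) :
    dirDeriv (spaceDir i) (dirDeriv (spaceDir i) (coneTest P M θ)) z =
      4 * z.1 i ^ 2 * coneTest (deriv (deriv P)) M θ z - 2 * coneTest (deriv P) M θ z := by
  have hP' : ContDiff ℝ ∞ (deriv P) := (contDiff_infty_iff_deriv.1 hP).2
  have hc : ContDiff ℝ ∞ (coneTest (N := N) (deriv P) M θ) := contDiff_coneTest M hP' hθ
  rw [funext (dirDeriv_space_coneTest M hP hθ i)]
  have hcoord : ContDiff ℝ ∞ fun z : Space N × ℝ => z.1 i :=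
    (EuclideanSpace.proj (𝕜 := ℝ) i).contDiff.comp contDiff_fst
  have hd : Differentiable ℝ fun z : Space N × ℝ => -2 * (z.1 i * coneTest (deriv P) M θ z) :=
    (contDiff_const.mul (hcoord.mul hc)).differentiable (n := ∞) (by simp)
  refine (hasDerivAt_dirDeriv hd _ z).unique ?_
  have h1 : HasDerivAt (fun s : ℝ => (z + s • spaceDir i).1 i) 1 0 := by
    have h0 : (fun s : ℝ => (z + s • spaceDir i).1 i) = fun s => z.1 i + s := by
      funext s; simp [spaceDir]
    rw [h0]; exact (hasDerivAt_id (0 : ℝ)).const_add _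
  have h2 := hasDerivAt_dirDeriv (hc.differentiable (by simp)) (spaceDir i) z
  rw [dirDeriv_space_coneTest M hP' hθ] at h2
  refine ((h1.mul h2).const_mul (-2)).congr_deriv ?_
  simp; ring

/-- With `σ = (M + t)² - |x|²` one has `(∂ₜσ)² - |∇σ|² = 4σ` and `□σ = 2(N + 1)`, so `□P(σ) = 4σP''
+ 2(N + 1)P'`; the remaining terms differentiate `θ`. -/
theorem waveOp_coneTest {P θ : ℝ → ℝ} (M : ℝ) (hP : ContDiff ℝ ∞ P) (hθ : ContDiff ℝ ∞ θ)
    (z : Space N × ℝ) : waveOp (coneTest P M θ) z =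
      (4 * ((M + z.2) ^ 2 - ‖z.1‖ ^ 2) * deriv (deriv P) ((M + z.2) ^ 2 - ‖z.1‖ ^ 2)
        + 2 * (N + 1) * deriv P ((M + z.2) ^ 2 - ‖z.1‖ ^ 2)) * θ z.2
      + 4 * (M + z.2) * deriv P ((M + z.2) ^ 2 - ‖z.1‖ ^ 2) * deriv θ z.2
      + P ((M + z.2) ^ 2 - ‖z.1‖ ^ 2) * deriv (deriv θ) z.2 := by
  have hP' : ContDiff ℝ ∞ (deriv P) := (contDiff_infty_iff_deriv.1 hP).2
  have hθ' : ContDiff ℝ ∞ (deriv θ) := (contDiff_infty_iff_deriv.1 hθ).2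
  have hθ2 : ContDiff ℝ ∞ fun t => 2 * (M + t) * θ t := by fun_prop
  have htime : dirDeriv (timeDir N) (dirDeriv (timeDir N) (coneTest P M θ)) z =
      coneTest (deriv (deriv P)) M (fun t => 2 * (M + t) * (2 * (M + t) * θ t)) z
      + coneTest (deriv P) M (deriv fun t => 2 * (M + t) * θ t) z
      + (coneTest (deriv P) M (fun t => 2 * (M + t) * deriv θ t) z
        + coneTest P M (deriv (deriv θ)) z) := by
    rw [funext (dirDeriv_time_coneTest M hP hθ), ← dirDeriv_time_coneTest M hP' hθ2,
      ← dirDeriv_time_coneTest M hP hθ']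
    have d1 := (contDiff_coneTest (N := N) M hP' hθ2).differentiable (by simp)
    have d2 := (contDiff_coneTest (N := N) M hP hθ').differentiable (by simp)
    refine (hasDerivAt_dirDeriv (d1.add d2) _ z).unique ?_
    exact (hasDerivAt_dirDeriv d1 _ z).add (hasDerivAt_dirDeriv d2 _ z)
  have hderiv : deriv (fun t => 2 * (M + t) * θ t) z.2 = 2 * θ z.2 + 2 * (M + z.2) * deriv θ z.2 := by
    have h1 : HasDerivAt (fun t : ℝ => 2 * (M + t)) 2 z.2 := by
      simpa using ((hasDerivAt_id z.2).const_add M).const_mul 2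
    exact (h1.mul (hθ.differentiable (by simp)).differentiableAt.hasDerivAt).deriv
  rw [waveOp, htime]
  simp_rw [dirDeriv_space_sq_coneTest M hP hθ]
  rw [Finset.sum_sub_distrib, ← Finset.sum_mul, ← Finset.mul_sum, ← EuclideanSpace.real_norm_sq_eq,
    Finset.sum_const, Finset.card_univ, Fintype.card_fin, nsmul_eq_mul]
  simp only [coneTest]
  rw [hderiv]
  ring

/-- On the set where `P` is the power `σ ^ (-α)` of the exact solution, only the terms in which
the cutoff is differentiated survive. -/
theorem waveOp_coneTest_of_rpow {P θ : ℝ → ℝ} {α : ℝ} (hα : α = 0 ∨ 2 * α = N - 1) (M : ℝ)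
    (hP : ContDiff ℝ ∞ P) (hPα : ∀ s, 1 / 2 ≤ s → P s = s ^ (-α)) (hθ : ContDiff ℝ ∞ θ)
    (z : Space N × ℝ) (hz : 1 ≤ (M + z.2) ^ 2 - ‖z.1‖ ^ 2) :
    waveOp (coneTest P M θ) z =
      ((M + z.2) ^ 2 - ‖z.1‖ ^ 2) ^ (-α) * deriv (deriv θ) z.2
      - 4 * α * (M + z.2) * ((M + z.2) ^ 2 - ‖z.1‖ ^ 2) ^ (-α - 1) * deriv θ z.2 := by
  rw [waveOp_coneTest M hP hθ]
  set σ := (M + z.2) ^ 2 - ‖z.1‖ ^ 2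
  have h1 : ∀ s, 1 / 2 < s → deriv P s = -α * s ^ (-α - 1) := fun s hs => by
    have : P =ᶠ[𝓝 s] fun s => s ^ (-α) := by
      filter_upwards [Ioi_mem_nhds hs] with x hx using hPα x (le_of_lt hx)
    rw [this.deriv_eq, (Real.hasDerivAt_rpow_const (Or.inl (by linarith))).deriv]
  have h2 : deriv (deriv P) σ = -α * ((-α - 1) * σ ^ (-α - 1 - 1)) := by
    have : deriv P =ᶠ[𝓝 σ] fun s => -α * s ^ (-α - 1) := by
      filter_upwards [Ioi_mem_nhds (show (1 : ℝ) / 2 < σ by linarith)] with x hx using h1 x hx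
    rw [this.deriv_eq, ((Real.hasDerivAt_rpow_const (Or.inl (by linarith))).const_mul (-α)).deriv]
  have h3 : σ ^ (-α - 1 - 1) * σ = σ ^ (-α - 1) := by
    conv_lhs => rw [← Real.rpow_add_one (by linarith : σ ≠ 0)]
    congr 1; ring
  rw [h2, h1 σ (by linarith), hPα σ (by linarith)]
  have h4 : 4 * σ * (-α * ((-α - 1) * σ ^ (-α - 1 - 1))) = 4 * α * (α + 1) * σ ^ (-α - 1) := by
    rw [← h3]; ring
  rw [h4]
  -- This product is, up to a factor, the coefficient of `σ^(-α-1)` in `□(σ^(-α))`, so the two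
  -- admitted values of `α` are those for which the power is an exact solution.
  have h5 : α * (2 * α - (N - 1)) = 0 := by
    rcases hα with h | h
    · rw [h]; ring
    · rw [h]; ring
  linear_combination 2 * σ ^ (-α - 1) * θ z.2 * h5

/-- The contribution of the initial data to the identity tested with `((M + t)² - |x|²) ^ (-α)`. -/
noncomputable def dataTerm (α M : ℝ) (f g : Space N → ℝ) : ℝ :=
  (∫ x, g x * (M ^ 2 - ‖x‖ ^ 2) ^ (-α))
    - ∫ x, f x * (-2 * α * M * (M ^ 2 - ‖x‖ ^ 2) ^ (-α - 1))

/-- The derivative terms of the cutoff in the tested identity. -/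
noncomputable def coneWeight (α M R : ℝ) (χ : ℝ → ℝ) (z : Space N × ℝ) : ℝ :=
  ((M + z.2) ^ 2 - ‖z.1‖ ^ 2) ^ (-α) * (deriv (deriv χ) (z.2 / R) / R ^ 2)
    - 4 * α * (M + z.2) * ((M + z.2) ^ 2 - ‖z.1‖ ^ 2) ^ (-α - 1) * (deriv χ (z.2 / R) / R)

theorem one_le_cone {r M t y : ℝ} (hr : 0 ≤ r) (hM : r + 1 ≤ M) (ht : 0 ≤ t) (hy : 0 ≤ y)
    (hyr : y ≤ r + t) : 1 ≤ (M + t) ^ 2 - y ^ 2 := by nlinarith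

/-- On the cone carrying `H` and `U` the argument of the power is at least `1`, so the smooth
modification needed to obtain a test function is invisible to both integrals. Near `t = 0` the
cutoff is constant, so the data term sees only the exact solution. -/
theorem TestedWave.core {ε r p q C R α M : ℝ} {f g : Space N → ℝ} {H U : Space N × ℝ → ℝ}
    {χ ϖ : ℝ → ℝ} (hw : TestedWave T ε f g r H U) (hχ : IsCutoff p q C χ ϖ) (hr : 0 ≤ r)
    (hf : ∀ x, r < ‖x‖ → f x = 0) (hg : ∀ x, r < ‖x‖ → g x = 0)
    (hα : α = 0 ∨ 2 * α = N - 1) (hM : r + 1 ≤ M) (hR : 0 < R) (hRT : R < T) :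
    ε * dataTerm α M f g
      + ∫ z, H z * (((M + z.2) ^ 2 - ‖z.1‖ ^ 2) ^ (-α) * χ (z.2 / R)) ∂(slab N T) =
        ∫ z, U z * coneWeight α M R χ z ∂(slab N T) := by
  obtain ⟨P, hP, hP0, hPα⟩ := exists_smooth_rpow α
  -- The second factor cuts off negative times, as compact support in `ℝᴺ × ℝ` requires. It is `1`
  -- for `t ≥ -1`, so it affects neither the slab nor the derivatives at `0`.
  set θ : ℝ → ℝ := fun t => χ (t / R) * Real.smoothTransition (t + 2) with hθdef
  have hθ : ContDiff ℝ ∞ θ := (hχ.smooth.comp (contDiff_id.div_const R)).mul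
    (Real.smoothTransition.contDiff.comp (by fun_prop))
  have hθ1 : ∀ t, -1 < t → θ =ᶠ[𝓝 t] fun t => χ (t / R) := fun t ht => by
    filter_upwards [Ioi_mem_nhds ht] with s hs
    have hs' : -1 < s := hs
    rw [hθdef]; beta_reduce
    rw [Real.smoothTransition.one_of_one_le (by linarith), mul_one]
  have hd1 : ∀ t, -1 < t → deriv θ t = deriv χ (t / R) / R := fun t ht => by
    rw [(hθ1 t ht).deriv_eq]
    have h1 : HasDerivAt (fun t : ℝ => t / R) (1 / R) t := (hasDerivAt_id t).div_const R
    have h2 := ((hχ.smooth.differentiable (by simp)).differentiableAt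
      (x := t / R)).hasDerivAt.comp t h1
    exact h2.deriv.trans (by ring)
  have hχ' : ContDiff ℝ ∞ (deriv χ) := (contDiff_infty_iff_deriv.1 hχ.smooth).2
  have hd2 : ∀ t, -1 < t → deriv (deriv θ) t = deriv (deriv χ) (t / R) / R ^ 2 := fun t ht => by
    have : deriv θ =ᶠ[𝓝 t] fun t => deriv χ (t / R) / R := by
      filter_upwards [Ioi_mem_nhds ht] with s hs using hd1 s hs
    rw [this.deriv_eq]
    have h1 : HasDerivAt (fun t : ℝ => t / R) (1 / R) t := (hasDerivAt_id t).div_const R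
    have h2 := (((hχ'.differentiable (by simp)).differentiableAt
      (x := t / R)).hasDerivAt.comp t h1).div_const R
    exact h2.deriv.trans (by field_simp)
  have htest : IsTestFunction T (coneTest (N := N) P M θ) := by
    set K : Set (Space N × ℝ) := Metric.closedBall 0 (M + R) ×ˢ Icc (-2) R with hK
    have hKc : IsCompact K := (isCompact_closedBall _ _).prod isCompact_Icc
    have hzero : ∀ z ∉ K, coneTest (N := N) P M θ z = 0 := by
      intro z hz
      by_cases h1 : z.2 < -2
      · have : θ z.2 = 0 := by
          rw [hθdef]; beta_reduce
          rw [Real.smoothTransition.zero_of_nonpos (by linarith), mul_zero]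
        rw [coneTest, this, mul_zero]
      by_cases h2 : R < z.2
      · have : θ z.2 = 0 := by
          rw [hθdef]; beta_reduce
          rw [hχ.eq_zero _ ((one_le_div hR).2 h2.le), zero_mul]
        rw [coneTest, this, mul_zero]
      -- For `-2 ≤ t ≤ R` and `|x| > M + R` the argument of `P` is negative, where `P` vanishes;
      -- this bounds the support in space.
      rw [coneTest, hP0, zero_mul]
      by_contra hlt
      rw [not_le] at hlt
      refine hz ⟨?_, not_lt.1 h1, not_lt.1 h2⟩
      rw [mem_closedBall_zero_iff]
      push Not at h1 h2
      by_contra hn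
      push Not at hn
      nlinarith [norm_nonneg z.1]
    have hsub : tsupport (coneTest (N := N) P M θ) ⊆ K :=
      closure_minimal (fun z hz => by_contra fun h => hz (hzero z h)) hKc.isClosed
    exact ⟨contDiff_coneTest M hP hθ, HasCompactSupport.intro hKc hzero,
      fun z hz => lt_of_le_of_lt (hsub hz).2.2 hRT⟩
  have key := hw.tested _ htest
  have hθ0 : θ 0 = 1 := by
    rw [(hθ1 0 (by norm_num)).eq_of_nhds, zero_div, hχ.eq_one 0 (by norm_num)]
  have hθ0' : deriv θ 0 = 0 := by
    have : χ =ᶠ[𝓝 0] fun _ => 1 := by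
      filter_upwards [Iio_mem_nhds (show (0 : ℝ) < 1 / 2 by norm_num)] with x hx
        using hχ.eq_one x (le_of_lt hx)
    rw [hd1 0 (by norm_num), zero_div, this.deriv_eq, deriv_const, zero_div]
  have hcone : ∀ x : Space N, ‖x‖ ≤ r → 1 ≤ M ^ 2 - ‖x‖ ^ 2 := fun x hx => by
    have := one_le_cone hr hM le_rfl (norm_nonneg x) (by simpa using hx)
    simpa using this
  have hgd : ∀ x, g x * coneTest P M θ (x, 0) = g x * (M ^ 2 - ‖x‖ ^ 2) ^ (-α) := fun x => by
    rcases le_or_gt ‖x‖ r with hx | hx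
    · simp only [coneTest, hθ0, mul_one, add_zero]
      rw [hPα _ (by linarith [hcone x hx])]
    · rw [hg x hx, zero_mul, zero_mul]
  have hfd : ∀ x, f x * dirDeriv (timeDir N) (coneTest P M θ) (x, 0) =
      f x * (-2 * α * M * (M ^ 2 - ‖x‖ ^ 2) ^ (-α - 1)) := fun x => by
    rcases le_or_gt ‖x‖ r with hx | hx
    · rw [dirDeriv_time_coneTest M hP hθ]
      simp only [coneTest, hθ0, hθ0', mul_one, add_zero, mul_zero]
      have : P =ᶠ[𝓝 (M ^ 2 - ‖x‖ ^ 2)] fun s => s ^ (-α) := by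
        filter_upwards [Ioi_mem_nhds (show (1 : ℝ) / 2 < M ^ 2 - ‖x‖ ^ 2 by
          linarith [hcone x hx])] with s hs using hPα s (le_of_lt hs)
      rw [this.deriv_eq, (Real.hasDerivAt_rpow_const (Or.inl (by linarith [hcone x hx]))).deriv]
      ring
    · rw [hf x hx, zero_mul, zero_mul]
  simp_rw [hgd, hfd] at key
  rw [dataTerm]
  have hpos : ∀ᵐ z ∂(slab N T), 0 < z.2 := by
    have h1 : ∀ᵐ t ∂(volume.restrict (Ioo 0 T)), (0 : ℝ) < t := by
      filter_upwards [ae_restrict_mem measurableSet_Ioo] with t ht using ht.1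
    rw [slab]
    exact Measure.quasiMeasurePreserving_snd.ae h1
  have e1 : ∫ z, H z * coneTest P M θ z ∂(slab N T) =
      ∫ z, H z * (((M + z.2) ^ 2 - ‖z.1‖ ^ 2) ^ (-α) * χ (z.2 / R)) ∂(slab N T) := by
    refine integral_congr_ae ?_
    filter_upwards [hpos, hw.cone'] with z hz hc
    rcases le_or_gt ‖z.1‖ (r + z.2) with hx | hx
    · have := one_le_cone hr hM hz.le (norm_nonneg z.1) hx
      rw [coneTest, hPα _ (by linarith), (hθ1 z.2 (by linarith)).eq_of_nhds]
    · rw [hc hx, zero_mul, zero_mul]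
  have e2 : ∫ z, U z * waveOp (coneTest P M θ) z ∂(slab N T) =
      ∫ z, U z * coneWeight α M R χ z ∂(slab N T) := by
    refine integral_congr_ae ?_
    filter_upwards [hpos, hw.cone] with z hz hc
    rcases le_or_gt ‖z.1‖ (r + z.2) with hx | hx
    · have := one_le_cone hr hM hz.le (norm_nonneg z.1) hx
      rw [waveOp_coneTest_of_rpow hα M hP hPα hθ z this, hd1 _ (by linarith), hd2 _ (by linarith),
        coneWeight]
    · rw [hc hx, zero_mul, zero_mul]
  rw [← e1, ← e2, ← key]

end WaveSystem

/-! ### Positivity of the data term and integrals of powers of the distance to the light cone -/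

namespace WaveSystem

open Filter Topology

variable {N : ℕ} {T : ℝ}

theorem tendsto_integral_mul_rpow {φ : Space N → ℝ} {r γ : ℝ} (hγ : 0 ≤ γ) (hφ : Integrable φ)
    (hr : ∀ x, r < ‖x‖ → φ x = 0) :
    Tendsto (fun M : ℝ => ∫ x, φ x * (1 - ‖x‖ ^ 2 / M ^ 2) ^ (-γ)) atTop (𝓝 (∫ x, φ x)) := by
  refine tendsto_integral_filter_of_dominated_convergence (fun x => |φ x| * 2 ^ γ) ?_ ?_
    (hφ.abs.mul_const _) ?_
  · refine Eventually.of_forall fun M => hφ.aestronglyMeasurable.mul ?_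
    exact ((measurable_const.sub ((measurable_norm.pow_const 2).div_const _)).pow_const
      (-γ)).aestronglyMeasurable
  · filter_upwards [eventually_ge_atTop (2 * |r| + 1)] with M hM
    refine Eventually.of_forall fun x => ?_
    rcases lt_or_ge r ‖x‖ with hx | hx
    · simp [hr x hx]
    · have h1 : ‖x‖ ^ 2 / M ^ 2 ≤ 1 / 2 := by
        have h0 := abs_nonneg r
        have h2 : ‖x‖ ≤ |r| := hx.trans (le_abs_self r)
        have hM0 : 0 < M := by linarith
        rw [div_le_iff₀ (by positivity)]
        nlinarith [norm_nonneg x]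
      rw [norm_mul, Real.norm_eq_abs]
      gcongr
      have h3 : (1 / 2 : ℝ) ≤ 1 - ‖x‖ ^ 2 / M ^ 2 := by linarith
      rw [Real.norm_eq_abs, abs_of_nonneg (Real.rpow_nonneg (by linarith) _)]
      calc (1 - ‖x‖ ^ 2 / M ^ 2) ^ (-γ) ≤ (1 / 2) ^ (-γ) :=
            Real.rpow_le_rpow_of_nonpos (by norm_num) h3 (by linarith)
        _ = 2 ^ γ := by rw [one_div, Real.inv_rpow (by norm_num), Real.rpow_neg (by norm_num), inv_inv]
  · refine Eventually.of_forall fun x => ?_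
    have h1 : Tendsto (fun M : ℝ => 1 - ‖x‖ ^ 2 / M ^ 2) atTop (𝓝 1) := by
      have : Tendsto (fun M : ℝ => ‖x‖ ^ 2 / M ^ 2) atTop (𝓝 0) :=
        tendsto_const_nhds.div_atTop (tendsto_pow_atTop (by norm_num))
      simpa using tendsto_const_nhds.sub this
    have h2 := (h1.rpow_const (p := -γ) (Or.inl one_ne_zero)).const_mul (φ x)
    simpa using h2

/-- Scaling out `M^(-2α)` leaves a quantity that tends to `∫ g` as `M → ∞`, the part from `f` being
smaller by a factor `M⁻¹`. -/
theorem dataTerm_eq {f g : Space N → ℝ} {r α M : ℝ} (hr : 0 ≤ r) (hM : r + 1 ≤ M)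
    (hf : ∀ x, r < ‖x‖ → f x = 0) (hg : ∀ x, r < ‖x‖ → g x = 0) :
    dataTerm α M f g = M ^ (-(2 * α)) * ((∫ x, g x * (1 - ‖x‖ ^ 2 / M ^ 2) ^ (-α))
      + 2 * α * M⁻¹ * ∫ x, f x * (1 - ‖x‖ ^ 2 / M ^ 2) ^ (-(α + 1))) := by
  have hM0 : 0 < M := by linarith
  have key : ∀ (γ : ℝ) (x : Space N), ‖x‖ ≤ r → (M ^ 2 - ‖x‖ ^ 2) ^ (-γ) =
      M ^ (-(2 * γ)) * (1 - ‖x‖ ^ 2 / M ^ 2) ^ (-γ) := fun γ x hx => by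
    have h1 : ‖x‖ ^ 2 / M ^ 2 ≤ 1 := by
      rw [div_le_one (by positivity)]
      exact pow_le_pow_left₀ (norm_nonneg x) (by linarith) 2
    have h2 : M ^ (-(2 * γ)) = (M ^ 2) ^ (-γ) := by
      rw [← Real.rpow_natCast, ← Real.rpow_mul hM0.le]; congr 1; push_cast; ring
    rw [h2, ← Real.mul_rpow (by positivity) (by linarith)]
    congr 1
    field_simp
  have e1 : ∀ x, g x * (M ^ 2 - ‖x‖ ^ 2) ^ (-α) =
      M ^ (-(2 * α)) * (g x * (1 - ‖x‖ ^ 2 / M ^ 2) ^ (-α)) := fun x => by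
    rcases lt_or_ge r ‖x‖ with hx | hx
    · simp [hg x hx]
    · rw [key α x hx]; ring
  have hpw : M * M ^ (-(2 * (α + 1))) = M ^ (-(2 * α)) * M⁻¹ := by
    rw [← Real.rpow_neg_one, ← Real.rpow_add hM0]
    nth_rewrite 1 [← Real.rpow_one M]
    rw [← Real.rpow_add hM0]
    congr 1; ring
  have e2 : ∀ x, f x * (-2 * α * M * (M ^ 2 - ‖x‖ ^ 2) ^ (-α - 1)) =
      -(M ^ (-(2 * α)) * (2 * α * M⁻¹)) * (f x * (1 - ‖x‖ ^ 2 / M ^ 2) ^ (-(α + 1))) := fun x => by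
    rcases lt_or_ge r ‖x‖ with hx | hx
    · simp [hf x hx]
    · rw [show -α - 1 = -(α + 1) by ring, key (α + 1) x hx]
      linear_combination -2 * α * f x * (1 - ‖x‖ ^ 2 / M ^ 2) ^ (-(α + 1)) * hpw
  rw [dataTerm]
  simp_rw [e1, e2]
  rw [integral_const_mul, integral_const_mul]
  ring

/-- The initial data contribute with a positive sign once the time origin is moved far enough. -/
theorem eventually_dataTerm_pos {f g : Space N → ℝ} {r α : ℝ} (hr : 0 ≤ r) (hα : 0 ≤ α)
    (hfi : Integrable f) (hgi : Integrable g)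
    (hf : ∀ x, r < ‖x‖ → f x = 0) (hg : ∀ x, r < ‖x‖ → g x = 0) (hI : 0 < ∫ x, g x) :
    ∀ᶠ M in atTop, 0 < dataTerm α M f g := by
  have h1 := tendsto_integral_mul_rpow hα hgi hg
  have h2 := tendsto_integral_mul_rpow (by linarith : 0 ≤ α + 1) hfi hf
  have h3 : Tendsto (fun M : ℝ => 2 * α * M⁻¹) atTop (𝓝 0) := by
    simpa using tendsto_inv_atTop_zero.const_mul (2 * α)
  have h4 := h1.add (h3.mul h2)
  rw [zero_mul, add_zero] at h4
  filter_upwards [h4.eventually (lt_mem_nhds hI), eventually_ge_atTop (r + 1)] with M hM hMr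
  rw [dataTerm_eq hr hMr hf hg]
  exact mul_pos (Real.rpow_pos_of_pos (by linarith) _) hM

theorem dataTerm_zero (M : ℝ) (f g : Space N → ℝ) : dataTerm 0 M f g = ∫ x, g x := by
  simp [dataTerm]

/-- The power `(c + t - |x|) ^ (-λ)` of the distance to the light cone, in the region of the slab
that the solution occupies before the time `R`. -/
noncomputable def conePow (c r R l : ℝ) (z : Space N × ℝ) : ℝ :=
  {z : Space N × ℝ | ‖z.1‖ ≤ r + z.2 ∧ 0 ≤ z.2 ∧ z.2 ≤ R}.indicator
    (fun z => (c + z.2 - ‖z.1‖) ^ (-l)) z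

theorem conePow_nonneg {c r R l : ℝ} (hc : r + 1 ≤ c) (z : Space N × ℝ) :
    0 ≤ conePow c r R l z := by
  refine indicator_nonneg (fun z hz => Real.rpow_nonneg ?_ _) z
  have := hz.1
  linarith

theorem conePow_of_mem {c r R l : ℝ} {z : Space N × ℝ} (h1 : ‖z.1‖ ≤ r + z.2) (h2 : 0 ≤ z.2)
    (h3 : z.2 ≤ R) : conePow c r R l z = (c + z.2 - ‖z.1‖) ^ (-l) :=
  indicator_of_mem (s := {z : Space N × ℝ | ‖z.1‖ ≤ r + z.2 ∧ 0 ≤ z.2 ∧ z.2 ≤ R})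
    (show z ∈ _ from ⟨h1, h2, h3⟩) _

theorem measurable_conePow (c r R l : ℝ) : Measurable (conePow (N := N) c r R l) := by
  refine Measurable.indicator ?_ ?_
  · exact ((measurable_const.add measurable_snd).sub (measurable_norm.comp measurable_fst)).pow_const _
  · exact (measurableSet_le measurable_fst.norm (measurable_snd.const_add r)).inter
      ((measurableSet_le measurable_const measurable_snd).inter
        (measurableSet_le measurable_snd measurable_const))

theorem conePow_rpow {c r R l s : ℝ} (hc : r + 1 ≤ c) (hs : s ≠ 0) (z : Space N × ℝ) :
    conePow c r R l z ^ s = conePow c r R (l * s) z := by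
  by_cases hz : ‖z.1‖ ≤ r + z.2 ∧ 0 ≤ z.2 ∧ z.2 ≤ R
  · rw [conePow_of_mem hz.1 hz.2.1 hz.2.2, conePow_of_mem hz.1 hz.2.1 hz.2.2,
      ← Real.rpow_mul (by linarith [hz.1])]
    congr 1; ring
  · rw [conePow, indicator_of_notMem (by exact hz), conePow, indicator_of_notMem (by exact hz),
      Real.zero_rpow hs]

/-- Integrating first in time, no polar coordinates are needed. -/
theorem lintegral_conePow_le {c r R l : ℝ} (hr : 0 ≤ r) (hc : r + 1 ≤ c) (hR : 1 ≤ R) :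
    ∫⁻ z, ENNReal.ofReal (conePow c r R l z) ∂(slab N T) ≤
      ENNReal.ofReal ((c * R) ^ N * (volume (Metric.ball (0 : Space N) 1)).toReal
        * ∫ y in (1 : ℝ)..(c + R), y ^ (-l)) := by
  have hcR : (1 : ℝ) ≤ c + R := by linarith
  set J : ENNReal := ∫⁻ y in Icc 1 (c + R), ENNReal.ofReal (y ^ (-l)) with hJ
  have hJe : J = ENNReal.ofReal (∫ y in (1 : ℝ)..(c + R), y ^ (-l)) := by
    rw [intervalIntegral.integral_of_le hcR, ← integral_Icc_eq_integral_Ioc,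
      ofReal_integral_eq_lintegral_ofReal]
    · refine (ContinuousOn.integrableOn_Icc ?_)
      exact continuousOn_id.rpow_const fun y hy => Or.inl (by
        have := hy.1; exact ne_of_gt (by simp only [id]; linarith))
    · filter_upwards [ae_restrict_mem measurableSet_Icc] with y hy
      exact Real.rpow_nonneg (by linarith [hy.1]) _
  -- For fixed `x` put `y = c + t - |x|`. It stays in `[1, c + R]`, so the time integral has a bound
  -- independent of `x`; nonempty time slices need `|x| ≤ r + R ≤ cR`.
  have hin : ∀ x : Space N, ∫⁻ t in Ioo 0 T, ENNReal.ofReal (conePow c r R l (x, t)) ≤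
      (Metric.closedBall (0 : Space N) (c * R)).indicator (fun _ => J) x := by
    intro x
    by_cases hx : x ∈ Metric.closedBall (0 : Space N) (c * R)
    · rw [indicator_of_mem hx]
      have h1 : ∀ t, ENNReal.ofReal (conePow c r R l (x, t)) ≤
          (Icc 1 (c + R)).indicator (fun y => ENNReal.ofReal (y ^ (-l))) (t + (c - ‖x‖)) := by
        intro t
        by_cases hz : ‖x‖ ≤ r + t ∧ 0 ≤ t ∧ t ≤ R
        · rw [conePow_of_mem (z := (x, t)) hz.1 hz.2.1 hz.2.2, indicator_of_mem]
          · apply le_of_eq; congr 2; simp only; ring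
          · have := norm_nonneg x
            exact ⟨by linarith [hz.1], by linarith [hz.2.2]⟩
        · rw [conePow, indicator_of_notMem (by exact hz)]; simp
      calc ∫⁻ t in Ioo 0 T, ENNReal.ofReal (conePow c r R l (x, t))
          ≤ ∫⁻ t, ENNReal.ofReal (conePow c r R l (x, t)) := setLIntegral_le_lintegral _ _
        _ ≤ ∫⁻ t, (Icc 1 (c + R)).indicator (fun y => ENNReal.ofReal (y ^ (-l)))
              (t + (c - ‖x‖)) := lintegral_mono h1
        _ = J := by rw [lintegral_add_right_eq_self, lintegral_indicator measurableSet_Icc]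
    · rw [indicator_of_notMem hx]
      refine le_of_eq ((lintegral_congr fun t => ?_).trans lintegral_zero)
      have : ¬ (‖x‖ ≤ r + t ∧ 0 ≤ t ∧ t ≤ R) := by
        rintro ⟨h1, h2, h3⟩
        refine hx (mem_closedBall_zero_iff.2 ?_)
        nlinarith
      rw [conePow, indicator_of_notMem (by exact this), ENNReal.ofReal_zero]
  calc ∫⁻ z, ENNReal.ofReal (conePow c r R l z) ∂(slab N T)
      = ∫⁻ x, ∫⁻ t in Ioo 0 T, ENNReal.ofReal (conePow c r R l (x, t)) := by
        rw [slab, lintegral_prod _ (measurable_conePow c r R l).ennreal_ofReal.aemeasurable]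
    _ ≤ ∫⁻ x, (Metric.closedBall (0 : Space N) (c * R)).indicator (fun _ => J) x :=
        lintegral_mono hin
    _ = J * volume (Metric.closedBall (0 : Space N) (c * R)) := by
        rw [lintegral_indicator Metric.isClosed_closedBall.measurableSet, setLIntegral_const]
    _ ≤ _ := by
        have hcR0 : 0 ≤ c * R := by nlinarith
        rw [Measure.addHaar_closedBall _ _ hcR0, hJe, finrank_euclideanSpace_fin,
          ENNReal.ofReal_mul (by positivity), ENNReal.ofReal_mul (by positivity),
          ENNReal.ofReal_toReal Metric.isBounded_ball.measure_lt_top.ne, mul_comm]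

end WaveSystem

/-! ### Dyadic sums, Hölder's inequality and the size of the cutoff terms -/

namespace WaveSystem

open Filter Topology

variable {N : ℕ} {T : ℝ}

/-- The sum is dominated by the terms with `2^k` comparable to `d`: for smaller `2^k` the terms grow
geometrically because `κ > 0`, for larger ones they decay geometrically because `κ < l`. -/
theorem exists_dyadic_sum_le {κ l : ℝ} (hκ : 0 < κ) (hl : κ < l) :
    ∃ K, 0 < K ∧ ∀ d : ℝ, 1 ≤ d → ∀ n : ℕ,
      ∑ k ∈ Finset.range n, ((2 : ℝ) ^ k) ^ κ * (d + 2 ^ k) ^ (-l) ≤ K * d ^ (κ - l) := by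
  set a : ℝ := 2 ^ κ with ha
  set b : ℝ := 2 ^ (κ - l) with hb
  have ha1 : 1 < a := Real.one_lt_rpow (by norm_num) hκ
  have hb0 : 0 < b := by positivity
  have hb1 : b < 1 := Real.rpow_lt_one_of_one_lt_of_neg (by norm_num) (by linarith)
  have hapow : ∀ k : ℕ, a ^ k = ((2 : ℝ) ^ k) ^ κ := fun k => by
    rw [ha, ← Real.rpow_natCast, ← Real.rpow_natCast, ← Real.rpow_mul (by norm_num),
      ← Real.rpow_mul (by norm_num), mul_comm]
  have hbpow : ∀ k : ℕ, b ^ k = ((2 : ℝ) ^ k) ^ (κ - l) := fun k => by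
    rw [hb, ← Real.rpow_natCast, ← Real.rpow_natCast, ← Real.rpow_mul (by norm_num),
      ← Real.rpow_mul (by norm_num), mul_comm]
  have hK1 : 0 < a / (a - 1) := div_pos (by linarith) (by linarith)
  have hK2 : 0 < (1 - b)⁻¹ := inv_pos.2 (by linarith)
  refine ⟨a / (a - 1) + (1 - b)⁻¹, by positivity, fun d hd n => ?_⟩
  -- The sum is split at `2^m ≤ d < 2^(m+1)`.
  obtain ⟨m, hm1, hm2⟩ := exists_nat_pow_near hd (one_lt_two : (1 : ℝ) < 2)
  have hd0 : 0 < d := by linarith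
  have hterm : ∀ k : ℕ, 0 ≤ ((2 : ℝ) ^ k) ^ κ * (d + 2 ^ k) ^ (-l) := fun k => by positivity
  have h1 : ∑ k ∈ Finset.range (m + 1), ((2 : ℝ) ^ k) ^ κ * (d + 2 ^ k) ^ (-l) ≤
      a / (a - 1) * d ^ (κ - l) := by
    calc ∑ k ∈ Finset.range (m + 1), ((2 : ℝ) ^ k) ^ κ * (d + 2 ^ k) ^ (-l)
        ≤ ∑ k ∈ Finset.range (m + 1), a ^ k * d ^ (-l) := by
          refine Finset.sum_le_sum fun k _ => ?_
          rw [hapow]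
          have hk : (0 : ℝ) < 2 ^ k := by positivity
          exact mul_le_mul_of_nonneg_left (Real.rpow_le_rpow_of_nonpos hd0 (by linarith)
            (by linarith)) (by positivity)
      _ = (a ^ (m + 1) - 1) / (a - 1) * d ^ (-l) := by
          rw [← Finset.sum_mul, geom_sum_eq ha1.ne']
      _ ≤ a / (a - 1) * d ^ κ * d ^ (-l) := by
          gcongr
          rw [div_mul_eq_mul_div]
          have h2 : a ^ m ≤ d ^ κ := by
            rw [hapow]; exact Real.rpow_le_rpow (by positivity) hm1 hκ.le
          have h3 : 0 < a - 1 := by linarith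
          gcongr
          rw [pow_succ]
          nlinarith
      _ = a / (a - 1) * d ^ (κ - l) := by
          rw [mul_assoc, ← Real.rpow_add hd0]; rfl
  have h2 : ∑ j ∈ Finset.range n, ((2 : ℝ) ^ (m + 1 + j)) ^ κ * (d + 2 ^ (m + 1 + j)) ^ (-l) ≤
      (1 - b)⁻¹ * d ^ (κ - l) := by
    calc ∑ j ∈ Finset.range n, ((2 : ℝ) ^ (m + 1 + j)) ^ κ * (d + 2 ^ (m + 1 + j)) ^ (-l)
        ≤ ∑ j ∈ Finset.range n, d ^ (κ - l) * b ^ j := by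
          refine Finset.sum_le_sum fun j _ => ?_
          have hp : (0 : ℝ) < 2 ^ (m + 1 + j) := by positivity
          calc ((2 : ℝ) ^ (m + 1 + j)) ^ κ * (d + 2 ^ (m + 1 + j)) ^ (-l)
              ≤ ((2 : ℝ) ^ (m + 1 + j)) ^ κ * (2 ^ (m + 1 + j)) ^ (-l) := by
                gcongr ?_ * ?_
                exact Real.rpow_le_rpow_of_nonpos hp (by linarith) (by linarith)
            _ = b ^ (m + 1) * b ^ j := by
                rw [← Real.rpow_add hp, ← pow_add, hbpow]; rfl
            _ ≤ d ^ (κ - l) * b ^ j := by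
                gcongr
                rw [hbpow]
                exact Real.rpow_le_rpow_of_nonpos hd0 hm2.le (by linarith)
      _ = d ^ (κ - l) * ∑ j ∈ Finset.range n, b ^ j := by rw [Finset.mul_sum]
      _ ≤ d ^ (κ - l) * (1 - b)⁻¹ := by
          gcongr
          rw [← tsum_geometric_of_lt_one hb0.le hb1]
          exact (summable_geometric_of_lt_one hb0.le hb1).sum_le_tsum _ fun _ _ => by positivity
      _ = _ := mul_comm _ _
  calc ∑ k ∈ Finset.range n, ((2 : ℝ) ^ k) ^ κ * (d + 2 ^ k) ^ (-l)
      ≤ ∑ k ∈ Finset.range (m + 1 + n), ((2 : ℝ) ^ k) ^ κ * (d + 2 ^ k) ^ (-l) :=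
        Finset.sum_le_sum_of_subset_of_nonneg (Finset.range_subset_range.2 (by omega))
          fun k _ _ => hterm k
    _ ≤ _ := by rw [Finset.sum_range_add, add_mul]; exact add_le_add h1 h2

/-- The part of `∫ |U|^q` in the transition layer of the cutoff at time scale `R`. -/
noncomputable def layer (T q R : ℝ) (ϖ : ℝ → ℝ) (U : Space N × ℝ → ℝ) : ℝ :=
  ∫ z, |U z| ^ q * ϖ (z.2 / R) ∂(slab N T)

section Cutoff

variable {p q C R : ℝ} {χ ϖ : ℝ → ℝ}

theorem IsCutoff.integrable_mul (hχ : IsCutoff p q C χ ϖ) {F : Space N × ℝ → ℝ}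
    (hF : Integrable F (slab N T)) : Integrable (fun z => F z * ϖ (z.2 / R)) (slab N T) := by
  refine hF.mul_bdd (c := 1) (hχ.cont.comp (continuous_snd.div_const R)).aestronglyMeasurable
    (Eventually.of_forall fun z => ?_)
  rw [Real.norm_eq_abs, abs_of_nonneg (hχ.nonneg _)]
  exact (hχ.le _).trans (hχ.le_one _)

theorem IsCutoff.integrable_mul' (hχ : IsCutoff p q C χ ϖ) {F : Space N × ℝ → ℝ}
    (hF : Integrable F (slab N T)) : Integrable (fun z => F z * χ (z.2 / R)) (slab N T) := by
  refine hF.mul_bdd (c := 1) (hχ.smooth.continuous.comp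
    (continuous_snd.div_const R)).aestronglyMeasurable (Eventually.of_forall fun z => ?_)
  rw [Real.norm_eq_abs, abs_of_nonneg (hχ.nonneg' _)]
  exact hχ.le_one _

/-- Hölder's inequality with the weight `(c + t - |x|) ^ (-l)`. -/
theorem IsCutoff.hoelder (hχ : IsCutoff p q C χ ϖ) (hq : 1 < q) {U : Space N × ℝ → ℝ}
    (hU : Measurable U) (hUq : Integrable (fun z => |U z| ^ q) (slab N T))
    {r c l : ℝ} (hr : 0 ≤ r) (hc : r + 1 ≤ c) (hR : 1 ≤ R) :
    Integrable (fun z => |U z| * ϖ (z.2 / R) ^ (1 / q) * conePow c r R l z) (slab N T) ∧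
    ∫ z, |U z| * ϖ (z.2 / R) ^ (1 / q) * conePow c r R l z ∂(slab N T) ≤
      layer T q R ϖ U ^ (1 / q) * ((c * R) ^ N * (volume (Metric.ball (0 : Space N) 1)).toReal
        * ∫ y in (1 : ℝ)..(c + R), y ^ (-(l * (q / (q - 1))))) ^ (1 - 1 / q) := by
  have hq0 : 0 < q := by linarith
  set q' := q / (q - 1) with hq'
  have hq'0 : 0 < q' := div_pos hq0 (by linarith)
  have hconj : q.HolderConjugate q' := Real.HolderConjugate.conjExponent hq
  have hinv : 1 / q' = 1 - 1 / q := by rw [hq']; field_simp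
  set F : Space N × ℝ → ℝ := fun z => |U z| * ϖ (z.2 / R) ^ (1 / q) with hF
  have hF0 : ∀ z, 0 ≤ F z := fun z => mul_nonneg (abs_nonneg _) (Real.rpow_nonneg (hχ.nonneg _) _)
  have hFm : Measurable F := (continuous_abs.measurable.comp hU).mul
    (((hχ.cont.comp (continuous_snd.div_const R)).measurable).pow_const _)
  have hFq : ∀ z, F z ^ q = |U z| ^ q * ϖ (z.2 / R) := fun z => by
    rw [hF]; beta_reduce
    rw [Real.mul_rpow (abs_nonneg _) (Real.rpow_nonneg (hχ.nonneg _) _),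
      ← Real.rpow_mul (hχ.nonneg _), one_div_mul_cancel hq0.ne', Real.rpow_one]
  have hFL : MemLp F (ENNReal.ofReal q) (slab N T) := by
    rw [← integrable_norm_rpow_iff hFm.aestronglyMeasurable (by simpa using hq0) (by simp)]
    refine (hχ.integrable_mul (R := R) hUq).congr (Eventually.of_forall fun z => ?_)
    simp only [Real.norm_eq_abs, ENNReal.toReal_ofReal hq0.le]
    rw [abs_of_nonneg (hF0 z), hFq]
  have hlint := lintegral_conePow_le (N := N) (T := T) (l := l * q') hr hc hR
  have hgi : Integrable (conePow (N := N) c r R (l * q')) (slab N T) := by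
    refine ⟨(measurable_conePow _ _ _ _).aestronglyMeasurable, ?_⟩
    rw [hasFiniteIntegral_iff_ofReal (Eventually.of_forall fun z => conePow_nonneg hc z)]
    exact hlint.trans_lt ENNReal.ofReal_lt_top
  have hgL : MemLp (conePow (N := N) c r R l) (ENNReal.ofReal q') (slab N T) := by
    rw [← integrable_norm_rpow_iff (measurable_conePow _ _ _ _).aestronglyMeasurable
      (by simpa using hq'0) (by simp)]
    refine hgi.congr (Eventually.of_forall fun z => ?_)
    simp only [Real.norm_eq_abs, ENNReal.toReal_ofReal hq'0.le]
    rw [abs_of_nonneg (conePow_nonneg hc z), conePow_rpow hc hq'0.ne']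
  have hJ0 : 0 ≤ ∫ y in (1 : ℝ)..(c + R), y ^ (-(l * q')) :=
    intervalIntegral.integral_nonneg (by linarith) fun y hy =>
      Real.rpow_nonneg (by linarith [hy.1]) _
  have hcR : 0 ≤ c * R := by nlinarith
  refine ⟨?_, ?_⟩
  · have : ENNReal.HolderConjugate (ENNReal.ofReal q) (ENNReal.ofReal q') :=
      hconj.ennrealOfReal
    exact hFL.integrable_mul hgL
  · refine (integral_mul_le_Lp_mul_Lq_of_nonneg hconj (Eventually.of_forall hF0)
      (Eventually.of_forall fun z => conePow_nonneg hc z) hFL hgL).trans ?_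
    simp_rw [hFq, conePow_rpow hc hq'0.ne', hinv]
    have h1 : 0 ≤ 1 - 1 / q := by rw [← hinv]; positivity
    refine mul_le_mul_of_nonneg_left (Real.rpow_le_rpow
      (integral_nonneg fun z => conePow_nonneg hc z) ?_ h1) (Real.rpow_nonneg
      (integral_nonneg fun z => mul_nonneg (Real.rpow_nonneg (abs_nonneg _) _) (hχ.nonneg _)) _)
    rw [integral_eq_lintegral_of_nonneg_ae (Eventually.of_forall fun z => conePow_nonneg hc z)
      (measurable_conePow _ _ _ _).aestronglyMeasurable]
    exact ENNReal.toReal_le_of_le_ofReal (by positivity) hlint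

/-- In the layer, `m = c + s + t` is comparable to `R`. Since `σ = (m - |x|)(m + |x|)`, both cutoff
terms are of size `R⁻¹ m σ^(-α-1)`, at most a multiple of `R^(-1-α) (m - |x|)^(-α-1)`. The constant
does not depend on the shift `s`, which is what allows translates to be summed. -/
theorem abs_coneWeight_le (hχ : IsCutoff p q C χ ϖ) (hq : 1 < q) {r c s α : ℝ} (hr : 0 ≤ r)
    (hc : r + 1 ≤ c) (hα : 0 ≤ α) (hR : 1 ≤ R) (hs0 : 0 ≤ s) (hs : s ≤ (c + 1) * R)
    {z : Space N × ℝ} (hz0 : 0 < z.2) (hz : ‖z.1‖ ≤ r + z.2) :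
    |coneWeight α (c + s) R χ z| ≤ C * (2 * c + 2 + 4 * α) * 2 ^ α * R ^ (-1 - α) *
      (ϖ (z.2 / R) ^ (1 / q) * conePow (c + s) r R (α + 1) z) := by
  have hC := hχ.pos
  have hϖ0 := hχ.nonneg (z.2 / R)
  have hR0 : 0 < R := by linarith
  have hcp : 0 ≤ conePow (c + s) r R (α + 1) z := conePow_nonneg (by linarith) z
  have hd1 := hχ.deriv_q (z.2 / R)
  have hd2 := hχ.deriv2_q (z.2 / R)
  have hq0 : (1 / q) ≠ 0 := by positivity
  -- Where `ϖ` vanishes so do both derivatives of `χ`; otherwise `R/2 ≤ t ≤ R`.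
  rcases hϖ0.eq_or_lt with h0 | h0
  · rw [← h0, Real.zero_rpow hq0, mul_zero] at hd1 hd2
    have e1 := abs_nonpos_iff.1 hd1
    have e2 := abs_nonpos_iff.1 hd2
    rw [coneWeight, e1, e2, ← h0, Real.zero_rpow hq0]
    simp
  have hlo : R / 2 ≤ z.2 := by
    by_contra hlt
    push Not at hlt
    exact h0.ne' (hχ.left _ (by rw [div_le_iff₀ hR0]; linarith))
  have hhi : z.2 ≤ R := by
    by_contra hlt
    push Not at hlt
    exact h0.ne' (hχ.right _ (by rw [le_div_iff₀ hR0]; linarith))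
  have hy := norm_nonneg z.1
  rw [conePow_of_mem hz hz0.le hhi]
  set w := ϖ (z.2 / R) ^ (1 / q)
  have hw : 0 ≤ w := Real.rpow_nonneg hϖ0 _
  set m := c + s + z.2 with hm
  set y := ‖z.1‖ with hydef
  have hm1 : R / 2 ≤ m := by linarith
  have hm0 : 0 < m := by linarith
  have hmy : 1 ≤ m - y := by linarith
  have hmR : m ≤ (2 * c + 2) * R := by
    have : c ≤ c * R := le_mul_of_one_le_right (by linarith) hR
    linarith
  set σ := m ^ 2 - y ^ 2 with hσ
  have hσ1 : 1 ≤ σ := by nlinarith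
  have hσ0 : 0 < σ := by linarith
  have hpw : m * σ ^ (-α - 1) ≤ 2 ^ α * R ^ (-α) * (m - y) ^ (-(α + 1)) := by
    have h1 : σ ^ (-α - 1) ≤ (m * (m - y)) ^ (-α - 1) :=
      Real.rpow_le_rpow_of_nonpos (by positivity) (by nlinarith) (by linarith)
    have h2 : m * m ^ (-α - 1) = m ^ (-α) := by
      nth_rewrite 1 [← Real.rpow_one m]
      rw [← Real.rpow_add hm0]; congr 1; ring
    have h3 : m ^ (-α) ≤ (R / 2) ^ (-α) :=
      Real.rpow_le_rpow_of_nonpos (by linarith) hm1 (by linarith)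
    have h4 : (R / 2) ^ (-α) = 2 ^ α * R ^ (-α) := by
      rw [Real.div_rpow hR0.le (by norm_num), Real.rpow_neg (by norm_num : (0 : ℝ) ≤ 2), div_inv_eq_mul, mul_comm]
    have h5 : 0 ≤ (m - y) ^ (-(α + 1)) := Real.rpow_nonneg (by linarith) _
    calc m * σ ^ (-α - 1) ≤ m * (m * (m - y)) ^ (-α - 1) := by gcongr
      _ = m ^ (-α) * (m - y) ^ (-(α + 1)) := by
          rw [Real.mul_rpow hm0.le (by linarith), ← mul_assoc, h2, show -(α + 1) = -α - 1 by ring]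
      _ ≤ _ := by rw [← h4]; gcongr
  have hσα : σ ^ (-α) ≤ (2 * c + 2) * R * (m * σ ^ (-α - 1)) := by
    have h1 : σ ^ (-α) = σ * σ ^ (-α - 1) := by
      nth_rewrite 2 [← Real.rpow_one σ]
      rw [← Real.rpow_add hσ0]; congr 1; ring
    rw [h1]
    have h2 : σ ≤ (2 * c + 2) * R * m := by nlinarith [sq_nonneg y]
    have := Real.rpow_nonneg hσ0.le (-α - 1)
    nlinarith
  have hσp : 0 ≤ σ ^ (-α - 1) := Real.rpow_nonneg hσ0.le _
  have hRR : R ^ (-1 - α) = R⁻¹ * R ^ (-α) := by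
    rw [← Real.rpow_neg_one, ← Real.rpow_add hR0]; rfl
  have h1 : |σ ^ (-α) * (deriv (deriv χ) (z.2 / R) / R ^ 2)| ≤
      (2 * c + 2) * (m * σ ^ (-α - 1)) * (C * w) * R⁻¹ := by
    rw [abs_mul, abs_div, abs_of_nonneg (Real.rpow_nonneg hσ0.le _), abs_of_pos (by positivity : 0 < R ^ 2)]
    calc σ ^ (-α) * (|deriv (deriv χ) (z.2 / R)| / R ^ 2)
        ≤ (2 * c + 2) * R * (m * σ ^ (-α - 1)) * (C * w / R ^ 2) := by
          refine mul_le_mul hσα ?_ (by positivity) ?_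
          · gcongr
          · have : 0 ≤ 2 * c + 2 := by linarith
            positivity
      _ = _ := by field_simp
  have h2 : |4 * α * m * σ ^ (-α - 1) * (deriv χ (z.2 / R) / R)| ≤
      4 * α * (m * σ ^ (-α - 1)) * (C * w) * R⁻¹ := by
    rw [abs_mul, abs_div, abs_of_pos hR0, abs_of_nonneg (by positivity)]
    calc 4 * α * m * σ ^ (-α - 1) * (|deriv χ (z.2 / R)| / R)
        ≤ 4 * α * m * σ ^ (-α - 1) * (C * w / R) := by gcongr
      _ = _ := by field_simp
  rw [coneWeight]
  refine (abs_sub _ _).trans ((add_le_add h1 h2).trans ?_)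
  have hc0 : 0 ≤ 2 * c + 2 + 4 * α := by linarith
  calc (2 * c + 2) * (m * σ ^ (-α - 1)) * (C * w) * R⁻¹ + 4 * α * (m * σ ^ (-α - 1)) * (C * w) * R⁻¹
      = (2 * c + 2 + 4 * α) * (C * w) * R⁻¹ * (m * σ ^ (-α - 1)) := by ring
    _ ≤ (2 * c + 2 + 4 * α) * (C * w) * R⁻¹ * (2 ^ α * R ^ (-α) * (m - y) ^ (-(α + 1))) := by
        gcongr
    _ = _ := by rw [hRR]; ring

end Cutoff

end WaveSystem

/-! ### Estimates from the constant and from a single exact solution -/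

namespace WaveSystem

open Filter Topology

variable {N : ℕ}

theorem ae_slab_pos (N : ℕ) (T : ℝ) : ∀ᵐ z ∂(slab N T), 0 < z.2 := by
  have h1 : ∀ᵐ t ∂(volume.restrict (Ioo 0 T)), (0 : ℝ) < t := by
    filter_upwards [ae_restrict_mem measurableSet_Ioo] with t ht using ht.1
  rw [slab]
  exact Measure.quasiMeasurePreserving_snd.ae h1

section Estimates

variable {p q C r c : ℝ} {χ ϖ : ℝ → ℝ}

theorem TestedWave.ae_abs_mul_coneWeight_le {T ε R α s : ℝ} {f g : Space N → ℝ}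
    {H U : Space N × ℝ → ℝ} (hw : TestedWave T ε f g r H U) (hχ : IsCutoff p q C χ ϖ) (hq : 1 < q)
    (hr : 0 ≤ r) (hc : r + 1 ≤ c) (hα : 0 ≤ α) (hR : 1 ≤ R) (hs0 : 0 ≤ s)
    (hs : s ≤ (c + 1) * R) : ∀ᵐ z ∂(slab N T), |U z * coneWeight α (c + s) R χ z| ≤
      C * (2 * c + 2 + 4 * α) * 2 ^ α * R ^ (-1 - α) *
        (|U z| * ϖ (z.2 / R) ^ (1 / q) * conePow (c + s) r R (α + 1) z) := by
  filter_upwards [ae_slab_pos N T, hw.cone] with z hz hcone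
  rcases le_or_gt ‖z.1‖ (r + z.2) with hx | hx
  · rw [abs_mul]
    exact (mul_le_mul_of_nonneg_left (abs_coneWeight_le hχ hq hr hc hα hR hs0 hs hz hx)
      (abs_nonneg _)).trans_eq (by ring)
  · rw [hcone hx]; simp

/-- For `α = 0` the first-order term is absent, so the cutoff costs `R^(-2)` rather than the
`R^(-1)` of the general bound. -/
theorem TestedWave.ae_abs_mul_coneWeight_zero_le {T ε R : ℝ} {f g : Space N → ℝ}
    {H U : Space N × ℝ → ℝ} (hw : TestedWave T ε f g r H U) (hχ : IsCutoff p q C χ ϖ)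
    (hq : 1 < q) (hR : 1 ≤ R) : ∀ᵐ z ∂(slab N T), |U z * coneWeight 0 c R χ z| ≤
      C * R ^ (-2 : ℝ) * (|U z| * ϖ (z.2 / R) ^ (1 / q) * conePow c r R 0 z) := by
  have hR0 : 0 < R := by linarith
  filter_upwards [ae_slab_pos N T, hw.cone] with z hz hcone
  rcases le_or_gt ‖z.1‖ (r + z.2) with hx | hx
  · have hd2 := hχ.deriv2_q (z.2 / R)
    rw [coneWeight, neg_zero, Real.rpow_zero]
    simp only [mul_zero, zero_mul, sub_zero, one_mul]
    rw [abs_mul, abs_div, abs_of_pos (by positivity : 0 < R ^ 2)]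
    have hRR : R ^ (-2 : ℝ) = (R ^ 2)⁻¹ := by
      rw [Real.rpow_neg hR0.le]; norm_num
    rcases le_or_gt z.2 R with h1 | h1
    · rw [conePow_of_mem hx hz.le h1, neg_zero, Real.rpow_zero, hRR]
      calc |U z| * (|deriv (deriv χ) (z.2 / R)| / R ^ 2)
          ≤ |U z| * (C * ϖ (z.2 / R) ^ (1 / q) / R ^ 2) := by gcongr
        _ = _ := by ring
    · have h0 : ϖ (z.2 / R) = 0 := hχ.right _ ((one_le_div hR0).2 h1.le)
      rw [h0, Real.zero_rpow (by positivity)] at hd2 ⊢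
      rw [mul_zero] at hd2
      rw [abs_nonpos_iff.1 hd2]
      simp
  · rw [hcone hx]; simp

theorem integral_mul_le_of_ae {T R l K c' : ℝ} {U W : Space N × ℝ → ℝ}
    (hχ : IsCutoff p q C χ ϖ) (hq : 1 < q) (hU : Measurable U)
    (hUq : Integrable (fun z => |U z| ^ q) (slab N T)) (hr : 0 ≤ r) (hc : r + 1 ≤ c') (hR : 1 ≤ R)
    (h : ∀ᵐ z ∂(slab N T), |U z * W z| ≤
      K * (|U z| * ϖ (z.2 / R) ^ (1 / q) * conePow c' r R l z)) :
    ∫ z, U z * W z ∂(slab N T) ≤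
      K * ∫ z, |U z| * ϖ (z.2 / R) ^ (1 / q) * conePow c' r R l z ∂(slab N T) := by
  rw [← integral_const_mul]
  refine (le_abs_self _).trans ((abs_integral_le_integral_abs).trans ?_)
  exact integral_mono_of_nonneg (Eventually.of_forall fun z => abs_nonneg _)
    ((hχ.hoelder hq hU hUq hr hc hR).1.const_mul K) h

theorem TestedWave.integrable_mul_bounded {T ε : ℝ} {f g : Space N → ℝ}
    {H U W : Space N × ℝ → ℝ} (hw : TestedWave T ε f g r H U) (hW : Measurable W)
    (hb : ∀ᵐ z ∂(slab N T), ‖z.1‖ ≤ r + z.2 → |W z| ≤ 1) :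
    Integrable (fun z => H z * W z) (slab N T) := by
  refine hw.integrable.mono' (hw.integrable.aestronglyMeasurable.mul hW.aestronglyMeasurable) ?_
  filter_upwards [hb, hw.cone'] with z hz hc
  rcases le_or_gt ‖z.1‖ (r + z.2) with hx | hx
  · rw [norm_mul, Real.norm_eq_abs, Real.norm_eq_abs, abs_of_nonneg (hw.nonneg z)]
    exact mul_le_of_le_one_right (hw.nonneg z) (hz hx)
  · rw [hc hx]; simp

theorem ball_volume_pos (N : ℕ) : 0 < (volume (Metric.ball (0 : Space N) 1)).toReal :=
  ENNReal.toReal_pos (Metric.measure_ball_pos _ _ one_pos).ne' Metric.isBounded_ball.measure_lt_top.ne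

/-- The identity tested with the cutoff alone. -/
theorem exists_estimate_const (hχ : IsCutoff p q C χ ϖ) (hq : 1 < q) (hr : 0 ≤ r)
    (hc : r + 1 ≤ c) : ∃ K, 0 < K ∧ ∀ (T ε : ℝ) (f g : Space N → ℝ) (H U : Space N × ℝ → ℝ),
      TestedWave T ε f g r H U → Integrable (fun z => |U z| ^ q) (slab N T) →
      (∀ x, r < ‖x‖ → f x = 0) → (∀ x, r < ‖x‖ → g x = 0) → ∀ R, 1 ≤ R → R < T →
      ε * (∫ x, g x) + ∫ z, H z * χ (z.2 / R) ∂(slab N T) ≤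
        K * (layer T q R ϖ U ^ (1 / q) * R ^ ((N + 1) * (1 - 1 / q) - 2)) := by
  have hv := ball_volume_pos N
  set v := (volume (Metric.ball (0 : Space N) 1)).toReal
  have hc0 : 0 < c := by linarith
  refine ⟨C * (c ^ (N + 1) * v) ^ (1 - 1 / q), mul_pos hχ.pos (by positivity),
    fun T ε f g H U hw hUq hf hg R hR hRT => ?_⟩
  have hR0 : 0 < R := by linarith
  have hcore := hw.core hχ hr hf hg (Or.inl rfl) hc hR0 hRT
  rw [dataTerm_zero] at hcore
  simp only [neg_zero, Real.rpow_zero, one_mul] at hcore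
  rw [hcore]
  have hq1 : 0 ≤ 1 - 1 / q := by
    rw [sub_nonneg, div_le_one (by linarith)]; exact hq.le
  have hlay : 0 ≤ layer T q R ϖ U := integral_nonneg fun z =>
    mul_nonneg (Real.rpow_nonneg (abs_nonneg _) _) (hχ.nonneg _)
  refine (integral_mul_le_of_ae hχ hq hw.measurable hUq hr hc hR
    (hw.ae_abs_mul_coneWeight_zero_le hχ hq hR)).trans ?_
  have hC := hχ.pos
  have hbound : ((c * R) ^ N * v * ∫ y in (1 : ℝ)..(c + R), y ^ (-(0 * (q / (q - 1))))) ^ (1 - 1 / q)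
      ≤ (c ^ (N + 1) * v) ^ (1 - 1 / q) * R ^ ((N + 1) * (1 - 1 / q)) := by
    have h1 : ∫ y in (1 : ℝ)..(c + R), y ^ (-(0 * (q / (q - 1)))) = c + R - 1 := by simp
    rw [h1, Real.rpow_mul hR0.le, ← Real.mul_rpow (by positivity) (by positivity)]
    refine Real.rpow_le_rpow ?_ ?_ hq1
    · have : 0 ≤ c + R - 1 := by linarith
      positivity
    · have h2 : c + R - 1 ≤ c * R := by nlinarith
      have h3 : R ^ ((N : ℝ) + 1) = R ^ (N + 1) := by
        rw [← Real.rpow_natCast]; push_cast; rfl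
      rw [h3]
      calc (c * R) ^ N * v * (c + R - 1) ≤ (c * R) ^ N * v * (c * R) := by gcongr
        _ = _ := by rw [mul_pow]; ring
  calc C * R ^ (-2 : ℝ) * ∫ z, |U z| * ϖ (z.2 / R) ^ (1 / q) * conePow c r R 0 z ∂(slab N T)
      ≤ C * R ^ (-2 : ℝ) * (layer T q R ϖ U ^ (1 / q) *
          ((c ^ (N + 1) * v) ^ (1 - 1 / q) * R ^ ((N + 1) * (1 - 1 / q)))) := by
        gcongr
        exact (hχ.hoelder hq hw.measurable hUq hr hc hR).2.trans (by gcongr)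
    _ = _ := by
        rw [sub_eq_add_neg _ (2 : ℝ), Real.rpow_add hR0]; ring

/-- The identity tested with the exact solution `((c + t)² - |x|²) ^ (-(N - 1) / 2)`: the layer
carries at least the energy of the free wave. -/
theorem exists_estimate_data {α : ℝ} (hχ : IsCutoff p q C χ ϖ) (hq : 1 < q) (hr : 0 ≤ r)
    (hc : r + 1 ≤ c) (hα0 : 0 ≤ α) (hα : 2 * α = N - 1) :
    ∃ K, 0 < K ∧ ∀ (T ε : ℝ) (f g : Space N → ℝ) (H U : Space N × ℝ → ℝ),
      TestedWave T ε f g r H U → Integrable (fun z => |U z| ^ q) (slab N T) →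
      (∀ x, r < ‖x‖ → f x = 0) → (∀ x, r < ‖x‖ → g x = 0) → ∀ R, 1 ≤ R → R < T →
      ε * dataTerm α c f g ≤
        K * (layer T q R ϖ U ^ (1 / q) * R ^ (N * (1 - 1 / q) - 1 - α)) := by
  have hv := ball_volume_pos N
  set v := (volume (Metric.ball (0 : Space N) 1)).toReal
  have hc0 : 0 < c := by linarith
  set m := (α + 1) * (q / (q - 1)) with hm
  -- Since `m > 1`, the integral of `y^(-m)` converges at infinity. Hölder therefore costs only
  -- `R^(N(1-1/q))`, one power of `R` less inside the volume factor than for the constant solution.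
  have hm1 : 1 < m := by
    rw [hm, mul_div_assoc', one_lt_div (by linarith)]
    nlinarith
  have hC := hχ.pos
  have hq1 : 0 ≤ 1 - 1 / q := by
    rw [sub_nonneg, div_le_one (by linarith)]; exact hq.le
  have hB : 0 < c ^ N * v * (1 / (m - 1)) := by
    have : 0 < m - 1 := by linarith
    positivity
  refine ⟨C * (2 * c + 2 + 4 * α) * 2 ^ α * (c ^ N * v * (1 / (m - 1))) ^ (1 - 1 / q), by positivity,
    fun T ε f g H U hw hUq hf hg R hR hRT => ?_⟩
  have hR0 : 0 < R := by linarith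
  have hcore := hw.core hχ hr hf hg (Or.inr hα) hc hR0 hRT
  have hpos : 0 ≤ ∫ z, H z * (((c + z.2) ^ 2 - ‖z.1‖ ^ 2) ^ (-α) * χ (z.2 / R)) ∂(slab N T) := by
    refine integral_nonneg_of_ae ?_
    filter_upwards [ae_slab_pos N T, hw.cone'] with z hz hcone
    rcases le_or_gt ‖z.1‖ (r + z.2) with hx | hx
    · have := one_le_cone hr hc hz.le (norm_nonneg z.1) hx
      exact mul_nonneg (hw.nonneg z) (mul_nonneg (Real.rpow_nonneg (by linarith) _) (hχ.nonneg' _))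
    · rw [hcone hx, zero_mul]; exact le_rfl
  refine (by linarith : ε * dataTerm α c f g ≤ ∫ z, U z * coneWeight α c R χ z ∂(slab N T)).trans ?_
  have hae := hw.ae_abs_mul_coneWeight_le hχ hq hr hc hα0 hR le_rfl (by positivity)
  simp only [add_zero] at hae
  have hlay : 0 ≤ layer T q R ϖ U := integral_nonneg fun z =>
    mul_nonneg (Real.rpow_nonneg (abs_nonneg _) _) (hχ.nonneg _)
  refine (integral_mul_le_of_ae hχ hq hw.measurable hUq hr hc hR hae).trans ?_
  have hbound : ((c * R) ^ N * v * ∫ y in (1 : ℝ)..(c + R), y ^ (-m)) ^ (1 - 1 / q)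
      ≤ (c ^ N * v * (1 / (m - 1))) ^ (1 - 1 / q) * R ^ (N * (1 - 1 / q)) := by
    have h1 : ∫ y in (1 : ℝ)..(c + R), y ^ (-m) ≤ 1 / (m - 1) := by
      rw [integral_rpow (Or.inr ⟨by linarith, by
        rw [uIcc_of_le (by linarith)]; exact fun h => by linarith [h.1]⟩), Real.one_rpow,
        ← neg_div_neg_eq]
      have h2 : 0 ≤ (c + R) ^ (-m + 1) := Real.rpow_nonneg (by linarith) _
      have h3 : -(-m + 1) = m - 1 := by ring
      rw [h3]
      exact div_le_div_of_nonneg_right (by linarith) (by linarith)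
    rw [Real.rpow_mul hR0.le, ← Real.mul_rpow hB.le (by positivity)]
    refine Real.rpow_le_rpow ?_ ?_ hq1
    · have : 0 ≤ ∫ y in (1 : ℝ)..(c + R), y ^ (-m) :=
        intervalIntegral.integral_nonneg (by linarith) fun y hy =>
          Real.rpow_nonneg (by linarith [hy.1]) _
      positivity
    · rw [Real.rpow_natCast]
      calc (c * R) ^ N * v * ∫ y in (1 : ℝ)..(c + R), y ^ (-m)
          ≤ (c * R) ^ N * v * (1 / (m - 1)) := by gcongr
        _ = _ := by rw [mul_pow]; ring
  have hK0 : 0 ≤ C * (2 * c + 2 + 4 * α) * 2 ^ α * R ^ (-1 - α) := by positivity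
  refine (mul_le_mul_of_nonneg_left ((hχ.hoelder hq hw.measurable hUq hr hc hR).2.trans
    (mul_le_mul_of_nonneg_left hbound (Real.rpow_nonneg hlay _))) hK0).trans (le_of_eq ?_)
  rw [show (N : ℝ) * (1 - 1 / q) - 1 - α = (-1 - α) + N * (1 - 1 / q) by ring, Real.rpow_add hR0]
  ring

end Estimates

end WaveSystem

/-! ### Superposition of time translates and the logarithmic estimate -/

namespace WaveSystem

open Filter Topology

variable {N : ℕ}

section Estimates

variable {p q C r c : ℝ} {χ ϖ : ℝ → ℝ}

/-- A dyadic superposition of time translates of the exact solution dominates `(c + t) ^ (-β)`. -/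
theorem rpow_le_dyadic_sum {α κ R t y : ℝ} {n : ℕ} (hα : 0 ≤ α) (hκ : 0 ≤ κ) (hc1 : 1 ≤ c)
    (hR : 1 ≤ R) (hn : (c + 1) * R < 2 ^ n) (ht : 0 ≤ t) (htR : t ≤ R)
    (hy : 1 ≤ (c + t) ^ 2 - y ^ 2) :
    (c + t) ^ (κ - 2 * α) ≤ 2 ^ κ * 4 ^ α *
      ∑ k ∈ Finset.range n, ((2 : ℝ) ^ k) ^ κ * (((c + 2 ^ k) + t) ^ 2 - y ^ 2) ^ (-α) := by
  set τ := c + t with hτ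
  have hτ1 : 1 ≤ τ := by linarith
  have hτ0 : 0 < τ := by linarith
  -- The single term with `2^k ≤ c + t < 2^(k+1)` already suffices, all terms being nonnegative.
  obtain ⟨k, hk1, hk2⟩ := exists_nat_pow_near hτ1 (one_lt_two : (1 : ℝ) < 2)
  have hpos : ∀ k : ℕ, 0 < ((c + 2 ^ k) + t) ^ 2 - y ^ 2 := fun k => by
    have : (0 : ℝ) < 2 ^ k := by positivity
    nlinarith
  have hkn : k ∈ Finset.range n := by
    rw [Finset.mem_range]
    have h1 : (2 : ℝ) ^ k < 2 ^ n := by nlinarith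
    exact (pow_lt_pow_iff_right₀ (by norm_num)).1 h1
  have hterm : τ ^ (κ - 2 * α) ≤ 2 ^ κ * 4 ^ α *
      (((2 : ℝ) ^ k) ^ κ * (((c + 2 ^ k) + t) ^ 2 - y ^ 2) ^ (-α)) := by
    have h1 : τ ^ κ ≤ 2 ^ κ * ((2 : ℝ) ^ k) ^ κ := by
      rw [← Real.mul_rpow (by norm_num) (by positivity)]
      refine Real.rpow_le_rpow hτ0.le ?_ hκ
      rw [pow_succ] at hk2; linarith
    have h2 : (4 * τ ^ 2) ^ (-α) ≤ (((c + 2 ^ k) + t) ^ 2 - y ^ 2) ^ (-α) := by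
      refine Real.rpow_le_rpow_of_nonpos (hpos k) ?_ (by linarith)
      have : ((c + 2 ^ k) + t) ^ 2 ≤ (2 * τ) ^ 2 := by
        refine pow_le_pow_left₀ (by positivity) (by linarith) 2
      nlinarith [sq_nonneg y]
    have h3 : (4 * τ ^ 2) ^ (-α) = (4 ^ α)⁻¹ * τ ^ (-(2 * α)) := by
      rw [Real.mul_rpow (by norm_num) (by positivity), Real.rpow_neg (by norm_num)]
      congr 1
      rw [← Real.rpow_natCast, ← Real.rpow_mul hτ0.le]
      congr 1; push_cast; ring
    have h4 : (0 : ℝ) < 4 ^ α := by positivity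
    calc τ ^ (κ - 2 * α) = τ ^ κ * τ ^ (-(2 * α)) := by rw [← Real.rpow_add hτ0]; rfl
      _ ≤ (2 ^ κ * ((2 : ℝ) ^ k) ^ κ) * τ ^ (-(2 * α)) := by gcongr
      _ = 2 ^ κ * 4 ^ α * (((2 : ℝ) ^ k) ^ κ * (4 * τ ^ 2) ^ (-α)) := by
          rw [h3]; field_simp
      _ ≤ _ := by gcongr
  refine hterm.trans ?_
  gcongr
  exact Finset.single_le_sum (f := fun k => ((2 : ℝ) ^ k) ^ κ *
    (((c + 2 ^ k) + t) ^ 2 - y ^ 2) ^ (-α)) (fun k _ => mul_nonneg (by positivity)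
      (Real.rpow_nonneg (hpos k).le _)) hkn

/-- The tested identities for `M = c + 2^k` are added with weights `2^(kκ)`. The data terms are
nonnegative and dropped. The cutoff kernels are summed pointwise before Hölder is applied, which
turns them into one power of the distance to the light cone. -/
theorem TestedWave.dyadic_core {T ε R α κ K : ℝ} {n : ℕ} {f g : Space N → ℝ}
    {H U : Space N × ℝ → ℝ} (hw : TestedWave T ε f g r H U) (hε : 0 ≤ ε)
    (hχ : IsCutoff p q C χ ϖ) (hq : 1 < q) (hr : 0 ≤ r)
    (hc : r + 1 ≤ c) (hα0 : 0 ≤ α) (hα : 2 * α = N - 1)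
    (hUq : Integrable (fun z => |U z| ^ q) (slab N T))
    (hf : ∀ x, r < ‖x‖ → f x = 0) (hg : ∀ x, r < ‖x‖ → g x = 0)
    (hdata : ∀ M, c ≤ M → 0 ≤ dataTerm α M f g) (hR : 1 ≤ R) (hRT : R < T)
    (hn : ∀ k ∈ Finset.range n, (2 : ℝ) ^ k ≤ (c + 1) * R)
    (hK : ∀ d : ℝ, 1 ≤ d → ∑ k ∈ Finset.range n,
      ((2 : ℝ) ^ k) ^ κ * (d + 2 ^ k) ^ (-(α + 1)) ≤ K * d ^ (κ - (α + 1))) :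
    ∑ k ∈ Finset.range n, ((2 : ℝ) ^ k) ^ κ *
      ∫ z, H z * ((((c + 2 ^ k) + z.2) ^ 2 - ‖z.1‖ ^ 2) ^ (-α) * χ (z.2 / R)) ∂(slab N T) ≤
    C * (2 * c + 2 + 4 * α) * 2 ^ α * R ^ (-1 - α) * (K *
      ∫ z, |U z| * ϖ (z.2 / R) ^ (1 / q) * conePow c r R ((α + 1) - κ) z ∂(slab N T)) := by
  have hR0 : 0 < R := by linarith
  have hC := hχ.pos
  have hK1 : 0 ≤ C * (2 * c + 2 + 4 * α) * 2 ^ α * R ^ (-1 - α) := by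
    have : 0 ≤ 2 * c + 2 + 4 * α := by linarith
    positivity
  set K1 := C * (2 * c + 2 + 4 * α) * 2 ^ α * R ^ (-1 - α)
  have hck : ∀ k : ℕ, r + 1 ≤ c + 2 ^ k := fun k => by
    have : (0 : ℝ) < 2 ^ k := by positivity
    linarith
  have hstep : ∀ k ∈ Finset.range n, ((2 : ℝ) ^ k) ^ κ *
      ∫ z, H z * ((((c + 2 ^ k) + z.2) ^ 2 - ‖z.1‖ ^ 2) ^ (-α) * χ (z.2 / R)) ∂(slab N T) ≤
      K1 * ∫ z, ((2 : ℝ) ^ k) ^ κ * (|U z| * ϖ (z.2 / R) ^ (1 / q) *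
        conePow (c + 2 ^ k) r R (α + 1) z) ∂(slab N T) := by
    intro k hk
    have hcore := hw.core hχ hr hf hg (Or.inr hα) (hck k) hR0 hRT
    have h1 := mul_nonneg hε (hdata (c + 2 ^ k) (by
      have : (0 : ℝ) < 2 ^ k := by positivity
      linarith))
    have h2 := integral_mul_le_of_ae hχ hq hw.measurable hUq hr (hck k) hR
      (hw.ae_abs_mul_coneWeight_le hχ hq hr hc hα0 hR (by positivity) (hn k hk))
    have h3 : (0 : ℝ) ≤ (2 ^ k) ^ κ := by positivity
    rw [integral_const_mul]
    calc _ ≤ ((2 : ℝ) ^ k) ^ κ * (K1 * ∫ z, |U z| * ϖ (z.2 / R) ^ (1 / q) *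
          conePow (c + 2 ^ k) r R (α + 1) z ∂(slab N T)) :=
          mul_le_mul_of_nonneg_left (by linarith) h3
      _ = _ := by ring
  refine (Finset.sum_le_sum hstep).trans ?_
  have hi : ∀ k : ℕ, Integrable (fun z => ((2 : ℝ) ^ k) ^ κ * (|U z| * ϖ (z.2 / R) ^ (1 / q) *
      conePow (c + 2 ^ k) r R (α + 1) z)) (slab N T) := fun k =>
    (hχ.hoelder hq hw.measurable hUq hr (hck k) hR).1.const_mul _
  rw [← Finset.mul_sum, ← integral_finsetSum _ fun k _ => hi k, ← integral_const_mul K]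
  refine mul_le_mul_of_nonneg_left (integral_mono (integrable_finsetSum _ fun k _ => hi k)
    ((hχ.hoelder hq hw.measurable hUq hr hc hR).1.const_mul K) fun z => ?_) hK1
  have hF : 0 ≤ |U z| * ϖ (z.2 / R) ^ (1 / q) :=
    mul_nonneg (abs_nonneg _) (Real.rpow_nonneg (hχ.nonneg _) _)
  have hsum : ∑ k ∈ Finset.range n, ((2 : ℝ) ^ k) ^ κ * conePow (c + 2 ^ k) r R (α + 1) z ≤
      K * conePow c r R ((α + 1) - κ) z := by
    by_cases hz : ‖z.1‖ ≤ r + z.2 ∧ 0 ≤ z.2 ∧ z.2 ≤ R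
    · simp_rw [conePow_of_mem hz.1 hz.2.1 hz.2.2]
      have := hK (c + z.2 - ‖z.1‖) (by linarith [hz.1])
      rw [show -(α + 1 - κ) = κ - (α + 1) by ring]
      refine le_of_eq_of_le (Finset.sum_congr rfl fun k _ => ?_) this
      congr 2; ring
    · have h0 : ∀ c' l, conePow c' r R l z = 0 := fun c' l => indicator_of_notMem (by exact hz) _
      simp [h0]
  calc ∑ k ∈ Finset.range n, ((2 : ℝ) ^ k) ^ κ * (|U z| * ϖ (z.2 / R) ^ (1 / q) *
      conePow (c + 2 ^ k) r R (α + 1) z)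
      = (|U z| * ϖ (z.2 / R) ^ (1 / q)) *
        ∑ k ∈ Finset.range n, ((2 : ℝ) ^ k) ^ κ * conePow (c + 2 ^ k) r R (α + 1) z := by
        rw [Finset.mul_sum]; exact Finset.sum_congr rfl fun k _ => by ring
    _ ≤ (|U z| * ϖ (z.2 / R) ^ (1 / q)) * (K * conePow c r R ((α + 1) - κ) z) := by gcongr
    _ = _ := by ring

theorem log_add_le {R : ℝ} (hc : 0 ≤ c) (hR : 2 ≤ R) :
    Real.log (c + R) ≤ (Real.log (c + 1) / Real.log 2 + 1) * Real.log R := by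
  have h2 : 0 < Real.log 2 := Real.log_pos (by norm_num)
  have h3 : Real.log 2 ≤ Real.log R := Real.log_le_log (by norm_num) hR
  have h4 : 0 ≤ Real.log (c + 1) := Real.log_nonneg (by linarith)
  have h5 : Real.log (c + R) ≤ Real.log (c + 1) + Real.log R := by
    rw [← Real.log_mul (by linarith) (by linarith)]
    exact Real.log_le_log (by linarith) (by nlinarith)
  have h6 : Real.log (c + 1) ≤ Real.log (c + 1) / Real.log 2 * Real.log R := by
    rw [div_mul_eq_mul_div, le_div_iff₀ h2]
    gcongr
  linarith

/-- The identity tested with the dyadic superposition: the estimate with a logarithm. -/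
theorem exists_estimate_log {α : ℝ} (hχ : IsCutoff p q C χ ϖ) (hq : 1 < q) (hr : 0 ≤ r)
    (hc : r + 1 ≤ c) (hα0 : 0 ≤ α) (hα : 2 * α = N - 1) :
    ∃ K, 0 < K ∧ ∀ (T ε : ℝ) (f g : Space N → ℝ) (H U : Space N × ℝ → ℝ),
      TestedWave T ε f g r H U → 0 ≤ ε → Integrable (fun z => |U z| ^ q) (slab N T) →
      (∀ x, r < ‖x‖ → f x = 0) → (∀ x, r < ‖x‖ → g x = 0) →
      (∀ M, c ≤ M → 0 ≤ dataTerm α M f g) → ∀ R, 2 ≤ R → R < T →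
      ∫ z, H z * (c + z.2) ^ (-(α - 1 / q)) * χ (z.2 / R) ∂(slab N T) ≤
        K * (layer T q R ϖ U ^ (1 / q) * R ^ (N * (1 - 1 / q) - 1 - α)
          * Real.log R ^ (1 - 1 / q)) := by
  have hv := ball_volume_pos N
  set v := (volume (Metric.ball (0 : Space N) 1)).toReal
  have hc0 : 0 < c := by linarith
  have hC := hχ.pos
  have hq0 : 0 < 1 / q := by positivity
  have hq1 : 0 < 1 - 1 / q := by
    rw [sub_pos, div_lt_one (by linarith)]; exact hq
  -- With this `κ` the kernel exponent left after summation is `1 - 1/q`, whose multiple by the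
  -- conjugate exponent is exactly `1`: the time integral in Hölder becomes a logarithm. On the
  -- source side the superposition dominates `(c + t)^(κ-2α)`, which is the weight in the
  -- conclusion.
  set κ := α + 1 / q with hκ
  obtain ⟨K, hK, hsum⟩ := exists_dyadic_sum_le (κ := κ) (l := α + 1) (by positivity) (by linarith)
  have hl : (α + 1) - κ = 1 - 1 / q := by rw [hκ]; ring
  set L := Real.log (c + 1) / Real.log 2 + 1 with hL
  have hL0 : 0 < L := by
    have h2 : 0 < Real.log 2 := Real.log_pos (by norm_num)
    have h4 : 0 ≤ Real.log (c + 1) := Real.log_nonneg (by linarith)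
    positivity
  refine ⟨2 ^ κ * 4 ^ α * (C * (2 * c + 2 + 4 * α) * 2 ^ α * K * (c ^ N * v * L) ^ (1 - 1 / q)),
    by positivity, fun T ε f g H U hw hε hUq hf hg hdata R hR hRT => ?_⟩
  have hR1 : 1 ≤ R := by linarith
  have hR0 : 0 < R := by linarith
  -- The shifts go up to the largest power of two not exceeding `(c + 1)R`: they remain admissible
  -- for the kernel bound and still reach every `c + t` with `t ≤ R`.
  obtain ⟨m, hm1, hm2⟩ := exists_nat_pow_near (x := (c + 1) * R) (by nlinarith)
    (one_lt_two : (1 : ℝ) < 2)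
  have hn : ∀ k ∈ Finset.range (m + 1), (2 : ℝ) ^ k ≤ (c + 1) * R := fun k hk =>
    (pow_le_pow_right₀ (by norm_num) (by have := Finset.mem_range.1 hk; omega)).trans hm1
  have hdy := hw.dyadic_core hε hχ hq hr hc hα0 hα hUq hf hg hdata hR1 hRT hn
    (fun d hd => hsum d hd (m + 1))
  rw [hl] at hdy
  have hint : ∀ k : ℕ, Integrable (fun z : Space N × ℝ => H z *
      ((((c + 2 ^ k) + z.2) ^ 2 - ‖z.1‖ ^ 2) ^ (-α) * χ (z.2 / R))) (slab N T) := fun k => by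
    refine hw.integrable_mul_bounded (((((measurable_snd.const_add _).pow_const 2).sub
      (measurable_fst.norm.pow_const 2)).pow_const _).mul
      (hχ.smooth.continuous.measurable.comp (measurable_snd.div_const R))) ?_
    filter_upwards [ae_slab_pos N T] with z hz hx
    have h2k : (0 : ℝ) < 2 ^ k := by positivity
    have h1 := one_le_cone hr (M := c + 2 ^ k) (by linarith) hz.le (norm_nonneg z.1) hx
    have h2 : 0 ≤ (((c + 2 ^ k) + z.2) ^ 2 - ‖z.1‖ ^ 2) ^ (-α) := Real.rpow_nonneg (by linarith) _
    rw [abs_of_nonneg (mul_nonneg h2 (hχ.nonneg' _))]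
    exact mul_le_one₀ (Real.rpow_le_one_of_one_le_of_nonpos h1 (by linarith)) (hχ.nonneg' _)
      (hχ.le_one _)
  have hleft : ∫ z, H z * (c + z.2) ^ (-(α - 1 / q)) * χ (z.2 / R) ∂(slab N T) ≤
      2 ^ κ * 4 ^ α * ∑ k ∈ Finset.range (m + 1), ((2 : ℝ) ^ k) ^ κ *
      ∫ z, H z * ((((c + 2 ^ k) + z.2) ^ 2 - ‖z.1‖ ^ 2) ^ (-α) * χ (z.2 / R)) ∂(slab N T) := by
    simp_rw [← integral_const_mul]
    rw [← integral_finsetSum _ fun k _ => (hint k).const_mul _, ← integral_const_mul]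
    refine integral_mono_of_nonneg ?_
      ((integrable_finsetSum _ fun k _ => (hint k).const_mul _).const_mul _) ?_
    · filter_upwards [ae_slab_pos N T] with z hz
      exact mul_nonneg (mul_nonneg (hw.nonneg z) (Real.rpow_nonneg (by linarith) _)) (hχ.nonneg' _)
    · filter_upwards [ae_slab_pos N T, hw.cone'] with z hz hcone
      rcases le_or_gt ‖z.1‖ (r + z.2) with hx | hx
      · rcases le_or_gt z.2 R with h1 | h1
        · have h2 := rpow_le_dyadic_sum (κ := κ) hα0 (by positivity) (by linarith) hR1 hm2 hz.le h1
            (one_le_cone hr hc hz.le (norm_nonneg z.1) hx)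
          rw [show κ - 2 * α = -(α - 1 / q) by rw [hκ]; ring] at h2
          have h3 : 0 ≤ H z * χ (z.2 / R) := mul_nonneg (hw.nonneg z) (hχ.nonneg' _)
          calc H z * (c + z.2) ^ (-(α - 1 / q)) * χ (z.2 / R)
              = H z * χ (z.2 / R) * (c + z.2) ^ (-(α - 1 / q)) := by ring
            _ ≤ _ := mul_le_mul_of_nonneg_left h2 h3
            _ = _ := by
                rw [mul_left_comm, Finset.mul_sum]
                congr 1
                exact Finset.sum_congr rfl fun k _ => by ring
        · have h0 : χ (z.2 / R) = 0 := hχ.eq_zero _ ((one_le_div hR0).2 h1.le)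
          simp [h0]
      · simp [hcone hx]
  have hlay : 0 ≤ layer T q R ϖ U := integral_nonneg fun z =>
    mul_nonneg (Real.rpow_nonneg (abs_nonneg _) _) (hχ.nonneg _)
  have hlog0 : 0 ≤ Real.log R := Real.log_nonneg hR1
  have hbound : ((c * R) ^ N * v * ∫ y in (1 : ℝ)..(c + R),
      y ^ (-((1 - 1 / q) * (q / (q - 1))))) ^ (1 - 1 / q)
      ≤ (c ^ N * v * L) ^ (1 - 1 / q) * R ^ (N * (1 - 1 / q)) * Real.log R ^ (1 - 1 / q) := by
    have h0 : (1 - 1 / q) * (q / (q - 1)) = 1 := by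
      have : q - 1 ≠ 0 := by linarith
      field_simp
    have h1 : ∫ y in (1 : ℝ)..(c + R), y ^ (-((1 - 1 / q) * (q / (q - 1)))) = Real.log (c + R) := by
      rw [h0]
      simp_rw [Real.rpow_neg_one]
      rw [integral_inv_of_pos one_pos (by linarith), div_one]
    rw [h1, Real.rpow_mul hR0.le, ← Real.mul_rpow (by positivity) (by positivity),
      ← Real.mul_rpow (by positivity) hlog0]
    have hlogc : 0 ≤ Real.log (c + R) := Real.log_nonneg (by linarith)
    refine Real.rpow_le_rpow (by positivity) ?_ hq1.le
    rw [Real.rpow_natCast]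
    calc (c * R) ^ N * v * Real.log (c + R) ≤ (c * R) ^ N * v * (L * Real.log R) := by
          gcongr
          exact log_add_le hc0.le hR
      _ = _ := by rw [mul_pow]; ring
  have hhol := (hχ.hoelder hq hw.measurable hUq hr hc hR1 (l := 1 - 1 / q)).2.trans
    (mul_le_mul_of_nonneg_left hbound (Real.rpow_nonneg hlay _))
  have hK1 : 0 ≤ C * (2 * c + 2 + 4 * α) * 2 ^ α * R ^ (-1 - α) := by positivity
  refine hleft.trans ((mul_le_mul_of_nonneg_left (hdy.trans (mul_le_mul_of_nonneg_left
    (mul_le_mul_of_nonneg_left hhol hK.le) hK1)) (by positivity)).trans (le_of_eq ?_))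
  rw [show (N : ℝ) * (1 - 1 / q) - 1 - α = (-1 - α) + N * (1 - 1 / q) by ring, Real.rpow_add hR0]
  ring

end Estimates

end WaveSystem

/-! ### The differential inequality in logarithmic time -/

namespace WaveSystem

open Filter Topology

variable {N : ℕ}

/-- The function `f^(1-P)` decreases at rate at least `(P - 1)κ` and must remain positive on the
whole interval. -/
theorem ode_bound {f f' : ℝ → ℝ} {P κ a b : ℝ} (hP : 1 < P) (hab : a ≤ b)
    (hd : ∀ s ∈ Icc a b, HasDerivAt f (f' s) s) (hpos : ∀ s ∈ Icc a b, 0 < f s)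
    (h : ∀ s ∈ Icc a b, κ * f s ^ P ≤ f' s) : (P - 1) * κ * (b - a) ≤ f a ^ (1 - P) := by
  have hg : ∀ s ∈ Icc a b, HasDerivAt (fun s => -f s ^ (1 - P))
      (-(f' s * (1 - P) * f s ^ (1 - P - 1))) s := fun s hs =>
    ((hd s hs).rpow_const (Or.inl (hpos s hs).ne')).neg
  have key := (convex_Icc a b).mul_sub_le_image_sub_of_le_deriv (f := fun s => -f s ^ (1 - P))
    (C := (P - 1) * κ) (fun s hs => (hg s hs).continuousAt.continuousWithinAt)
    (fun s hs => (hg s (interior_subset hs)).differentiableAt.differentiableWithinAt)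
    (fun s hs => by
      have hs' := interior_subset hs
      rw [(hg s hs').deriv]
      have h1 : f s ^ P * f s ^ (1 - P - 1) = 1 := by
        rw [← Real.rpow_add (hpos s hs')]
        ring_nf
        exact Real.rpow_zero _
      have h2 : 0 < f s ^ (1 - P - 1) := Real.rpow_pos_of_pos (hpos s hs') _
      have h3 : κ ≤ f' s * f s ^ (1 - P - 1) := by
        calc κ = κ * f s ^ P * f s ^ (1 - P - 1) := by rw [mul_assoc, h1, mul_one]
          _ ≤ f' s * f s ^ (1 - P - 1) := by gcongr; exact h s hs'
      nlinarith) a (left_mem_Icc.2 hab) b (right_mem_Icc.2 hab) hab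
  have : 0 < f b ^ (1 - P) := Real.rpow_pos_of_pos (hpos b (right_mem_Icc.2 hab)) _
  linarith

section Cutoff

variable {p q C : ℝ} {χ ϖ : ℝ → ℝ}

/-- The logarithmic primitive of the layer weight is dominated by the cutoff. -/
theorem IsCutoff.exists_primitive (hχ : IsCutoff p q C χ ϖ) : ∃ ψ : ℝ → ℝ,
    Continuous ψ ∧ (∀ y, 0 ≤ ψ y) ∧ (∀ y, ψ y ≤ χ y) ∧
    ∀ t, 0 < t → ∀ s, HasDerivAt (fun s => ψ (t * Real.exp (-s))) (ϖ (t * Real.exp (-s))) s := by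
  -- The primitive is `ψ(y) = ∫_y^1 ϖ(s)/s ds`. Since `ϖ` vanishes below `1/2`, replacing `s` by
  -- `max s (1/2)` changes nothing there and keeps the integrand continuous.
  set φ : ℝ → ℝ := fun y => ϖ y / max y (1 / 2) with hφ
  have hm : ∀ y : ℝ, 0 < max y (1 / 2) := fun y => lt_max_of_lt_right (by norm_num)
  have hφc : Continuous φ :=
    hχ.cont.div (continuous_id.max continuous_const) fun y => (hm y).ne'
  have hφ0 : ∀ y, 0 ≤ φ y := fun y => div_nonneg (hχ.nonneg y) (hm y).le
  have hφ2 : ∀ y, φ y ≤ 2 * χ y := fun y => by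
    rw [hφ]; beta_reduce
    rw [div_le_iff₀ (hm y)]
    have h1 := hχ.le y
    have h2 := le_max_right y (1 / 2)
    have h3 := hχ.nonneg' y
    nlinarith
  have hφr : ∀ y, 1 ≤ y → φ y = 0 := fun y hy => by
    rw [hφ]; beta_reduce; rw [hχ.right y hy, zero_div]
  have hφl : ∀ y, y ≤ 1 / 2 → φ y = 0 := fun y hy => by
    rw [hφ]; beta_reduce; rw [hχ.left y hy, zero_div]
  have hI : ∀ a b, IntervalIntegrable φ volume a b := fun a b => hφc.intervalIntegrable a b
  have hψd : ∀ y, HasDerivAt (fun y => ∫ s in y..1, φ s) (-φ y) y := fun y =>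
    intervalIntegral.integral_hasDerivAt_left (hI y 1)
      (hφc.stronglyMeasurableAtFilter _ _) hφc.continuousAt
  have hupper : ∀ y, 1 ≤ y → ∫ s in y..1, φ s = 0 := fun y hy => by
    rw [intervalIntegral.integral_congr (g := fun _ => 0)
      (fun s hs => by rw [uIcc_of_ge hy] at hs; exact hφr s hs.1)]
    simp
  -- The integrand is at most `2χ(y)` by monotonicity of `χ`, and the interval has length at most
  -- `1/2`.
  have hmid : ∀ y, 1 / 2 ≤ y → y ≤ 1 → ∫ s in y..1, φ s ≤ χ y := fun y hy hy1 => by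
    have h1 : ∫ s in y..1, φ s ≤ ∫ s in y..1, 2 * χ y :=
      intervalIntegral.integral_mono_on hy1 (hI y 1) (by simp) fun s hs =>
        (hφ2 s).trans (mul_le_mul_of_nonneg_left (hχ.anti hs.1) (by norm_num))
    rw [intervalIntegral.integral_const, smul_eq_mul] at h1
    have := hχ.nonneg' y
    nlinarith
  refine ⟨fun y => ∫ s in y..1, φ s, continuous_iff_continuousAt.2 fun y => (hψd y).continuousAt,
    fun y => ?_, fun y => ?_, fun t ht s => ?_⟩
  · rcases le_total y 1 with hy | hy
    · exact intervalIntegral.integral_nonneg hy fun s _ => hφ0 s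
    · exact (hupper y hy).ge
  · beta_reduce
    rcases le_total y 1 with hy | hy
    · rcases le_total (1 / 2) y with hy2 | hy2
      · exact hmid y hy2 hy
      · have h1 := intervalIntegral.integral_add_adjacent_intervals (hI y (1 / 2)) (hI (1 / 2) 1)
        rw [intervalIntegral.integral_congr (g := fun _ => 0) (a := y) (b := 1 / 2)
          (fun s hs => by rw [uIcc_of_le hy2] at hs; exact hφl s hs.2)] at h1
        have h2 := hmid (1 / 2) le_rfl (by norm_num)
        rw [hχ.eq_one _ le_rfl] at h2
        rw [hχ.eq_one y hy2, ← h1]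
        simpa using h2
    · rw [hupper y hy]; exact hχ.nonneg' y
  · have h1 : HasDerivAt (fun s : ℝ => t * Real.exp (-s)) (-(t * Real.exp (-s))) s := by
      have := ((hasDerivAt_neg s).exp).const_mul t
      simpa using this
    refine ((hψd (t * Real.exp (-s))).comp s h1).congr_deriv ?_
    have hy : 0 < t * Real.exp (-s) := by positivity
    set y := t * Real.exp (-s)
    rw [neg_mul_neg]
    rcases le_total y (1 / 2) with h2 | h2
    · rw [hφl y h2, hχ.left y h2, zero_mul]
    · rw [hφ]; beta_reduce
      rw [max_eq_left h2, div_mul_cancel₀ _ hy.ne']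

/-- The logarithmic blow-up mechanism of the critical case. -/
theorem IsCutoff.exists_log_bound (hχ : IsCutoff p q C χ ϖ) {P ν K : ℝ} (hP : 1 < P) (hν0 : 0 ≤ ν)
    (hν1 : ν < 1) (hK : 0 < K) : ∃ A, 0 < A ∧ ∀ (T δ : ℝ) (F : Space N × ℝ → ℝ), 0 < δ →
      Integrable F (slab N T) → (∀ᵐ z ∂(slab N T), 0 ≤ F z) →
      (∀ R, 2 ≤ R → R < T → δ ≤ K * (∫ z, F z * ϖ (z.2 / R) ∂(slab N T)) ^ (1 / P)) →
      (∀ R, 2 ≤ R → R < T → ∫ z, F z * χ (z.2 / R) ∂(slab N T) ≤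
        K * ((∫ z, F z * ϖ (z.2 / R) ∂(slab N T)) ^ (1 / P) * Real.log R ^ ν)) →
      0 < T → 4 ≤ Real.log T → Real.log T ≤ A * δ ^ (-((P - 1) / (1 - ν))) := by
  obtain ⟨ψ, hψc, hψ0, hψχ, hψd⟩ := hχ.exists_primitive
  have hP0 : 0 < P := by linarith
  set B : ℝ := 4 ^ P * K ^ P * K ^ (P * (P - 1)) / (P - 1) with hB
  have hB0 : 0 < B := by
    have : 0 < P - 1 := by linarith
    positivity
  refine ⟨B ^ (1 / (P * (1 - ν))), by positivity, fun T δ F hδ hF hF0 h1 h2 hT hS => ?_⟩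
  set S := Real.log T with hSdef
  have hS0 : 0 < S := by linarith
  set Zs : ℝ → ℝ := fun s => ∫ z, F z * ϖ (z.2 * Real.exp (-s)) ∂(slab N T) with hZs
  -- Here `s = log R`, and the choice of `ψ` gives `Z' = Zs`, the layer integral at scale `R`, while
  -- `Z` is at most the integral with `χ`.
  set Z : ℝ → ℝ := fun s => ∫ z, F z * ψ (z.2 * Real.exp (-s)) ∂(slab N T) with hZ
  have hdiv : ∀ (s : ℝ) (z : Space N × ℝ), z.2 * Real.exp (-s) = z.2 / Real.exp s := fun s z => by
    rw [Real.exp_neg]; rfl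
  have hmeas : ∀ (s : ℝ) {h : ℝ → ℝ}, Continuous h →
      AEStronglyMeasurable (fun z : Space N × ℝ => F z * h (z.2 * Real.exp (-s))) (slab N T) :=
    fun s h hh => hF.aestronglyMeasurable.mul
      (hh.comp (continuous_snd.mul continuous_const)).aestronglyMeasurable
  have hϖ1 : ∀ y, ϖ y ≤ 1 := fun y => (hχ.le y).trans (hχ.le_one y)
  have hψ1 : ∀ y, ψ y ≤ 1 := fun y => (hψχ y).trans (hχ.le_one y)
  have hder : ∀ s, HasDerivAt Z (Zs s) s := by
    intro s
    refine (hasDerivAt_integral_of_dominated_loc_of_deriv_le (bound := fun z => ‖F z‖)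
      (F := fun s z => F z * ψ (z.2 * Real.exp (-s)))
      (F' := fun s z => F z * ϖ (z.2 * Real.exp (-s))) (s := univ) univ_mem
      (Eventually.of_forall fun s => hmeas s hψc) ?_ (hmeas s hχ.cont) ?_ hF.norm ?_).2
    · refine hF.norm.mono' (hmeas s hψc) (Eventually.of_forall fun z => ?_)
      rw [norm_mul, Real.norm_eq_abs (ψ _), abs_of_nonneg (hψ0 _)]
      exact mul_le_of_le_one_right (norm_nonneg _) (hψ1 _)
    · refine Eventually.of_forall fun z s _ => ?_
      rw [norm_mul, Real.norm_eq_abs (ϖ _), abs_of_nonneg (hχ.nonneg _)]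
      exact mul_le_of_le_one_right (norm_nonneg _) (hϖ1 _)
    · filter_upwards [ae_slab_pos N T] with z hz s _
      exact (hψd z.2 hz s).const_mul (F z)
  have hrange : ∀ s, 1 ≤ s → s < S → 2 ≤ Real.exp s ∧ Real.exp s < T := fun s hs1 hs2 => by
    refine ⟨?_, ?_⟩
    · have := Real.add_one_le_exp s; linarith
    · rw [← Real.exp_log hT]; exact Real.exp_lt_exp.2 hs2
  have hlow : ∀ s, 1 ≤ s → s < S → (δ / K) ^ P ≤ Zs s := fun s hs1 hs2 => by
    have h3 := h1 _ (hrange s hs1 hs2).1 (hrange s hs1 hs2).2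
    simp_rw [← hdiv] at h3
    rw [← div_le_iff₀' hK] at h3
    have hZ0 : 0 ≤ Zs s := integral_nonneg_of_ae (by
      filter_upwards [hF0] with z hz using mul_nonneg hz (hχ.nonneg _))
    calc (δ / K) ^ P ≤ (Zs s ^ (1 / P)) ^ P := by gcongr
      _ = Zs s := by rw [← Real.rpow_mul hZ0, one_div_mul_cancel hP0.ne', Real.rpow_one]
  have hZnn : ∀ s, 0 ≤ Z s := fun s => integral_nonneg_of_ae (by
    filter_upwards [hF0] with z hz using mul_nonneg hz (hψ0 _))
  have hδK : 0 < (δ / K) ^ P := by positivity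
  -- Integrating the lower bound on `Z'` from `S/4`. As `S ≥ 4`, this stays in `s ≥ 1`, hence in `R
  -- ≥ 2`.
  have hgrow : ∀ s ∈ Icc (S / 2) (3 * S / 4), S / 4 * (δ / K) ^ P ≤ Z s := by
    intro s hs
    have h3 := (convex_Icc (S / 4) s).mul_sub_le_image_sub_of_le_deriv (f := Z)
      (C := (δ / K) ^ P) (fun s _ => (hder s).continuousAt.continuousWithinAt)
      (fun s _ => (hder s).differentiableAt.differentiableWithinAt)
      (fun y hy => by
        rw [(hder y).deriv]
        have := interior_subset hy
        exact hlow y (by linarith [this.1]) (by linarith [this.2, hs.2]))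
      (S / 4) (left_mem_Icc.2 (by linarith [hs.1])) s (right_mem_Icc.2 (by linarith [hs.1]))
      (by linarith [hs.1])
    have h4 := hZnn (S / 4)
    nlinarith [hs.1]
  have hpos : 0 < S / 4 * (δ / K) ^ P := by positivity
  -- On this interval `s^ν ≤ S^ν`, so the second hypothesis becomes the autonomous inequality `Z' ≥
  -- (K S^ν)^(-P) Z^P`. Starting from the linear growth already obtained, its maximal lifespan must
  -- exceed `S/4`.
  have hode := ode_bound (f := Z) (f' := Zs) (κ := (K * S ^ ν)⁻¹ ^ P) (a := S / 2) (b := 3 * S / 4)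
    hP (by linarith) (fun s _ => hder s) (fun s hs => hpos.trans_le (hgrow s hs)) (fun s hs => by
      have hs1 : 1 ≤ s := by linarith [hs.1]
      have hs2 : s < S := by linarith [hs.2]
      have h3 := h2 _ (hrange s hs1 hs2).1 (hrange s hs1 hs2).2
      simp_rw [← hdiv] at h3
      rw [Real.log_exp] at h3
      have hZ0 : 0 ≤ Zs s := hδK.le.trans (hlow s hs1 hs2)
      have h4 : Z s ≤ K * S ^ ν * Zs s ^ (1 / P) := by
        calc Z s ≤ ∫ z, F z * χ (z.2 * Real.exp (-s)) ∂(slab N T) := by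
              refine integral_mono_of_nonneg ?_ ?_ ?_
              · filter_upwards [hF0] with z hz using mul_nonneg hz (hψ0 _)
              · refine hF.norm.mono' (hmeas s hχ.smooth.continuous) (Eventually.of_forall fun z => ?_)
                rw [norm_mul, Real.norm_eq_abs (χ _), abs_of_nonneg (hχ.nonneg' _)]
                exact mul_le_of_le_one_right (norm_nonneg _) (hχ.le_one _)
              · filter_upwards [hF0] with z hz using mul_le_mul_of_nonneg_left (hψχ _) hz
          _ ≤ K * (Zs s ^ (1 / P) * s ^ ν) := h3
          _ ≤ K * (Zs s ^ (1 / P) * S ^ ν) := by gcongr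
          _ = _ := by ring
      have h5 : 0 < K * S ^ ν := by positivity
      rw [← Real.mul_rpow (by positivity) (hZnn s), ← div_eq_inv_mul]
      calc (Z s / (K * S ^ ν)) ^ P ≤ (Zs s ^ (1 / P)) ^ P := by
            refine Real.rpow_le_rpow (div_nonneg (hZnn s) h5.le) ?_ hP0.le
            rw [div_le_iff₀ h5, mul_comm]; exact h4
        _ = Zs s := by rw [← Real.rpow_mul hZ0, one_div_mul_cancel hP0.ne', Real.rpow_one])
  have h6 : Z (S / 2) ^ (1 - P) ≤ (S / 4 * (δ / K) ^ P) ^ (1 - P) :=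
    Real.rpow_le_rpow_of_nonpos hpos (hgrow _ (left_mem_Icc.2 (by linarith))) (by linarith)
  have h7 := hode.trans h6
  -- the inequality is solved for `S`
  have h8 : S ^ (P * (1 - ν)) ≤ B * δ ^ (-(P * (P - 1))) := by
    have hP1 : 0 < P - 1 := by linarith
    have e1 : (K * S ^ ν)⁻¹ ^ P = K ^ (-P) * S ^ (-(ν * P)) := by
      rw [Real.inv_rpow (by positivity), Real.mul_rpow hK.le (by positivity), mul_inv,
        ← Real.rpow_mul hS0.le, Real.rpow_neg hK.le, Real.rpow_neg hS0.le]
    have e2 : (S / 4 * (δ / K) ^ P) ^ (1 - P) =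
        S * S ^ (-P) * (4 ^ P / 4) * (δ ^ (-(P * (P - 1))) * K ^ (P * (P - 1))) := by
      rw [Real.mul_rpow (by positivity) (by positivity), Real.div_rpow hS0.le (by norm_num),
        ← Real.rpow_mul (by positivity), Real.div_rpow hδ.le hK.le,
        show P * (1 - P) = -(P * (P - 1)) by ring, Real.rpow_neg hK.le, div_inv_eq_mul,
        Real.rpow_sub hS0, Real.rpow_sub (by norm_num), Real.rpow_one, Real.rpow_one,
        Real.rpow_neg hS0.le]
      field_simp
    rw [e1, e2] at h7
    have e3 : S ^ (P * (1 - ν)) = S ^ P * S ^ (-(ν * P)) := by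
      rw [← Real.rpow_add hS0]; congr 1; ring
    have e4 : S ^ P * S ^ (-P) = 1 := by rw [← Real.rpow_add hS0, add_neg_cancel, Real.rpow_zero]
    have e5 : K ^ P * K ^ (-P) = 1 := by rw [← Real.rpow_add hK, add_neg_cancel, Real.rpow_zero]
    have h9 := mul_le_mul_of_nonneg_left h7
      (by positivity : 0 ≤ 4 * K ^ P * S ^ P / ((P - 1) * S))
    have e6 : 4 * K ^ P * S ^ P / ((P - 1) * S) *
        ((P - 1) * (K ^ (-P) * S ^ (-(ν * P))) * (3 * S / 4 - S / 2)) =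
        (K ^ P * K ^ (-P)) * (S ^ P * S ^ (-(ν * P))) := by field_simp; ring
    have e7 : 4 * K ^ P * S ^ P / ((P - 1) * S) *
        (S * S ^ (-P) * (4 ^ P / 4) * (δ ^ (-(P * (P - 1))) * K ^ (P * (P - 1)))) =
        (S ^ P * S ^ (-P)) * (4 ^ P * K ^ P * K ^ (P * (P - 1)) / (P - 1)) *
          δ ^ (-(P * (P - 1))) := by field_simp
    rw [e6, e7, e4, e5, one_mul, one_mul] at h9
    rw [e3]; exact h9
  have hPν : 0 < P * (1 - ν) := mul_pos hP0 (by linarith)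
  calc S = (S ^ (P * (1 - ν))) ^ (1 / (P * (1 - ν))) := by
        rw [← Real.rpow_mul hS0.le, mul_one_div_cancel hPν.ne', Real.rpow_one]
    _ ≤ (B * δ ^ (-(P * (P - 1)))) ^ (1 / (P * (1 - ν))) := by gcongr
    _ = _ := by
        rw [Real.mul_rpow hB0.le (by positivity), ← Real.rpow_mul hδ.le]
        congr 2
        have : 1 - ν ≠ 0 := by linarith
        field_simp

end Cutoff

end WaveSystem

/-! ### Common estimates for the system -/

namespace WaveSystem

open Filter Topology

variable {N : ℕ}

section Layer

variable {p q C T R b : ℝ} {χ ϖ : ℝ → ℝ}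

theorem layer_nonneg (hχ : IsCutoff p q C χ ϖ) (s : ℝ) (U : Space N × ℝ → ℝ) :
    0 ≤ layer T s R ϖ U :=
  integral_nonneg fun _ => mul_nonneg (Real.rpow_nonneg (abs_nonneg _) _) (hχ.nonneg _)

theorem layer_le (hχ : IsCutoff p q C χ ϖ) {s : ℝ} {G : ℝ → ℝ} (hb : 0 < b)
    (hG : ∀ y, b * |y| ^ s ≤ G y) {U : Space N × ℝ → ℝ}
    (hGU : Integrable (fun z => G (U z)) (slab N T)) :
    layer T s R ϖ U ≤ b⁻¹ * ∫ z, G (U z) * χ (z.2 / R) ∂(slab N T) := by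
  rw [← integral_const_mul]
  refine integral_mono_of_nonneg (Eventually.of_forall fun z =>
    mul_nonneg (Real.rpow_nonneg (abs_nonneg _) _) (hχ.nonneg _))
    ((hχ.integrable_mul' hGU).const_mul _) (Eventually.of_forall fun z => ?_)
  have h1 := hG (U z)
  have h2 : 0 ≤ |U z| ^ s := Real.rpow_nonneg (abs_nonneg _) _
  beta_reduce
  rw [inv_mul_eq_div, le_div_iff₀ hb]
  calc |U z| ^ s * ϖ (z.2 / R) * b = (b * |U z| ^ s) * ϖ (z.2 / R) := by ring
    _ ≤ G (U z) * χ (z.2 / R) := mul_le_mul h1 (hχ.le _) (hχ.nonneg _) (by nlinarith)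

theorem integrable_mul_time_rpow {c β : ℝ} (hc : 1 ≤ c) {H : Space N × ℝ → ℝ}
    (hH : Integrable H (slab N T)) : Integrable (fun z => H z * (c + z.2) ^ (-β)) (slab N T) := by
  refine hH.mul_bdd (c := (c + T) ^ |β|)
    ((measurable_snd.const_add c).pow_const _).aestronglyMeasurable ?_
  have hpos : ∀ᵐ z ∂(slab N T), z.2 ∈ Ioo 0 T := by
    rw [slab]
    exact Measure.quasiMeasurePreserving_snd.ae (ae_restrict_mem measurableSet_Ioo)
  filter_upwards [hpos] with z hz
  have h1 : 1 ≤ c + z.2 := by linarith [hz.1]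
  rw [Real.norm_eq_abs, abs_of_nonneg (Real.rpow_nonneg (by linarith) _)]
  calc (c + z.2) ^ (-β) ≤ (c + z.2) ^ |β| :=
        Real.rpow_le_rpow_of_exponent_le h1 (neg_le_abs β)
    _ ≤ (c + T) ^ |β| := Real.rpow_le_rpow (by linarith) (by linarith [hz.2]) (abs_nonneg _)

/-- The weight `ϖ(t/R)` is supported where `c + t` is comparable to `R`, so `R^β (c + t)^(-β)` can
be inserted at the cost of a constant, whatever the sign of `β`. -/
theorem layer_le_weighted (hχ : IsCutoff p q C χ ϖ) {s c β : ℝ} {G : ℝ → ℝ} (hb : 0 < b)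
    (hG : ∀ y, b * |y| ^ s ≤ G y) {U : Space N × ℝ → ℝ} (hc : 1 ≤ c) (hR : 1 ≤ R)
    (hGU : Integrable (fun z => G (U z)) (slab N T)) :
    layer T s R ϖ U ≤ (b⁻¹ * (2 * (c + 1)) ^ |β|) * R ^ β *
      ∫ z, G (U z) * (c + z.2) ^ (-β) * ϖ (z.2 / R) ∂(slab N T) := by
  have hR0 : 0 < R := by linarith
  rw [← integral_const_mul]
  refine integral_mono_of_nonneg (Eventually.of_forall fun z =>
    mul_nonneg (Real.rpow_nonneg (abs_nonneg _) _) (hχ.nonneg _))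
    ((hχ.integrable_mul (integrable_mul_time_rpow hc hGU)).const_mul _) ?_
  filter_upwards [ae_slab_pos N T] with z hz
  rcases (hχ.nonneg (z.2 / R)).eq_or_lt with h0 | h0
  · rw [← h0]; simp
  have hlo : R / 2 ≤ z.2 := by
    by_contra hlt
    push Not at hlt
    exact h0.ne' (hχ.left _ (by rw [div_le_iff₀ hR0]; linarith))
  have hhi : z.2 ≤ R := by
    by_contra hlt
    push Not at hlt
    exact h0.ne' (hχ.right _ (by rw [le_div_iff₀ hR0]; linarith))
  have hτ : 0 < c + z.2 := by linarith
  have h1 : 1 ≤ (2 * (c + 1)) ^ |β| * R ^ β * (c + z.2) ^ (-β) := by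
    have h2 : ((c + z.2) / R) ^ β ≤ (2 * (c + 1)) ^ |β| := by
      rcases le_total 0 β with hβ | hβ
      · rw [abs_of_nonneg hβ]
        refine Real.rpow_le_rpow (by positivity) ?_ hβ
        rw [div_le_iff₀ hR0]; nlinarith
      · rw [abs_of_nonpos hβ]
        calc ((c + z.2) / R) ^ β ≤ (1 / (2 * (c + 1))) ^ β := by
              refine Real.rpow_le_rpow_of_nonpos (by positivity) ?_ hβ
              rw [div_le_div_iff₀ (by positivity) hR0]; nlinarith
          _ = (2 * (c + 1)) ^ (-β) := by
              rw [one_div, Real.inv_rpow (by positivity), Real.rpow_neg (by positivity)]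
    have h3 : ((c + z.2) / R) ^ β * (R ^ β * (c + z.2) ^ (-β)) = 1 := by
      rw [Real.div_rpow hτ.le hR0.le, Real.rpow_neg hτ.le]
      have := (Real.rpow_pos_of_pos hτ β).ne'
      have := (Real.rpow_pos_of_pos hR0 β).ne'
      field_simp
    calc 1 = ((c + z.2) / R) ^ β * (R ^ β * (c + z.2) ^ (-β)) := h3.symm
      _ ≤ (2 * (c + 1)) ^ |β| * (R ^ β * (c + z.2) ^ (-β)) := by gcongr
      _ = _ := by ring
  have h2 : 0 ≤ |U z| ^ s := Real.rpow_nonneg (abs_nonneg _) _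
  calc |U z| ^ s * ϖ (z.2 / R) = b⁻¹ * (b * |U z| ^ s) * ϖ (z.2 / R) * 1 := by
        field_simp
    _ ≤ b⁻¹ * G (U z) * ϖ (z.2 / R) * ((2 * (c + 1)) ^ |β| * R ^ β * (c + z.2) ^ (-β)) := by
        have hG0 : 0 ≤ G (U z) := (by positivity : 0 ≤ b * |U z| ^ s).trans (hG _)
        gcongr
        exact hG _
    _ = _ := by ring

end Layer

/-- The estimates of both equations of the system with common constants. Here `H₁`, `H₂` are the
sources and `E₁`, `E₂` the corresponding energies in the transition layer. -/
structure Estimates (N : ℕ) (p q c d K T ε : ℝ) (χ ϖ : ℝ → ℝ) (H₁ H₂ : Space N × ℝ → ℝ)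
    (E₁ E₂ : ℝ → ℝ) : Prop where
  int₁ : Integrable H₁ (slab N T)
  int₂ : Integrable H₂ (slab N T)
  nonneg₁ : ∀ z, 0 ≤ H₁ z
  nonneg₂ : ∀ z, 0 ≤ H₂ z
  layer_nonneg₁ : ∀ R, 0 ≤ E₁ R
  layer_nonneg₂ : ∀ R, 0 ≤ E₂ R
  layer₁ : ∀ R, E₁ R ≤ K * ∫ z, H₁ z * χ (z.2 / R) ∂(slab N T)
  layer₂ : ∀ R, E₂ R ≤ K * ∫ z, H₂ z * χ (z.2 / R) ∂(slab N T)
  weighted₁ : ∀ R, 1 ≤ R → E₁ R ≤ K * (R ^ (((N : ℝ) - 1) / 2 - 1 / q) *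
    ∫ z, H₁ z * (c + z.2) ^ (-(((N : ℝ) - 1) / 2 - 1 / q)) * ϖ (z.2 / R) ∂(slab N T))
  weighted₂ : ∀ R, 1 ≤ R → E₂ R ≤ K * (R ^ (((N : ℝ) - 1) / 2 - 1 / p) *
    ∫ z, H₂ z * (c + z.2) ^ (-(((N : ℝ) - 1) / 2 - 1 / p)) * ϖ (z.2 / R) ∂(slab N T))
  const₁ : ∀ R, 1 ≤ R → R < T → ∫ z, H₁ z * χ (z.2 / R) ∂(slab N T) ≤
    K * (E₂ R ^ (1 / q) * R ^ ((N + 1) * (1 - 1 / q) - 2))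
  const₂ : ∀ R, 1 ≤ R → R < T → ∫ z, H₂ z * χ (z.2 / R) ∂(slab N T) ≤
    K * (E₁ R ^ (1 / p) * R ^ ((N + 1) * (1 - 1 / p) - 2))
  data₁ : ∀ R, 1 ≤ R → R < T →
    ε * d ≤ K * (E₂ R ^ (1 / q) * R ^ (N * (1 - 1 / q) - 1 - ((N : ℝ) - 1) / 2))
  data₂ : ∀ R, 1 ≤ R → R < T →
    ε * d ≤ K * (E₁ R ^ (1 / p) * R ^ (N * (1 - 1 / p) - 1 - ((N : ℝ) - 1) / 2))
  log₁ : ∀ R, 2 ≤ R → R < T →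
    ∫ z, H₁ z * (c + z.2) ^ (-(((N : ℝ) - 1) / 2 - 1 / q)) * χ (z.2 / R) ∂(slab N T) ≤
      K * (E₂ R ^ (1 / q) * R ^ (N * (1 - 1 / q) - 1 - ((N : ℝ) - 1) / 2)
        * Real.log R ^ (1 - 1 / q))
  log₂ : ∀ R, 2 ≤ R → R < T →
    ∫ z, H₂ z * (c + z.2) ^ (-(((N : ℝ) - 1) / 2 - 1 / p)) * χ (z.2 / R) ∂(slab N T) ≤
      K * (E₁ R ^ (1 / p) * R ^ (N * (1 - 1 / p) - 1 - ((N : ℝ) - 1) / 2)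
        * Real.log R ^ (1 - 1 / p))

theorem Estimates.symm {p q c d K T ε : ℝ} {χ ϖ : ℝ → ℝ} {H₁ H₂ : Space N × ℝ → ℝ}
    {E₁ E₂ : ℝ → ℝ} (h : Estimates N p q c d K T ε χ ϖ H₁ H₂ E₁ E₂) :
    Estimates N q p c d K T ε χ ϖ H₂ H₁ E₂ E₁ :=
  ⟨h.int₂, h.int₁, h.nonneg₂, h.nonneg₁, h.layer_nonneg₂, h.layer_nonneg₁, h.layer₂, h.layer₁,
    h.weighted₂, h.weighted₁, h.const₂, h.const₁, h.data₂, h.data₁, h.log₂, h.log₁⟩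

theorem norm_le_dataRadius {f₁ g₁ f₂ g₂ : Space N → ℝ} (hf₁ : IsCcSmooth f₁) (hg₁ : IsCcSmooth g₁)
    (hf₂ : IsCcSmooth f₂) (hg₂ : IsCcSmooth g₂) {x : Space N}
    (hx : x ∈ tsupport f₁ ∪ tsupport g₁ ∪ tsupport f₂ ∪ tsupport g₂) :
    ‖x‖ ≤ dataRadius f₁ g₁ f₂ g₂ := by
  have hc : IsCompact (tsupport f₁ ∪ tsupport f₂ ∪ tsupport g₁ ∪ tsupport g₂) :=
    ((hf₁.2.isCompact.union hf₂.2.isCompact).union hg₁.2.isCompact).union hg₂.2.isCompact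
  refine le_csSup (hc.image continuous_norm).bddAbove ⟨x, ?_, rfl⟩
  simp only [mem_union] at hx ⊢
  tauto

theorem eq_zero_of_norm_gt {f : Space N → ℝ} {r : ℝ} (h : ∀ x ∈ tsupport f, ‖x‖ ≤ r) (x : Space N)
    (hx : r < ‖x‖) : f x = 0 :=
  image_eq_zero_of_notMem_tsupport fun hm => absurd (h x hm) (not_le.2 hx)

theorem IsCcSmooth.integrable {f : Space N → ℝ} (h : IsCcSmooth f) : Integrable f :=
  h.1.continuous.integrable_of_hasCompactSupport h.2

/-- All constants are fixed before `ε`, `T` and the solution. A single time shift `c` is taken so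
large that the cone condition holds and the data terms of both equations are positive for every `M ≥
c`, as the translates require; `d` is the smaller data term at `c`, and `K` dominates all constants.
-/
theorem exists_estimates (hN : 1 ≤ N) {p q a b : ℝ} (hp : 1 < p) (hq : 1 < q)
    (ha : 0 < a) (hb : 0 < b) {G₁ G₂ : ℝ → ℝ}
    (hG₁ : Continuous G₁) (hG₂ : Continuous G₂) (hG₁0 : G₁ 0 = 0) (hG₂0 : G₂ 0 = 0)
    (hG₁p : ∀ s : ℝ, a * |s| ^ p ≤ G₁ s) (hG₂q : ∀ s : ℝ, b * |s| ^ q ≤ G₂ s)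
    {f₁ g₁ f₂ g₂ : Space N → ℝ}
    (hf₁ : IsCcSmooth f₁) (hg₁ : IsCcSmooth g₁) (hf₂ : IsCcSmooth f₂) (hg₂ : IsCcSmooth g₂)
    (hI₁ : 0 < ∫ x, g₁ x) (hI₂ : 0 < ∫ x, g₂ x) :
    ∃ C χ ϖ c d K, IsCutoff p q C χ ϖ ∧ 1 ≤ c ∧ 0 < d ∧ 0 < K ∧ ∀ ε : ℝ, 0 < ε → ∀ T : ℝ, 0 < T →
      ∀ u v : ℝ → L2 N, IsWeakSolution G₁ G₂ f₁ g₁ f₂ g₂ ε T u v →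
        SupportedInCone (dataRadius f₁ g₁ f₂ g₂) T u →
        SupportedInCone (dataRadius f₁ g₁ f₂ g₂) T v →
        ∃ H₁ H₂ E₁ E₂, Estimates N p q c d K T ε χ ϖ H₁ H₂ E₁ E₂ := by
  obtain ⟨C, χ, ϖ, hχ⟩ := exists_isCutoff hp hq
  set r := dataRadius f₁ g₁ f₂ g₂ with hrdef
  have hr : 0 ≤ r := Real.sSup_nonneg fun y hy => by
    obtain ⟨x, -, rfl⟩ := hy; exact norm_nonneg x
  have zf₁ : ∀ x, r < ‖x‖ → f₁ x = 0 := eq_zero_of_norm_gt fun x hx =>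
    norm_le_dataRadius hf₁ hg₁ hf₂ hg₂ (by simp [hx])
  have zg₁ : ∀ x, r < ‖x‖ → g₁ x = 0 := eq_zero_of_norm_gt fun x hx =>
    norm_le_dataRadius hf₁ hg₁ hf₂ hg₂ (by simp [hx])
  have zf₂ : ∀ x, r < ‖x‖ → f₂ x = 0 := eq_zero_of_norm_gt fun x hx =>
    norm_le_dataRadius hf₁ hg₁ hf₂ hg₂ (by simp [hx])
  have zg₂ : ∀ x, r < ‖x‖ → g₂ x = 0 := eq_zero_of_norm_gt fun x hx =>
    norm_le_dataRadius hf₁ hg₁ hf₂ hg₂ (by simp [hx])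
  set α : ℝ := ((N : ℝ) - 1) / 2 with hα
  have hα2 : 2 * α = N - 1 := by rw [hα]; ring
  have hα0 : 0 ≤ α := by
    have : (1 : ℝ) ≤ N := by exact_mod_cast hN
    rw [hα]; linarith
  obtain ⟨M₁, hM₁⟩ := eventually_atTop.1
    (eventually_dataTerm_pos hr hα0 hf₁.integrable hg₁.integrable zf₁ zg₁ hI₁)
  obtain ⟨M₂, hM₂⟩ := eventually_atTop.1
    (eventually_dataTerm_pos hr hα0 hf₂.integrable hg₂.integrable zf₂ zg₂ hI₂)
  set c := max (r + 1) (max M₁ M₂) with hc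
  have hcr : r + 1 ≤ c := le_max_left _ _
  have hc1 : 1 ≤ c := by linarith
  have hcM₁ : M₁ ≤ c := (le_max_left _ _).trans (le_max_right _ _)
  have hcM₂ : M₂ ≤ c := (le_max_right _ _).trans (le_max_right _ _)
  have hd₁ := hM₁ c hcM₁
  have hd₂ := hM₂ c hcM₂
  obtain ⟨A₁, hA₁, A₁h⟩ := exists_estimate_const (N := N) hχ hq hr hcr
  obtain ⟨A₂, hA₂, A₂h⟩ := exists_estimate_const (N := N) hχ.symm hp hr hcr
  obtain ⟨B₁, hB₁, B₁h⟩ := exists_estimate_data (N := N) hχ hq hr hcr hα0 hα2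
  obtain ⟨B₂, hB₂, B₂h⟩ := exists_estimate_data (N := N) hχ.symm hp hr hcr hα0 hα2
  obtain ⟨D₁, hD₁, D₁h⟩ := exists_estimate_log (N := N) hχ hq hr hcr hα0 hα2
  obtain ⟨D₂, hD₂, D₂h⟩ := exists_estimate_log (N := N) hχ.symm hp hr hcr hα0 hα2
  set W₁ := a⁻¹ * (2 * (c + 1)) ^ |α - 1 / q|
  set W₂ := b⁻¹ * (2 * (c + 1)) ^ |α - 1 / p|
  have hW₁ : 0 < W₁ := by positivity
  have hW₂ : 0 < W₂ := by positivity
  have ha' := inv_pos.2 ha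
  have hb' := inv_pos.2 hb
  set K := A₁ + A₂ + B₁ + B₂ + D₁ + D₂ + W₁ + W₂ + a⁻¹ + b⁻¹ with hK
  refine ⟨C, χ, ϖ, c, min (dataTerm α c f₁ g₁) (dataTerm α c f₂ g₂), K, hχ, hc1, lt_min hd₁ hd₂,
    by positivity, fun ε hε T hT u v huv hcu hcv => ?_⟩
  obtain ⟨U, V, hU, hV⟩ := huv.exists_testedWave hT hp hq ha hb hG₁ hG₂ hG₁0 hG₂0 hG₁p hG₂q hcu hcv
  have hUq := integrable_rpow_of_le hb hG₂q hU.measurable hV.integrable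
  have hVp := integrable_rpow_of_le ha hG₁p hV.measurable hU.integrable
  have up : ∀ {x y k : ℝ}, x ≤ k * y → 0 ≤ y → k ≤ K → x ≤ K * y := fun h hy hk =>
    h.trans (mul_le_mul_of_nonneg_right hk hy)
  have l₁ : ∀ R, 0 ≤ layer T p R ϖ V := fun R => layer_nonneg hχ p V
  have l₂ : ∀ R, 0 ≤ layer T q R ϖ U := fun R => layer_nonneg hχ q U
  have hτ : ∀ (H : Space N × ℝ → ℝ) (β R : ℝ) (h : ℝ → ℝ), (∀ z, 0 ≤ H z) → (∀ y, 0 ≤ h y) →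
      0 ≤ ∫ z, H z * (c + z.2) ^ (-β) * h (z.2 / R) ∂(slab N T) := fun H β R h h1 h2 => by
    refine integral_nonneg_of_ae ?_
    filter_upwards [ae_slab_pos N T] with z hz
    exact mul_nonneg (mul_nonneg (h1 z) (Real.rpow_nonneg (by linarith) _)) (h2 _)
  have hH : ∀ (H : Space N × ℝ → ℝ) (R : ℝ), (∀ z, 0 ≤ H z) →
      0 ≤ ∫ z, H z * χ (z.2 / R) ∂(slab N T) := fun H R h1 =>
    integral_nonneg fun z => mul_nonneg (h1 z) (hχ.nonneg' _)
  refine ⟨fun z => G₁ (V z), fun z => G₂ (U z), fun R => layer T p R ϖ V, fun R => layer T q R ϖ U,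
    ⟨hU.integrable, hV.integrable, hU.nonneg, hV.nonneg, l₁, l₂, fun R => ?_, fun R => ?_,
    fun R hR => ?_, fun R hR => ?_, fun R hR hRT => ?_, fun R hR hRT => ?_, fun R hR hRT => ?_,
    fun R hR hRT => ?_, fun R hR hRT => ?_, fun R hR hRT => ?_⟩⟩
  · exact up (layer_le hχ ha hG₁p hU.integrable) (hH _ R hU.nonneg) (by rw [hK]; linarith)
  · exact up (layer_le hχ hb hG₂q hV.integrable) (hH _ R hV.nonneg) (by rw [hK]; linarith)
  · have h1 := layer_le_weighted (R := R) (β := α - 1 / q) hχ ha hG₁p hc1 hR hU.integrable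
    rw [mul_assoc] at h1
    exact up h1 (mul_nonneg (by positivity) (hτ _ _ R ϖ hU.nonneg hχ.nonneg)) (by rw [hK]; linarith)
  · have h1 := layer_le_weighted (R := R) (β := α - 1 / p) hχ hb hG₂q hc1 hR hV.integrable
    rw [mul_assoc] at h1
    exact up h1 (mul_nonneg (by positivity) (hτ _ _ R ϖ hV.nonneg hχ.nonneg)) (by rw [hK]; linarith)
  · have h1 := A₁h T ε f₁ g₁ _ U hU hUq zf₁ zg₁ R hR hRT
    exact up (by nlinarith) (mul_nonneg (Real.rpow_nonneg (l₂ R) _) (by positivity))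
      (by rw [hK]; linarith : A₁ ≤ K)
  · have h1 := A₂h T ε f₂ g₂ _ V hV hVp zf₂ zg₂ R hR hRT
    exact up (by nlinarith) (mul_nonneg (Real.rpow_nonneg (l₁ R) _) (by positivity))
      (by rw [hK]; linarith : A₂ ≤ K)
  · have h1 := B₁h T ε f₁ g₁ _ U hU hUq zf₁ zg₁ R hR hRT
    exact (mul_le_mul_of_nonneg_left (min_le_left _ _) hε.le).trans (up h1
      (mul_nonneg (Real.rpow_nonneg (l₂ R) _) (by positivity)) (by rw [hK]; linarith))
  · have h1 := B₂h T ε f₂ g₂ _ V hV hVp zf₂ zg₂ R hR hRT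
    exact (mul_le_mul_of_nonneg_left (min_le_right _ _) hε.le).trans (up h1
      (mul_nonneg (Real.rpow_nonneg (l₁ R) _) (by positivity)) (by rw [hK]; linarith))
  · have h1 := D₁h T ε f₁ g₁ _ U hU hε.le hUq zf₁ zg₁ (fun M hM => (hM₁ M (hcM₁.trans hM)).le)
      R hR hRT
    have hlog := Real.log_nonneg (by linarith : 1 ≤ R)
    exact up h1 (mul_nonneg (mul_nonneg (Real.rpow_nonneg (l₂ R) _) (by positivity))
      (Real.rpow_nonneg hlog _)) (by rw [hK]; linarith)
  · have h1 := D₂h T ε f₂ g₂ _ V hV hε.le hVp zf₂ zg₂ (fun M hM => (hM₂ M (hcM₂.trans hM)).le)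
      R hR hRT
    have hlog := Real.log_nonneg (by linarith : 1 ≤ R)
    exact up h1 (mul_nonneg (mul_nonneg (Real.rpow_nonneg (l₁ R) _) (by positivity))
      (Real.rpow_nonneg hlog _)) (by rw [hK]; linarith)

end WaveSystem

/-! ### Elimination of the energies and the lifespan bounds -/

namespace WaveSystem

open Filter Topology

variable {N : ℕ}

theorem log_le_of_le_mul_rpow {x A y R s t : ℝ} (hx : 0 < x) (hA : 0 < A) (hy : 0 < y) (hR : 0 < R)
    (h : x ≤ A * (y ^ s * R ^ t)) :
    Real.log x ≤ Real.log A + s * Real.log y + t * Real.log R := by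
  have h1 := Real.log_le_log hx h
  rw [Real.log_mul hA.ne' (by positivity), Real.log_mul (by positivity) (by positivity),
    Real.log_rpow hy, Real.log_rpow hR] at h1
  linarith

/-- Elimination of the two unknown energies in the subcritical case. -/
theorem subcritical_elimination {p q n k l e₁ e₂ e ρ : ℝ} (hp : 1 < p) (hq : 1 < q)
    (h1 : e₁ ≤ k + 1 / q * e₂ + ((n + 1) * (1 - 1 / q) - 2) * ρ)
    (h2 : e₂ ≤ k + 1 / p * e₁ + ((n + 1) * (1 - 1 / p) - 2) * ρ)
    (h3 : e ≤ l + 1 / p * e₁ + (n * (1 - 1 / p) - 1 - (n - 1) / 2) * ρ) :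
    e ≤ l + (1 + 1 / q) * k * q * (p * q - 1)⁻¹
      - ((q + 2 + 1 / p) * (q * p - 1)⁻¹ - (n - 1) / 2) * ρ := by
  have hp0 : 0 < p := by linarith
  have hq0 : 0 < q := by linarith
  have hpq : 0 < p * q - 1 := by nlinarith
  have hne : p * q - 1 ≠ 0 := hpq.ne'
  have hne' : q * p - 1 ≠ 0 := by rwa [mul_comm q p]
  -- Inserting the second inequality into the first; `pq > 1` lets the term in `e₁` be absorbed on
  -- the left.
  have h4 : e₁ * (1 - 1 / (p * q)) ≤ (1 + 1 / q) * k
      + (((n + 1) * (1 - 1 / p) - 2) / q + (n + 1) * (1 - 1 / q) - 2) * ρ := by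
    have h5 := mul_le_mul_of_nonneg_left h2 (by positivity : 0 ≤ 1 / q)
    have h6 : e₁ * (1 - 1 / (p * q)) = e₁ - 1 / q * (1 / p * e₁) := by field_simp
    rw [h6]
    calc e₁ - 1 / q * (1 / p * e₁) ≤ k + 1 / q * (k + 1 / p * e₁ + ((n + 1) * (1 - 1 / p) - 2) * ρ)
          + ((n + 1) * (1 - 1 / q) - 2) * ρ - 1 / q * (1 / p * e₁) := by linarith
      _ = _ := by ring
  have h7 := mul_le_mul_of_nonneg_left h4 (by positivity : 0 ≤ q * (p * q - 1)⁻¹)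
  have h8 : q * (p * q - 1)⁻¹ * (e₁ * (1 - 1 / (p * q))) = 1 / p * e₁ := by
    field_simp
  rw [h8] at h7
  refine h3.trans (le_of_sub_nonneg ?_)
  have h9 : q * p - 1 = p * q - 1 := by ring
  have key : l + (1 + 1 / q) * k * q * (p * q - 1)⁻¹
      - ((q + 2 + 1 / p) * (q * p - 1)⁻¹ - (n - 1) / 2) * ρ
      - (l + 1 / p * e₁ + (n * (1 - 1 / p) - 1 - (n - 1) / 2) * ρ) =
      q * (p * q - 1)⁻¹ * ((1 + 1 / q) * k
        + (((n + 1) * (1 - 1 / p) - 2) / q + (n + 1) * (1 - 1 / q) - 2) * ρ) - 1 / p * e₁ := by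
    rw [h9]
    field_simp
    ring
  rw [key]
  linarith

/-- The data estimates force both energies to be strictly positive, so logarithms may be taken.
Using `data₂` produces `FSS N q p`; the other exponent is obtained through `Estimates.symm`. -/
theorem Estimates.log_le {p q c d K T ε R : ℝ} {χ ϖ : ℝ → ℝ} {H₁ H₂ : Space N × ℝ → ℝ}
    {E₁ E₂ : ℝ → ℝ} (h : Estimates N p q c d K T ε χ ϖ H₁ H₂ E₁ E₂) (hp : 1 < p) (hq : 1 < q)
    (hd : 0 < d) (hK : 0 < K) (hε : 0 < ε) (hR : 1 ≤ R) (hRT : R < T) :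
    Real.log ε ≤ Real.log K - Real.log d + (1 + 1 / q) * Real.log (K * K) * q * (p * q - 1)⁻¹
      - FSS N q p * Real.log R := by
  have hR0 : 0 < R := by linarith
  have hp0 : (1 / p) ≠ 0 := by positivity
  have hq0 : (1 / q) ≠ 0 := by positivity
  have b1 := h.data₁ R hR hRT
  have b2 := h.data₂ R hR hRT
  have hεd : 0 < ε * d := mul_pos hε hd
  have hE₁ : 0 < E₁ R := by
    refine (h.layer_nonneg₁ R).lt_of_ne fun h0 => ?_
    rw [← h0, Real.zero_rpow hp0, zero_mul, mul_zero] at b2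
    linarith
  have hE₂ : 0 < E₂ R := by
    refine (h.layer_nonneg₂ R).lt_of_ne fun h0 => ?_
    rw [← h0, Real.zero_rpow hq0, zero_mul, mul_zero] at b1
    linarith
  have a1 : E₁ R ≤ K * K * (E₂ R ^ (1 / q) * R ^ (((N : ℝ) + 1) * (1 - 1 / q) - 2)) := by
    rw [mul_assoc]
    exact (h.layer₁ R).trans (mul_le_mul_of_nonneg_left (h.const₁ R hR hRT) hK.le)
  have a2 : E₂ R ≤ K * K * (E₁ R ^ (1 / p) * R ^ (((N : ℝ) + 1) * (1 - 1 / p) - 2)) := by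
    rw [mul_assoc]
    exact (h.layer₂ R).trans (mul_le_mul_of_nonneg_left (h.const₂ R hR hRT) hK.le)
  have l3 := log_le_of_le_mul_rpow hεd hK hE₁ hR0 b2
  rw [Real.log_mul hε.ne' hd.ne'] at l3
  have := subcritical_elimination (e := Real.log ε) (l := Real.log K - Real.log d) hp hq
    (log_le_of_le_mul_rpow hE₁ (mul_pos hK hK) hE₂ hR0 a1)
    (log_le_of_le_mul_rpow hE₂ (mul_pos hK hK) hE₁ hR0 a2) (by linarith)
  rw [FSS]
  exact this

theorem exists_subcritical_bound {p q c d K : ℝ} {χ ϖ : ℝ → ℝ} (hp : 1 < p) (hq : 1 < q)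
    (hd : 0 < d) (hK : 0 < K) (hF : 0 < FSS N q p) : ∃ A, 0 < A ∧ ∀ (T ε : ℝ)
      (H₁ H₂ : Space N × ℝ → ℝ) (E₁ E₂ : ℝ → ℝ), Estimates N p q c d K T ε χ ϖ H₁ H₂ E₁ E₂ →
      0 < ε → ε ≤ 1 → 0 < T → T ≤ A * ε ^ (-(FSS N q p)⁻¹) := by
  set k := Real.log K - Real.log d + (1 + 1 / q) * Real.log (K * K) * q * (p * q - 1)⁻¹
  set Γ := FSS N q p
  refine ⟨2 * Real.exp (|k| / Γ), by positivity, fun T ε H₁ H₂ E₁ E₂ h hε hε1 hT => ?_⟩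
  have h1 : 1 ≤ ε ^ (-Γ⁻¹) :=
    Real.one_le_rpow_of_pos_of_le_one_of_nonpos hε hε1 (by simp [hF.le])
  have h2 : 1 ≤ Real.exp (|k| / Γ) := Real.one_le_exp (by positivity)
  rcases lt_or_ge T 2 with hT2 | hT2
  · nlinarith
  -- The scale must satisfy `1 ≤ R < T`, so `R = T/2` is available once `T ≥ 2`; smaller `T` is
  -- covered by the factor `2` in the constant.
  · have h3 := h.log_le hp hq hd hK hε (R := T / 2) (by linarith) (by linarith)
    have h4 : Real.log (T / 2) ≤ |k| / Γ + -Γ⁻¹ * Real.log ε := by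
      rw [← mul_le_mul_iff_right₀ hF]
      have : Γ * (|k| / Γ + -Γ⁻¹ * Real.log ε) = |k| - Real.log ε := by field_simp; ring
      rw [this]
      have := le_abs_self k
      linarith
    have h5 : T / 2 ≤ Real.exp (|k| / Γ) * ε ^ (-Γ⁻¹) := by
      rw [← Real.exp_log (by linarith : 0 < T / 2), Real.rpow_def_of_pos hε, ← Real.exp_add,
        mul_comm (Real.log ε)]
      exact Real.exp_le_exp.2 h4
    linarith

/-- Lifespans with `log T ≤ 4` are absorbed by the summand `4`, because `ε ≤ 1` makes the power of
`ε` at least `1`. -/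
theorem exp_bound_of_log_bound {A T ε d e : ℝ} (hA : 0 < A) (hd : 0 < d) (hε : 0 < ε) (hε1 : ε ≤ 1)
    (hT : 0 < T) (he : 0 ≤ e) (h : 4 ≤ Real.log T → Real.log T ≤ A * (ε * d) ^ (-e)) :
    T ≤ Real.exp ((A * d ^ (-e) + 4) * ε ^ (-e)) := by
  have h1 : 1 ≤ ε ^ (-e) := Real.one_le_rpow_of_pos_of_le_one_of_nonpos hε hε1 (by linarith)
  have h2 : 0 < d ^ (-e) := Real.rpow_pos_of_pos hd _
  rw [← Real.exp_log hT]
  refine Real.exp_le_exp.2 ?_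
  rcases le_total 4 (Real.log T) with h4 | h4
  · have := h h4
    rw [Real.mul_rpow hε.le hd.le] at this
    nlinarith
  · have : 0 ≤ A * d ^ (-e) * ε ^ (-e) := by positivity
    nlinarith

/-- Write `X` for the layer integral of the weighted source `H₁`. Then `E₁ ≲ R^β X`, and the
constant-solution estimate for the second equation bounds `E₂` by a power of `R` times `X^(1/p)`.
Inserted into `data₁` and `log₁`, this gives the two hypotheses of the logarithmic mechanism with `P
= pq` and `ν = 1 - 1/q`, since every power of `R` cancels when `FSS N p q = 0`. -/
theorem exists_critical_bound {p q c d K C : ℝ} {χ ϖ : ℝ → ℝ} (hχ : IsCutoff p q C χ ϖ)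
    (hp : 1 < p) (hq : 1 < q) (hc : 1 ≤ c) (hd : 0 < d) (hK : 0 < K) (hF : FSS N p q = 0) :
    ∃ A, 0 < A ∧ ∀ (T ε : ℝ)
      (H₁ H₂ : Space N × ℝ → ℝ) (E₁ E₂ : ℝ → ℝ), Estimates N p q c d K T ε χ ϖ H₁ H₂ E₁ E₂ →
      0 < ε → ε ≤ 1 → 0 < T → T ≤ Real.exp (A * ε ^ (-(q * (p * q - 1)))) := by
  have hp0 : 0 < p := by linarith
  have hq0 : 0 < q := by linarith
  have hpq : 1 < p * q := by nlinarith
  have hq1 : 1 / q < 1 := by rw [div_lt_one hq0]; exact hq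
  set M : ℝ := (K * K * K ^ (1 / p)) ^ (1 / q) with hM
  have hM0 : 0 < M := by positivity
  obtain ⟨A, hA, hlog⟩ := hχ.exists_log_bound (N := N) (P := p * q) (ν := 1 - 1 / q) (K := K * M)
    hpq (by linarith) (by linarith [show 0 < 1 / q by positivity]) (by positivity)
  have he : (p * q - 1) / (1 - (1 - 1 / q)) = q * (p * q - 1) := by field_simp; ring
  rw [he] at hlog
  refine ⟨A * d ^ (-(q * (p * q - 1))) + 4, by positivity, fun T ε H₁ H₂ E₁ E₂ h hε hε1 hT => ?_⟩
  set β := ((N : ℝ) - 1) / 2 - 1 / q with hβ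
  have hexp : (β / p + ((N + 1) * (1 - 1 / p) - 2)) / q +
      (N * (1 - 1 / q) - 1 - ((N : ℝ) - 1) / 2) = 0 := by
    have h1 : ((N : ℝ) - 1) / 2 * (p * q - 1) = p + 2 + 1 / q := by
      rw [FSS, sub_eq_zero] at hF
      rw [← hF, mul_assoc, inv_mul_cancel₀ (by linarith), mul_one]
    have h2 : (β / p + ((N + 1) * (1 - 1 / p) - 2)) / q +
        (N * (1 - 1 / q) - 1 - ((N : ℝ) - 1) / 2) =
        (((N : ℝ) - 1) / 2 * (p * q - 1) - (p + 2 + 1 / q)) / (p * q) := by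
      rw [hβ]; field_simp; ring
    rw [h2, h1, sub_self, zero_div]
  have hF0 : ∀ᵐ z ∂(slab N T), 0 ≤ H₁ z * (c + z.2) ^ (-β) := by
    filter_upwards [ae_slab_pos N T] with z hz
    exact mul_nonneg (h.nonneg₁ z) (Real.rpow_nonneg (by linarith) _)
  set Xs : ℝ → ℝ := fun R => ∫ z, H₁ z * (c + z.2) ^ (-β) * ϖ (z.2 / R) ∂(slab N T) with hXs
  have hXs0 : ∀ R, 0 ≤ Xs R := fun R => integral_nonneg_of_ae (by
    filter_upwards [hF0] with z hz using mul_nonneg hz (hχ.nonneg _))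
  have key : ∀ R, 1 ≤ R → R < T →
      E₂ R ^ (1 / q) * R ^ (N * (1 - 1 / q) - 1 - ((N : ℝ) - 1) / 2) ≤
        M * Xs R ^ (1 / (p * q)) := fun R hR hRT => by
    have hR0 : 0 < R := by linarith
    have h1 : E₁ R ^ (1 / p) ≤ K ^ (1 / p) * (R ^ (β / p) * Xs R ^ (1 / p)) := by
      calc E₁ R ^ (1 / p) ≤ (K * (R ^ β * Xs R)) ^ (1 / p) :=
            Real.rpow_le_rpow (h.layer_nonneg₁ R) (h.weighted₁ R hR) (by positivity)
        _ = _ := by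
            rw [Real.mul_rpow hK.le (mul_nonneg (by positivity) (hXs0 R)),
              Real.mul_rpow (by positivity) (hXs0 R), ← Real.rpow_mul hR0.le, mul_one_div]
    have h2 : E₂ R ≤ K * K * K ^ (1 / p) *
        (R ^ (β / p + ((N + 1) * (1 - 1 / p) - 2)) * Xs R ^ (1 / p)) := by
      calc E₂ R ≤ K * (K * (E₁ R ^ (1 / p) * R ^ (((N : ℝ) + 1) * (1 - 1 / p) - 2))) :=
            (h.layer₂ R).trans (mul_le_mul_of_nonneg_left (h.const₂ R hR hRT) hK.le)
        _ ≤ K * (K * ((K ^ (1 / p) * (R ^ (β / p) * Xs R ^ (1 / p))) *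
              R ^ (((N : ℝ) + 1) * (1 - 1 / p) - 2))) := by gcongr
        _ = _ := by rw [Real.rpow_add hR0]; ring
    have hXp := Real.rpow_nonneg (hXs0 R) (1 / p)
    calc E₂ R ^ (1 / q) * R ^ (N * (1 - 1 / q) - 1 - ((N : ℝ) - 1) / 2)
        ≤ (K * K * K ^ (1 / p) * (R ^ (β / p + ((N + 1) * (1 - 1 / p) - 2)) *
            Xs R ^ (1 / p))) ^ (1 / q) * R ^ (N * (1 - 1 / q) - 1 - ((N : ℝ) - 1) / 2) := by
          gcongr
          exact h.layer_nonneg₂ R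
      _ = M * Xs R ^ (1 / (p * q)) * (R ^ ((β / p + ((N + 1) * (1 - 1 / p) - 2)) / q) *
            R ^ (N * (1 - 1 / q) - 1 - ((N : ℝ) - 1) / 2)) := by
          rw [Real.mul_rpow (by positivity) (by positivity), Real.mul_rpow (by positivity) hXp,
            ← Real.rpow_mul hR0.le, ← Real.rpow_mul (hXs0 R), mul_one_div, one_div_mul_one_div]
          ring
      _ = M * Xs R ^ (1 / (p * q)) := by
          rw [← Real.rpow_add hR0, hexp, Real.rpow_zero, mul_one]
  refine exp_bound_of_log_bound hA hd hε hε1 hT (by nlinarith) fun hS =>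
    hlog T (ε * d) (fun z => H₁ z * (c + z.2) ^ (-β)) (by positivity)
      (integrable_mul_time_rpow hc h.int₁) hF0 (fun R hR hRT => ?_) (fun R hR hRT => ?_) hT hS
  · rw [mul_assoc]
    exact (h.data₁ R (by linarith) hRT).trans
      (mul_le_mul_of_nonneg_left (key R (by linarith) hRT) hK.le)
  · have hl := Real.rpow_nonneg (Real.log_nonneg (by linarith : 1 ≤ R)) (1 - 1 / q)
    calc _ ≤ K * (E₂ R ^ (1 / q) * R ^ (N * (1 - 1 / q) - 1 - ((N : ℝ) - 1) / 2)
        * Real.log R ^ (1 - 1 / q)) := h.log₁ R hR hRT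
      _ ≤ K * ((M * Xs R ^ (1 / (p * q))) * Real.log R ^ (1 - 1 / q)) :=
        mul_le_mul_of_nonneg_left (mul_le_mul_of_nonneg_right (key R (by linarith) hRT) hl)
          hK.le
      _ = _ := by ring

/-- For equal exponents the weights of both equations agree, and the weighted bounds for `E₁` and
`E₂` go directly into `data₁`, `log₁` and `log₂`. Applying the mechanism to the sum of the weighted
sources closes the argument with `P = p`, which improves `p(p² - 1)` to `p(p - 1)`. -/
theorem exists_critical_bound_diag {p c d K C : ℝ} {χ ϖ : ℝ → ℝ} (hχ : IsCutoff p p C χ ϖ)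
    (hp : 1 < p) (hc : 1 ≤ c) (hd : 0 < d) (hK : 0 < K) (hF : FSS N p p = 0) :
    ∃ A, 0 < A ∧ ∀ (T ε : ℝ)
      (H₁ H₂ : Space N × ℝ → ℝ) (E₁ E₂ : ℝ → ℝ), Estimates N p p c d K T ε χ ϖ H₁ H₂ E₁ E₂ →
      0 < ε → ε ≤ 1 → 0 < T → T ≤ Real.exp (A * ε ^ (-(p * (p - 1)))) := by
  have hp0 : 0 < p := by linarith
  have hp1 : 1 / p < 1 := by rw [div_lt_one hp0]; exact hp
  set M : ℝ := K ^ (1 / p) with hM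
  have hM0 : 0 < M := by positivity
  obtain ⟨A, hA, hlog⟩ := hχ.exists_log_bound (N := N) (P := p) (ν := 1 - 1 / p) (K := 2 * (K * M))
    hp (by linarith) (by linarith [show 0 < 1 / p by positivity]) (by positivity)
  have he : (p - 1) / (1 - (1 - 1 / p)) = p * (p - 1) := by field_simp; ring
  rw [he] at hlog
  refine ⟨A * d ^ (-(p * (p - 1))) + 4, by positivity, fun T ε H₁ H₂ E₁ E₂ h hε hε1 hT => ?_⟩
  set β := ((N : ℝ) - 1) / 2 - 1 / p with hβ
  -- The total power of `R` vanishes: multiplied by `p + 1` it becomes the critical relation.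
  have hexp : β / p + (N * (1 - 1 / p) - 1 - ((N : ℝ) - 1) / 2) = 0 := by
    have h1 : ((N : ℝ) - 1) / 2 * (p * p - 1) = p + 2 + 1 / p := by
      rw [FSS, sub_eq_zero] at hF
      rw [← hF, mul_assoc, inv_mul_cancel₀ (by nlinarith), mul_one]
    have h2 : (β / p + (N * (1 - 1 / p) - 1 - ((N : ℝ) - 1) / 2)) * (p + 1) =
        (((N : ℝ) - 1) / 2 * (p * p - 1) - (p + 2 + 1 / p)) / p := by
      rw [hβ]; field_simp; ring
    rw [h1, sub_self, zero_div] at h2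
    exact (mul_eq_zero.1 h2).resolve_right (by linarith)
  have hF0 : ∀ H : Space N × ℝ → ℝ, (∀ z, 0 ≤ H z) →
      ∀ᵐ z ∂(slab N T), 0 ≤ H z * (c + z.2) ^ (-β) := fun H hH => by
    filter_upwards [ae_slab_pos N T] with z hz
    exact mul_nonneg (hH z) (Real.rpow_nonneg (by linarith) _)
  have i₁ := integrable_mul_time_rpow (β := β) hc h.int₁
  have i₂ := integrable_mul_time_rpow (β := β) hc h.int₂
  set Xs : ℝ → ℝ := fun R => ∫ z, H₁ z * (c + z.2) ^ (-β) * ϖ (z.2 / R) ∂(slab N T) with hXs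
  set Ys : ℝ → ℝ := fun R => ∫ z, H₂ z * (c + z.2) ^ (-β) * ϖ (z.2 / R) ∂(slab N T) with hYs
  have hXs0 : ∀ R, 0 ≤ Xs R := fun R => integral_nonneg_of_ae (by
    filter_upwards [hF0 _ h.nonneg₁] with z hz using mul_nonneg hz (hχ.nonneg _))
  have hYs0 : ∀ R, 0 ≤ Ys R := fun R => integral_nonneg_of_ae (by
    filter_upwards [hF0 _ h.nonneg₂] with z hz using mul_nonneg hz (hχ.nonneg _))
  have key : ∀ (E x y R : ℝ), 1 ≤ R → 0 ≤ E → 0 ≤ x → x ≤ y → E ≤ K * (R ^ β * x) →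
      E ^ (1 / p) * R ^ (N * (1 - 1 / p) - 1 - ((N : ℝ) - 1) / 2) ≤ M * y ^ (1 / p) := by
    intro E x y R hR hE hx hxy h1
    have hR0 : 0 < R := by linarith
    calc E ^ (1 / p) * R ^ (N * (1 - 1 / p) - 1 - ((N : ℝ) - 1) / 2)
        ≤ (K * (R ^ β * x)) ^ (1 / p) * R ^ (N * (1 - 1 / p) - 1 - ((N : ℝ) - 1) / 2) := by gcongr
      _ = M * x ^ (1 / p) * (R ^ (β / p) * R ^ (N * (1 - 1 / p) - 1 - ((N : ℝ) - 1) / 2)) := by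
          rw [Real.mul_rpow hK.le (by positivity), Real.mul_rpow (by positivity) hx,
            ← Real.rpow_mul hR0.le, mul_one_div]
          ring
      _ = M * x ^ (1 / p) := by rw [← Real.rpow_add hR0, hexp, Real.rpow_zero, mul_one]
      _ ≤ M * y ^ (1 / p) := by gcongr
  have hsumϖ : ∀ R, ∫ z, (H₁ z * (c + z.2) ^ (-β) + H₂ z * (c + z.2) ^ (-β)) * ϖ (z.2 / R)
      ∂(slab N T) = Xs R + Ys R := fun R => by
    simp_rw [add_mul]
    exact integral_add (hχ.integrable_mul i₁) (hχ.integrable_mul i₂)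
  refine exp_bound_of_log_bound hA hd hε hε1 hT (by nlinarith) fun hS =>
    hlog T (ε * d) (fun z => H₁ z * (c + z.2) ^ (-β) + H₂ z * (c + z.2) ^ (-β)) (by positivity)
      (i₁.add i₂) ?_ (fun R hR hRT => ?_) (fun R hR hRT => ?_) hT hS
  · filter_upwards [hF0 _ h.nonneg₁, hF0 _ h.nonneg₂] with z h1 h2 using add_nonneg h1 h2
  · rw [hsumϖ]
    have hR1 : 1 ≤ R := by linarith
    have h1 := key (E₂ R) (Ys R) (Xs R + Ys R) R hR1 (h.layer_nonneg₂ R) (hYs0 R)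
      (by linarith [hXs0 R]) (h.weighted₂ R hR1)
    have h2 := (h.data₁ R hR1 hRT).trans (mul_le_mul_of_nonneg_left h1 hK.le)
    have h3 := Real.rpow_nonneg (add_nonneg (hXs0 R) (hYs0 R)) (1 / p)
    have h4 : 0 ≤ K * (M * (Xs R + Ys R) ^ (1 / p)) := by positivity
    linarith
  · rw [hsumϖ]
    simp_rw [add_mul]
    rw [integral_add (hχ.integrable_mul' i₁) (hχ.integrable_mul' i₂)]
    have hR1 : 1 ≤ R := by linarith
    have hl := Real.rpow_nonneg (Real.log_nonneg hR1) (1 - 1 / p)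
    have h1 := key (E₂ R) (Ys R) (Xs R + Ys R) R hR1 (h.layer_nonneg₂ R) (hYs0 R)
      (by linarith [hXs0 R]) (h.weighted₂ R hR1)
    have h2 := key (E₁ R) (Xs R) (Xs R + Ys R) R hR1 (h.layer_nonneg₁ R) (hXs0 R)
      (by linarith [hYs0 R]) (h.weighted₁ R hR1)
    have h3 := (h.log₁ R hR hRT).trans
      (mul_le_mul_of_nonneg_left (mul_le_mul_of_nonneg_right h1 hl) hK.le)
    have h4 := (h.log₂ R hR hRT).trans
      (mul_le_mul_of_nonneg_left (mul_le_mul_of_nonneg_right h2 hl) hK.le)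
    linarith

/-- The sign is that of `p - q`, so for `p ≠ q` the member of the pair that vanishes in the critical
case is the one whose lifespan exponent is the minimum in the theorem. -/
theorem FSS_sub_swap (N : ℕ) {p q : ℝ} (hp : 1 < p) (hq : 1 < q) :
    FSS N p q - FSS N q p = (p - q) * ((1 + 1 / (p * q)) * (p * q - 1)⁻¹) := by
  rw [FSS, FSS, mul_comm q p]
  field_simp
  ring

end WaveSystem

/-! ### The three cases of the lifespan estimate -/

theorem mainTheorem6 (N : ℕ) (hN : 1 ≤ N) (p q a b : ℝ) (hp : 1 < p) (hq : 1 < q)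
    (ha : 0 < a) (hb : 0 < b) (G₁ G₂ : ℝ → ℝ)
    (hG₁ : ContDiff ℝ 1 G₁) (hG₂ : ContDiff ℝ 1 G₂) (hG₁0 : G₁ 0 = 0) (hG₂0 : G₂ 0 = 0)
    (hG₁p : ∀ s : ℝ, a * |s| ^ p ≤ G₁ s) (hG₂q : ∀ s : ℝ, b * |s| ^ q ≤ G₂ s)
    (f₁ g₁ f₂ g₂ : WaveSystem.Space N → ℝ)
    (hf₁ : WaveSystem.IsCcSmooth f₁) (hg₁ : WaveSystem.IsCcSmooth g₁)
    (hf₂ : WaveSystem.IsCcSmooth f₂) (hg₂ : WaveSystem.IsCcSmooth g₂)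
    (hI₁ : 0 < ∫ x, g₁ x) (hI₂ : 0 < ∫ x, g₂ x)
    (hΓ : 0 ≤ WaveSystem.ΓSS N p q) :
    ∃ ε₀ > (0 : ℝ), ∃ C > (0 : ℝ), ∀ ε : ℝ, 0 < ε → ε ≤ ε₀ → ∀ T : ℝ, 0 < T →
      ∀ u v : ℝ → WaveSystem.L2 N,
        WaveSystem.IsWeakSolution G₁ G₂ f₁ g₁ f₂ g₂ ε T u v →
        WaveSystem.SupportedInCone (WaveSystem.dataRadius f₁ g₁ f₂ g₂) T u →
        WaveSystem.SupportedInCone (WaveSystem.dataRadius f₁ g₁ f₂ g₂) T v →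
          (0 < WaveSystem.ΓSS N p q → T ≤ C * ε ^ (-(WaveSystem.ΓSS N p q)⁻¹)) ∧
          (WaveSystem.ΓSS N p q = 0 → p ≠ q →
            T ≤ Real.exp (C * ε ^ (-min (p * (p * q - 1)) (q * (p * q - 1))))) ∧
          (WaveSystem.ΓSS N p q = 0 → p = q →
            T ≤ Real.exp (C * ε ^ (-(p * (p - 1))))) := by
  obtain ⟨B, χ, ϖ, c, d, K, hχ, hc, hd, hK, hest⟩ := WaveSystem.exists_estimates hN hp hq ha hb
    hG₁.continuous hG₂.continuous hG₁0 hG₂0 hG₁p hG₂q hf₁ hg₁ hf₂ hg₂ hI₁ hI₂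
  have hpq : 0 < p * q - 1 := by nlinarith
  have hfac : 0 < (1 + 1 / (p * q)) * (p * q - 1)⁻¹ := by positivity
  have hswap := WaveSystem.FSS_sub_swap N hp hq
  -- The threshold `ε₀ = 1` only serves to make the negative powers of `ε` at least `1`, so that
  -- bounded lifespans are covered.
  refine ⟨1, one_pos, ?_⟩
  rcases hΓ.lt_or_eq with hpos | hzero
  · suffices ∃ A, 0 < A ∧ ∀ (T ε : ℝ) (H₁ H₂ : WaveSystem.Space N × ℝ → ℝ) (E₁ E₂ : ℝ → ℝ),
        WaveSystem.Estimates N p q c d K T ε χ ϖ H₁ H₂ E₁ E₂ →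
        0 < ε → ε ≤ 1 → 0 < T → T ≤ A * ε ^ (-(WaveSystem.ΓSS N p q)⁻¹) by
      obtain ⟨A, hA, h⟩ := this
      refine ⟨A, hA, fun ε hε hε1 T hT u v huv hcu hcv => ?_⟩
      obtain ⟨H₁, H₂, E₁, E₂, hE⟩ := hest ε hε T hT u v huv hcu hcv
      exact ⟨fun _ => h T ε H₁ H₂ E₁ E₂ hE hε hε1 hT, fun h0 => absurd h0 hpos.ne',
        fun h0 => absurd h0 hpos.ne'⟩
    rcases le_total (WaveSystem.FSS N p q) (WaveSystem.FSS N q p) with hle | hle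
    · have hmax : WaveSystem.ΓSS N p q = WaveSystem.FSS N q p := max_eq_right hle
      rw [hmax] at hpos ⊢
      exact WaveSystem.exists_subcritical_bound hp hq hd hK hpos
    · have hmax : WaveSystem.ΓSS N p q = WaveSystem.FSS N p q := max_eq_left hle
      rw [hmax] at hpos ⊢
      obtain ⟨A, hA, h⟩ := WaveSystem.exists_subcritical_bound (c := c) (χ := χ) (ϖ := ϖ)
        hq hp hd hK hpos
      exact ⟨A, hA, fun T ε H₁ H₂ E₁ E₂ hE => h T ε H₂ H₁ E₂ E₁ hE.symm⟩
  · by_cases hne : p = q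
    · subst hne
      have hF : WaveSystem.FSS N p p = 0 := by
        rw [hzero, WaveSystem.ΓSS, max_self]
      obtain ⟨A, hA, h⟩ := WaveSystem.exists_critical_bound_diag hχ hp hc hd hK hF
      refine ⟨A, hA, fun ε hε hε1 T hT u v huv hcu hcv => ?_⟩
      obtain ⟨H₁, H₂, E₁, E₂, hE⟩ := hest ε hε T hT u v huv hcu hcv
      exact ⟨fun h0 => absurd hzero h0.ne, fun _ h1 => absurd rfl h1,
        fun _ _ => h T ε H₁ H₂ E₁ E₂ hE hε hε1 hT⟩
    · suffices ∃ A, 0 < A ∧ ∀ (T ε : ℝ) (H₁ H₂ : WaveSystem.Space N × ℝ → ℝ) (E₁ E₂ : ℝ → ℝ),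
          WaveSystem.Estimates N p q c d K T ε χ ϖ H₁ H₂ E₁ E₂ →
          0 < ε → ε ≤ 1 → 0 < T →
          T ≤ Real.exp (A * ε ^ (-min (p * (p * q - 1)) (q * (p * q - 1)))) by
        obtain ⟨A, hA, h⟩ := this
        refine ⟨A, hA, fun ε hε hε1 T hT u v huv hcu hcv => ?_⟩
        obtain ⟨H₁, H₂, E₁, E₂, hE⟩ := hest ε hε T hT u v huv hcu hcv
        exact ⟨fun h0 => absurd hzero h0.ne, fun _ _ => h T ε H₁ H₂ E₁ E₂ hE hε hε1 hT,
          fun _ h1 => absurd h1 hne⟩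
      rcases lt_or_gt_of_ne hne with hlt | hlt
      · have hle : WaveSystem.FSS N p q ≤ WaveSystem.FSS N q p := by
          have := mul_neg_of_neg_of_pos (sub_neg.2 hlt) hfac
          linarith
        have hF : WaveSystem.FSS N q p = 0 := by
          rw [hzero, WaveSystem.ΓSS, max_eq_right hle]
        rw [min_eq_left (mul_le_mul_of_nonneg_right hlt.le hpq.le)]
        obtain ⟨A, hA, h⟩ := WaveSystem.exists_critical_bound hχ.symm hq hp hc hd hK hF
        rw [mul_comm q p] at h
        exact ⟨A, hA, fun T ε H₁ H₂ E₁ E₂ hE => h T ε H₂ H₁ E₂ E₁ hE.symm⟩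
      · have hle : WaveSystem.FSS N q p ≤ WaveSystem.FSS N p q := by
          have := mul_pos (sub_pos.2 hlt) hfac
          linarith
        have hF : WaveSystem.FSS N p q = 0 := by
          rw [hzero, WaveSystem.ΓSS, max_eq_left hle]
        rw [min_eq_right (mul_le_mul_of_nonneg_right hlt.le hpq.le)]
        exact WaveSystem.exists_critical_bound hχ hp hq hc hd hK hF
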